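/- Let $\bar P\subset\mathbb R^3$ be a convex polyhedron (the convex hull of a finite set, with non-empty interior), with vertices $v^1,\dots,v^m$, and let $P$ denote $\bar P$ without its vertices. A continuous tangent unit-vector field is a continuous map $n\colon P\to S^2$ which at every point of every face is orthogonal to the normal of that face; $C^\infty$ fields are those which are $C^\infty$ on $P$, up to the faces and edges. Two such fields are homotopic if they are joined by a continuous map $H\colon P\times[0,1]\to S^2$ all of whose slices $H_t$ are tangent. For a homotopy class $h$ of continuous tangent unit-vector fields let $$M(h)=\inf\Big\{\int_P \partial_a n_b\,\partial_a n_b\,dV \;:\; n\in h,\ \nabla n\in L^2(P)\Big\}\in[0,\infty]$$ ($\nabla n$ is the weak gradient). For a $C^\infty$ tangent unit-vector field $n$ and a vertex $v^a$, let $\Omega^a(n)=\frac1{4\pi}\int_{S^a} n^*\omega$, where $\omega$ is the area form of $S^2$ (total area $4\pi$) and $S^a$ is a planar section of $P$ which separates $v^a$ from the other vertices, oriented by the normal pointing away from $v^a$. Then every homotopy class $h$ contains a $C^\infty$ field, and the trapped area $\Omega^a(n)$ is the same number $\Omega^a$ for all $C^\infty$ fields $n\in h$ and all such sections $S^a$.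 Moreover the maximum below is attained, and $$M(h)\;\ge\;\max_{\{\xi\in\mathbb R^m\,:\;|\xi^a-\xi^{a'}|\le|v^a-v^{a'}|\ \text{for all } a,a'\}}\; 8\pi\sum_a\Omega^a\xi^a .$$ The maximum on the right is (non-negative and) positive if and only if the trapped areas $\Omega^a$ are not all zero. -/

import Mathlib

noncomputable section

/-- Euclidean three-space. -/
abbrev E3 : Type := EuclideanSpace ℝ (Fin 3)

/-- The triple product `(a × b) · c`, i.e. the determinant with rows `a`, `b`, `c`. -/
def tripleProduct (a b c : E3) : ℝ :=
  Matrix.det (Matrix.of ![a.ofLp, b.ofLp, c.ofLp])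

/-- A (three-dimensional) convex polyhedron in `ℝ³`, given by its finite set of vertices: a finite
set of points in convex position whose convex hull has an interior point. -/
structure ConvexPolyhedron where
  /-- The vertices. -/
  vertices : Finset E3
  convexIndependent : ConvexIndependent ℝ (Subtype.val : vertices → E3)
  solid : (interior (convexHull ℝ (vertices : Set E3))).Nonempty

namespace ConvexPolyhedron

/-- The closed polyhedron `P̄`, vertices included. -/
def body (P : ConvexPolyhedron) : Set E3 := convexHull ℝ (P.vertices : Set E3)

/-- `P`: the closed polyhedron without its vertices. -/
def domain (P : ConvexPolyhedron) : Set E3 := P.body \ (P.vertices : Set E3)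

/-- The set of points of the closed polyhedron at which the functional `⟪u, ·⟫` is maximal. -/
def face (P : ConvexPolyhedron) (u : E3) : Set E3 :=
  ContinuousLinearMap.toExposed (innerSL ℝ u) P.body

/-- `u` is the outward unit normal of a (two-dimensional) face of the polyhedron. -/
def IsFaceNormal (P : ConvexPolyhedron) (u : E3) : Prop :=
  ‖u‖ = 1 ∧ Module.finrank ℝ (vectorSpan ℝ (P.face u)) = 2

/-- Tangent boundary conditions: on each face the unit-vector field is tangent to that face. -/
def IsTangent (P : ConvexPolyhedron) (n : C(P.domain, Metric.sphere (0 : E3) 1)) : Prop :=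
  ∀ u : E3, P.IsFaceNormal u → ∀ x : P.domain, (x : E3) ∈ P.face u → inner ℝ u (n x : E3) = 0

/-- The space of continuous tangent unit-vector fields on the polyhedron without its vertices. -/
abbrev TangentField (P : ConvexPolyhedron) : Type :=
  {n : C(P.domain, Metric.sphere (0 : E3) 1) // P.IsTangent n}

/-- Homotopy through continuous tangent unit-vector fields. -/
instance tangentFieldSetoid (P : ConvexPolyhedron) : Setoid P.TangentField where
  r n n' := ContinuousMap.HomotopicWith n.1 n'.1 P.IsTangent
  iseqv :=
    { refl := fun n => ContinuousMap.HomotopicWith.refl n.1 n.2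
      symm := fun h => ContinuousMap.HomotopicWith.symm h
      trans := fun h h' => ContinuousMap.HomotopicWith.trans h h' }

/-- Homotopy classes of continuous tangent unit-vector fields. -/
abbrev HomotopyClass (P : ConvexPolyhedron) : Type := Quotient P.tangentFieldSetoid

variable {P : ConvexPolyhedron}

open Classical in
/-- The field as a function on all of `ℝ³`, extended by zero (the values outside the polyhedron
play no role). -/
def TangentField.toFun (n : P.TangentField) (x : E3) : E3 :=
  if hx : x ∈ P.domain then (n.1 ⟨x, hx⟩ : E3) else 0

/-- The field is of class `C^∞` on the polyhedron without its vertices, up to faces and edges. -/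
def TangentField.IsSmooth (n : P.TangentField) : Prop :=
  ContDiffOn ℝ ((⊤ : ℕ∞) : WithTop ℕ∞) n.toFun P.domain

/-- `G` is the weak gradient of `f` on the open set `U`: `G x w` is the weak derivative of `f` in
the direction `w`. -/
def IsWeakGradient (U : Set E3) (f : E3 → E3) (G : E3 → E3 →L[ℝ] E3) : Prop :=
  MeasureTheory.LocallyIntegrableOn G U MeasureTheory.volume ∧
  ∀ φ : E3 → ℝ, ContDiff ℝ ((⊤ : ℕ∞) : WithTop ℕ∞) φ → HasCompactSupport φ → tsupport φ ⊆ U →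
    ∀ w : E3, ∫ x in U, (fderiv ℝ φ x w) • f x = - ∫ x in U, φ x • G x w

/-- Membership in `W^{1,2}`: the weak gradient exists and is square integrable. -/
def TangentField.MemW12 (n : P.TangentField) : Prop :=
  ∃ G : E3 → E3 →L[ℝ] E3, IsWeakGradient (interior P.body) n.toFun G ∧
    MeasureTheory.MemLp G 2 (MeasureTheory.volume.restrict (interior P.body))

/-- The Dirichlet energy `E[n] = ∫ ∂ₐ n_b ∂ₐ n_b dV`. The weak gradient `G` is unique up to a null
set, so the infimum is just the value for any such `G`; it is `∞` if there is none. -/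
def TangentField.energy (n : P.TangentField) : ENNReal :=
  ⨅ (G : E3 → E3 →L[ℝ] E3) (_ : IsWeakGradient (interior P.body) n.toFun G),
    ∫⁻ x in interior P.body, ∑ i : Fin 3, ‖G x (EuclideanSpace.single i 1)‖ₑ ^ 2

/-- The minimal energy `M(h)`: the infimum of the energy over the fields in the class `h` that
belong to `W^{1,2}`. -/
def minEnergy (h : P.HomotopyClass) : ENNReal :=
  ⨅ (n : P.TangentField) (_ : (⟦n⟧ : P.HomotopyClass) = h) (_ : n.MemW12), n.energy

/-- An oriented planar section of the polyhedron separating the vertex `v` from all the others: the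
section by the plane `base + ℝ t₁ + ℝ t₂`, with `(t₁, t₂)` orthonormal and with the normal
`t₁ × t₂` pointing away from `v`. -/
structure VertexSection (P : ConvexPolyhedron) (v : P.vertices) where
  /-- A point of the plane. -/
  base : E3
  /-- First vector of the frame. -/
  t₁ : E3
  /-- Second vector of the frame. -/
  t₂ : E3
  norm_t₁ : ‖t₁‖ = 1
  norm_t₂ : ‖t₂‖ = 1
  orthogonal : inner ℝ t₁ t₂ = 0
  below : tripleProduct t₁ t₂ ((v : E3) - base) < 0
  above : ∀ w : P.vertices, w ≠ v → 0 < tripleProduct t₁ t₂ ((w : E3) - base)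

/-- The parametrization of the plane of the section by Cartesian coordinates. -/
def VertexSection.point {v : P.vertices} (S : VertexSection P v) (s : ℝ × ℝ) : E3 :=
  S.base + s.1 • S.t₁ + s.2 • S.t₂

/-- `(1 / 4π) ∫_S n^* ω`, where `ω` is the area form of the unit sphere: the oriented area of the
image of the section `S` under `n`, as a proportion of the area of the sphere. The pull-back is
`n · (∂₁ n × ∂₂ n) ds₁ ds₂`; the relative boundary of the section has measure zero. -/
def TangentField.sectionArea (n : P.TangentField) {v : P.vertices} (S : VertexSection P v) : ℝ :=
  (1 / (4 * Real.pi)) *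
    ∫ s in {s : ℝ × ℝ | S.point s ∈ interior P.body},
      tripleProduct (n.toFun (S.point s))
        (fderiv ℝ n.toFun (S.point s) S.t₁) (fderiv ℝ n.toFun (S.point s) S.t₂)

/-- `Ω v` is the trapped area at the vertex `v`, for every `v`, of the homotopy class `h`: the class
contains a smooth field, and for every smooth field in `h` and every section separating `v` from
the other vertices, the area of the image of the section, relative to that of the sphere,
is `Ω v`. -/
def IsTrappedArea (h : P.HomotopyClass) (Ω : P.vertices → ℝ) : Prop :=
  (∃ n : P.TangentField, (⟦n⟧ : P.HomotopyClass) = h ∧ n.IsSmooth) ∧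
  ∀ n : P.TangentField, (⟦n⟧ : P.HomotopyClass) = h → n.IsSmooth →
    ∀ (v : P.vertices) (S : VertexSection P v), n.sectionArea S = Ω v

/-- The values of `8π ∑ₐ Ωᵃ ξᵃ` over all `ξ` with `|ξᵃ - ξᵃ'| ≤ |vᵃ - vᵃ'|`. -/
def boundValues (Ω : P.vertices → ℝ) : Set ℝ :=
  {b : ℝ | ∃ ξ : P.vertices → ℝ, (∀ v w : P.vertices, |ξ v - ξ w| ≤ ‖(v : E3) - (w : E3)‖) ∧
    b = 8 * Real.pi * ∑ v : P.vertices, Ω v * ξ v}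

end ConvexPolyhedron

end

/-! For a smooth field `n` the form `n^*ω` is closed. On a face the values of `n` stay on one great
circle, so `n^*ω` vanishes there. If `φ` takes the values `ξ` at the vertices, Stokes' theorem
therefore turns `∫ dφ ∧ n^*ω` into a sum over the vertices, `4π ∑ Ω ξ` up to sign. If moreover `φ`
has slope at most `1`, the integrand is at most half the energy density. This is the bound.

A competitor in `W^{1,2}` has no derivatives on the faces, so Stokes' theorem up to the boundary is
avoided. The area form is replaced by one that is zero near the great circles parallel to the faces.
Extended homogeneously off the sphere it becomes the radial field `cutoffField k`, still divergence
free away from the origin. Continuity and tangency make its pull-back vanish near every boundary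
point other than a vertex (`IsAdmissible.exists_compact`), so only an interior identity is needed,
`integral_fluxDensity_eq_zero`: the pull-back is weakly closed. It follows from the smooth Piola
identity by mollification. As the form is defined off the origin, neither mollified nor glued fields
need be projected back to the sphere.

Consequently `flux k u G φ`, for `φ` constant near each vertex, depends only on the vertex values of
`φ`, and is `∑ φ v * vertexFlux v` (`IsAdmissible.flux_eq_sum`). `vertexFlux_eq_of_homotopic` shows
that `vertexFlux` is a homotopy invariant: a field that equals `n` near the vertex and `n'` further
out has the same flux through small and large spheres.

For a smooth field, letting `φ` approach the indicator of one side of a section turns `vertexFlux`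
into a surface integral. As `k → ∞` it tends to `-4π Ω` (`tendsto_vertexFlux`); the directions that
were cut off cost nothing, since at almost every point where `n` is parallel to a face the area
density is zero. This gives the invariance of the trapped areas. With the pointwise inequality
`abs_fluxDensity_le_half` and the test functions of `exists_isVertexConst` it gives the energy bound
too. The test function `1` shows `∑ Ω = 0`, so `ξ` can be normalized at one vertex and the maximum
is attained by compactness. -/

noncomputable section
-- Faces and vertices of a convex polyhedron
namespace ConvexPolyhedron

variable (P : ConvexPolyhedron)

theorem isCompact_body : IsCompact P.body :=
  P.vertices.finite_toSet.isCompact_convexHull ℝ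

theorem isClosed_body : IsClosed P.body := P.isCompact_body.isClosed

theorem convex_body : Convex ℝ P.body := convex_convexHull ℝ _

theorem vertices_subset_body : (P.vertices : Set E3) ⊆ P.body := subset_convexHull ℝ _

theorem le_of_forall_vertices {u : E3} {c : ℝ} (h : ∀ p ∈ P.vertices, inner ℝ u p ≤ c) {y : E3}
    (hy : y ∈ P.body) : inner ℝ u y ≤ c := by
  have hc : Convex ℝ {y : E3 | inner ℝ u y ≤ c} :=
    convex_halfSpace_le (f := fun y : E3 => inner ℝ u y)
      ⟨fun x y => inner_add_right u x y, fun a x => inner_smul_right u x a⟩ c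
  exact convexHull_min (fun p hp => h p hp) hc hy

theorem mem_face {u x : E3} :
    x ∈ P.face u ↔ x ∈ P.body ∧ ∀ y ∈ P.body, inner ℝ u y ≤ inner ℝ u x := Iff.rfl

/-- Otherwise the whole body lies in a plane, and an interior point could not be moved along `w`. -/
theorem exists_vertex_inner_ne {w : E3} (hw : w ≠ 0) (c : ℝ) :
    ∃ p ∈ P.vertices, inner ℝ w p ≠ c := by
  by_contra! h
  obtain ⟨x, hx⟩ := P.solid
  have h1 : ∀ y ∈ P.body, inner ℝ w y = c := by
    intro y hy
    apply le_antisymm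
    · exact P.le_of_forall_vertices (fun p hp => (h p hp).le) hy
    · have := P.le_of_forall_vertices (u := -w) (c := -c)
        (fun p hp => by rw [inner_neg_left, h p hp]) hy
      rw [inner_neg_left] at this
      linarith
  have h2 : ∀ᶠ t in nhds (0 : ℝ), x + t • w ∈ P.body := by
    have hc : ContinuousAt (fun t : ℝ => x + t • w) 0 := by fun_prop
    apply hc.eventually_mem
    have : P.body ∈ nhds x := mem_interior_iff_mem_nhds.1 hx
    simpa only [zero_smul, add_zero] using this
  have h3 : ∀ᶠ t in nhdsWithin (0 : ℝ) {0}ᶜ, x + t • w ∈ P.body := h2.filter_mono inf_le_left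
  obtain ⟨t, ht, ht0⟩ := (h3.and self_mem_nhdsWithin).exists
  have e1 := h1 _ ht
  have e2 := h1 x (interior_subset hx)
  rw [inner_add_right, e2, inner_smul_right, real_inner_self_eq_norm_sq] at e1
  have : t * ‖w‖ ^ 2 ≠ 0 := mul_ne_zero ht0 (by positivity)
  exact this (by linarith)

theorem inner_eq_of_mem_face {u x y : E3} (hx : x ∈ P.face u) (hy : y ∈ P.face u) :
    inner ℝ u x = inner ℝ u y :=
  le_antisymm (hy.2 x hx.1) (hx.2 y hy.1)

theorem vectorSpan_face_le (u : E3) : vectorSpan ℝ (P.face u) ≤ (Submodule.span ℝ {u})ᗮ := by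
  rw [vectorSpan_def, Submodule.span_le]
  rintro z ⟨a, ha, b, hb, rfl⟩
  rw [SetLike.mem_coe, Submodule.mem_orthogonal_singleton_iff_inner_right]
  change inner ℝ u (a - b) = 0
  rw [inner_sub_right, P.inner_eq_of_mem_face ha hb, sub_self]

theorem exists_support {x : E3} (hx : x ∈ frontier P.body) : ∃ u : E3, u ≠ 0 ∧ x ∈ P.face u := by
  have hx' : x ∉ interior P.body := hx.2
  obtain ⟨f, hf⟩ := geometric_hahn_banach_open_point P.convex_body.interior isOpen_interior hx'
  obtain ⟨u, rfl⟩ := (InnerProductSpace.toDual ℝ E3).surjective f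
  simp only [InnerProductSpace.toDual_apply_apply] at hf
  obtain ⟨z, hz⟩ := P.solid
  refine ⟨u, ?_, P.isClosed_body.frontier_subset hx, fun y hy => ?_⟩
  · rintro rfl
    simpa using hf z hz
  · have hcl : P.body ⊆ closure (interior P.body) := by
      rw [P.convex_body.closure_interior_eq_closure_of_nonempty_interior P.solid]
      exact subset_closure
    have : closure (interior P.body) ⊆ {y : E3 | inner ℝ u y ≤ inner ℝ u x} := by
      apply closure_minimal (fun y hy => (hf y hy).le)
      exact isClosed_le (f := fun y : E3 => inner ℝ u y) (g := fun _ => inner ℝ u x)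
        (by fun_prop) (by fun_prop)
    exact this (hcl hy)

theorem finrank_face_le {u : E3} (hu : u ≠ 0) :
    Module.finrank ℝ (vectorSpan ℝ (P.face u)) ≤ 2 := by
  have h1 := Submodule.finrank_mono (P.vectorSpan_face_le u)
  have h2 := Submodule.finrank_add_finrank_orthogonal (Submodule.span ℝ {u})
  rw [finrank_span_singleton hu, finrank_euclideanSpace_fin] at h2
  omega

/-- The supporting plane is tilted about the face until it hits another vertex: `u` becomes `u + t •
w` with `w` orthogonal to `u` and to the directions of the face, and `t` is the first value at which
a vertex off the face becomes maximal. -/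
theorem exists_larger_face {u x : E3} (hu : u ≠ 0) (hx : x ∈ P.face u)
    (hd : Module.finrank ℝ (vectorSpan ℝ (P.face u)) < 2) :
    ∃ u' : E3, u' ≠ 0 ∧ x ∈ P.face u' ∧
      Module.finrank ℝ (vectorSpan ℝ (P.face u)) < Module.finrank ℝ (vectorSpan ℝ (P.face u')) := by
  set W := vectorSpan ℝ (P.face u) with hW
  obtain ⟨w, hw0, hwW, hwu⟩ : ∃ w : E3, w ≠ 0 ∧ (∀ z ∈ W, inner ℝ w z = 0) ∧ inner ℝ w u = 0 := by
    have h1 : Module.finrank ℝ ↥(W ⊔ Submodule.span ℝ {u}) ≤ 2 := by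
      have := Submodule.finrank_add_le_finrank_add_finrank W (Submodule.span ℝ {u})
      rw [finrank_span_singleton hu] at this
      omega
    have h2 := Submodule.finrank_add_finrank_orthogonal (W ⊔ Submodule.span ℝ {u})
    rw [finrank_euclideanSpace_fin] at h2
    have h3 : (W ⊔ Submodule.span ℝ {u})ᗮ ≠ ⊥ := by
      intro h
      rw [h, finrank_bot] at h2
      omega
    obtain ⟨w, hw, hw0⟩ := Submodule.exists_mem_ne_zero_of_ne_bot h3
    refine ⟨w, hw0, fun z hz => ?_, ?_⟩
    · exact Submodule.inner_left_of_mem_orthogonal (Submodule.mem_sup_left hz) hw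
    · exact Submodule.inner_left_of_mem_orthogonal
        (Submodule.mem_sup_right (Submodule.mem_span_singleton_self u)) hw
  obtain ⟨w, hw0, hwW, hwu, q, hq, hwq⟩ : ∃ w : E3, w ≠ 0 ∧ (∀ z ∈ W, inner ℝ w z = 0) ∧
      inner ℝ w u = 0 ∧ ∃ q ∈ P.vertices, 0 < inner ℝ w (q - x) := by
    obtain ⟨q, hq, hne⟩ := P.exists_vertex_inner_ne hw0 (inner ℝ w x)
    rcases lt_or_gt_of_ne hne with h | h
    · refine ⟨-w, neg_ne_zero.2 hw0, fun z hz => ?_, ?_, q, hq, ?_⟩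
      · rw [inner_neg_left, hwW z hz, neg_zero]
      · rw [inner_neg_left, hwu, neg_zero]
      · rw [inner_neg_left, inner_sub_right]
        linarith
    · exact ⟨w, hw0, hwW, hwu, q, hq, by rw [inner_sub_right]; linarith⟩
  have hface : ∀ p ∈ P.vertices, inner ℝ u (x - p) = 0 → p ∈ P.face u := by
    intro p hp h
    rw [inner_sub_right, sub_eq_zero] at h
    exact ⟨P.vertices_subset_body hp, fun y hy => (hx.2 y hy).trans h.le⟩
  have ha : ∀ p ∈ P.vertices, 0 ≤ inner ℝ u (x - p) := by
    intro p hp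
    have : inner ℝ u p ≤ inner ℝ u x := hx.2 p (P.vertices_subset_body hp)
    rw [inner_sub_right]
    linarith
  -- Only the vertices that gain from the tilt constrain `t`; the minimal ratio of slack to gain is
  -- the largest admissible tilt.
  let T := P.vertices.filter fun p => 0 < inner ℝ w (p - x)
  have hT : T.Nonempty := ⟨q, Finset.mem_filter.2 ⟨hq, hwq⟩⟩
  obtain ⟨p, hpT, hmin⟩ := T.exists_min_image
    (fun p => inner ℝ u (x - p) / inner ℝ w (p - x)) hT
  obtain ⟨hp, hbp⟩ := Finset.mem_filter.1 hpT
  have hap : 0 < inner ℝ u (x - p) := by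
    refine lt_of_le_of_ne (ha p hp) fun h => hbp.ne' ?_
    exact hwW _ (vsub_mem_vectorSpan ℝ (hface p hp h.symm) hx)
  set t := inner ℝ u (x - p) / inner ℝ w (p - x) with ht
  have ht0 : 0 ≤ t := by positivity
  have hval : ∀ y, inner ℝ (u + t • w) (y - x) = - inner ℝ u (x - y) + t * inner ℝ w (y - x) := by
    intro y
    rw [inner_add_left, inner_smul_left, ← neg_sub x y, inner_neg_right u]
    simp
  have hle : ∀ y ∈ P.body, inner ℝ (u + t • w) y ≤ inner ℝ (u + t • w) x := by
    intro y hy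
    refine P.le_of_forall_vertices (fun z hz => ?_) hy
    have h1 : inner ℝ (u + t • w) (z - x) ≤ 0 := by
      rw [hval]
      by_cases hb : 0 < inner ℝ w (z - x)
      · have := hmin z (Finset.mem_filter.2 ⟨hz, hb⟩)
        rw [le_div_iff₀ hb] at this
        linarith
      · have := ha z hz
        have := mul_nonneg ht0 (neg_nonneg.2 (not_lt.1 hb))
        linarith
    rw [inner_sub_right] at h1
    linarith
  have hx' : x ∈ P.face (u + t • w) := ⟨hx.1, hle⟩
  have hmem : ∀ y ∈ P.body, inner ℝ (u + t • w) (y - x) = 0 → y ∈ P.face (u + t • w) := by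
    intro y hy h
    rw [inner_sub_right, sub_eq_zero] at h
    exact ⟨hy, fun z hz => by have := hle z hz; exact this.trans h.ge⟩
  have hsub : P.face u ⊆ P.face (u + t • w) := by
    intro y hy
    apply hmem y hy.1
    have h1 : inner ℝ w (y - x) = 0 := hwW _ (vsub_mem_vectorSpan ℝ hy hx)
    rw [hval, inner_sub_right, P.inner_eq_of_mem_face hx hy, h1]
    simp
  have hp' : p ∈ P.face (u + t • w) := by
    apply hmem p (P.vertices_subset_body hp)
    rw [hval, ht, div_mul_cancel₀ _ hbp.ne']
    ring
  refine ⟨u + t • w, ?_, hx', ?_⟩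
  · intro h
    have : inner ℝ (u + t • w) u = 0 := by rw [h, inner_zero_left]
    rw [inner_add_left, inner_smul_left, hwu, real_inner_self_eq_norm_sq] at this
    have h3 : 0 < ‖u‖ ^ 2 := by positivity
    simp at this
    exact hu this
  -- The span grows strictly because the new vertex `p` is not on the plane through `x` orthogonal
  -- to `u`, which contains the old face.
  · apply Submodule.finrank_lt_finrank_of_lt
    refine lt_of_le_of_ne (vectorSpan_mono ℝ hsub) fun h => ?_
    have h1 : p - x ∈ W := by
      rw [h]
      exact vsub_mem_vectorSpan ℝ hp' hx'
    have h2 := P.vectorSpan_face_le u h1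
    rw [Submodule.mem_orthogonal_singleton_iff_inner_right, ← neg_sub, inner_neg_right] at h2
    linarith

theorem face_smul {u : E3} {c : ℝ} (hc : 0 < c) : P.face (c • u) = P.face u := by
  ext x
  simp only [mem_face, inner_smul_left, RCLike.conj_to_real]
  simp only [mul_le_mul_iff_right₀ hc]

/-- A supporting plane exists by Hahn–Banach, and tilting it repeatedly raises the dimension of its
face to two. So tangency, which is imposed on two-dimensional faces only, constrains the field at
every boundary point of the domain. -/
theorem exists_faceNormal_of_mem_frontier {x : E3} (hx : x ∈ frontier P.body) :
    ∃ u, P.IsFaceNormal u ∧ x ∈ P.face u := by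
  suffices h : ∃ u : E3, u ≠ 0 ∧ x ∈ P.face u ∧
      Module.finrank ℝ (vectorSpan ℝ (P.face u)) = 2 by
    obtain ⟨u, hu, hxu, hd⟩ := h
    have hf : P.face (‖u‖⁻¹ • u) = P.face u := P.face_smul (by positivity)
    exact ⟨‖u‖⁻¹ • u, ⟨norm_smul_inv_norm hu, by rw [hf, hd]⟩, by rwa [hf]⟩
  have key : ∀ d : ℕ, d ≤ 2 → ∃ u : E3, u ≠ 0 ∧ x ∈ P.face u ∧
      d ≤ Module.finrank ℝ (vectorSpan ℝ (P.face u)) := by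
    intro d
    induction d with
    | zero =>
      intro _
      obtain ⟨u, hu, hxu⟩ := P.exists_support hx
      exact ⟨u, hu, hxu, Nat.zero_le _⟩
    | succ d ih =>
      intro hd
      obtain ⟨u, hu, hxu, h⟩ := ih (by omega)
      by_cases h2 : d + 1 ≤ Module.finrank ℝ (vectorSpan ℝ (P.face u))
      · exact ⟨u, hu, hxu, h2⟩
      · obtain ⟨u', hu', hxu', h'⟩ := P.exists_larger_face hu hxu (by omega)
        exact ⟨u', hu', hxu', by omega⟩
  obtain ⟨u, hu, hxu, h⟩ := key 2 le_rfl
  exact ⟨u, hu, hxu, le_antisymm (P.finrank_face_le hu) h⟩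

theorem isClosed_face (u : E3) : IsClosed (P.face u) := by
  have : P.face u = P.body ∩ ⋂ y ∈ P.body, {x : E3 | inner ℝ u y ≤ inner ℝ u x} := by
    ext x
    simp [mem_face]
  rw [this]
  refine P.isClosed_body.inter (isClosed_biInter fun y _ => ?_)
  exact isClosed_le (by fun_prop) (by fun_prop)

/-- Krein–Milman: extreme points of an exposed face are extreme in the body, hence vertices. -/
theorem face_eq_convexHull (u : E3) :
    P.face u = convexHull ℝ {p : E3 | p ∈ P.vertices ∧ p ∈ P.face u} := by
  have hexp : IsExposed ℝ P.body (P.face u) := ContinuousLinearMap.toExposed.isExposed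
  have hcomp : IsCompact (P.face u) := P.isCompact_body.of_isClosed_subset (P.isClosed_face u)
    fun x hx => hx.1
  have hconv : Convex ℝ (P.face u) := hexp.convex P.convex_body
  have hfin : {p : E3 | p ∈ P.vertices ∧ p ∈ P.face u}.Finite :=
    P.vertices.finite_toSet.subset fun p hp => hp.1
  apply Set.Subset.antisymm
  · have h1 : P.face u ⊆ closure (convexHull ℝ ((P.face u).extremePoints ℝ)) :=
      (closure_convexHull_extremePoints hcomp hconv).ge
    have h2 : (P.face u).extremePoints ℝ ⊆ {p : E3 | p ∈ P.vertices ∧ p ∈ P.face u} := by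
      intro p hp
      refine ⟨?_, hp.1⟩
      have h3 := hexp.isExtreme.extremePoints_subset_extremePoints hp
      exact extremePoints_convexHull_subset h3
    refine h1.trans ?_
    exact closure_minimal (convexHull_mono h2) (hfin.isCompact_convexHull ℝ).isClosed
  · exact convexHull_min (fun p hp => hp.2) hconv

/-- A face is determined by the vertices on it, so there are finitely many faces. The normals of a
two-dimensional face span a line, on which only two vectors have unit length. -/
theorem finite_faceNormals : {u | P.IsFaceNormal u}.Finite := by
  refine Set.Finite.of_finite_fibers
    (fun u => {p : E3 | p ∈ P.vertices ∧ p ∈ P.face u}) ?_ ?_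
  · refine (P.vertices.finite_toSet.powerset).subset ?_
    rintro _ ⟨u, _, rfl⟩ p hp
    exact hp.1
  · rintro _ ⟨u, hu, rfl⟩
    refine (Set.toFinite {u, -u}).subset ?_
    rintro u' ⟨hu', he⟩
    have hf : P.face u' = P.face u := by
      rw [P.face_eq_convexHull u', P.face_eq_convexHull u]
      exact congrArg _ he
    set W := vectorSpan ℝ (P.face u) with hW
    have hmem : ∀ z, P.IsFaceNormal z → P.face z = P.face u → z ∈ Wᗮ := by
      intro z _ hz
      rw [Submodule.mem_orthogonal']
      intro w hw
      have := P.vectorSpan_face_le z (by rwa [hz])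
      rwa [Submodule.mem_orthogonal_singleton_iff_inner_right] at this
    have hd : Module.finrank ℝ Wᗮ = 1 := by
      have h2 := Submodule.finrank_add_finrank_orthogonal W
      rw [finrank_euclideanSpace_fin, hu.2] at h2
      omega
    have hu0 : (⟨u, hmem u hu rfl⟩ : Wᗮ) ≠ 0 := by
      intro h
      have : u = 0 := congrArg Subtype.val h
      have h1 := hu.1
      simp [this] at h1
    obtain ⟨c, hc⟩ := (finrank_eq_one_iff_of_nonzero' _ hu0).1 hd ⟨u', hmem u' hu' hf⟩
    have hc' : c • u = u' := congrArg Subtype.val hc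
    have hn := hu'.1
    rw [← hc', norm_smul, hu.1, mul_one, Real.norm_eq_abs] at hn
    rcases eq_or_eq_neg_of_abs_eq hn with h | h
    · left; rw [← hc', h, one_smul]
    · right; rw [← hc', h, neg_one_smul]; rfl

/-- Convex independence puts `v` outside the compact hull of the other vertices. -/
theorem exists_separating (v : P.vertices) : ∃ (ν : E3) (c : ℝ), inner ℝ ν (v : E3) < c ∧
    ∀ w : P.vertices, w ≠ v → c < inner ℝ ν (w : E3) := by
  have h1 : (v : E3) ∉ convexHull ℝ ((P.vertices : Set E3) \ {(v : E3)}) := by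
    have := P.convexIndependent.mem_convexHull_iff {v}ᶜ v
    have he : Subtype.val '' ({v}ᶜ : Set P.vertices) = (P.vertices : Set E3) \ {(v : E3)} := by
      ext x
      constructor
      · rintro ⟨y, hy, rfl⟩
        exact ⟨y.2, fun h => hy (Subtype.ext h)⟩
      · rintro ⟨hx, hxv⟩
        exact ⟨⟨x, hx⟩, fun h => hxv (congrArg Subtype.val h), rfl⟩
    rw [← he, this]
    simp
  have hfin : ((P.vertices : Set E3) \ {(v : E3)}).Finite := P.vertices.finite_toSet.sdiff
  obtain ⟨f, c, hfv, hf⟩ := geometric_hahn_banach_point_closed (convex_convexHull ℝ _)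
    (hfin.isCompact_convexHull ℝ).isClosed h1
  obtain ⟨u, rfl⟩ := (InnerProductSpace.toDual ℝ E3).surjective f
  simp only [InnerProductSpace.toDual_apply_apply] at hfv hf
  refine ⟨u, c, hfv, fun w hw => hf _ (subset_convexHull ℝ _ ⟨w.2, fun h => hw (Subtype.ext h)⟩)⟩

/-- A vertex is the strict minimum among the vertices of a linear functional, so the body contains
no point just beyond it on the line from another vertex. -/
theorem interior_subset_domain : interior P.body ⊆ P.domain := by
  intro x hx
  refine ⟨interior_subset hx, fun hxv => ?_⟩
  obtain ⟨ν, c, h1, h2⟩ := P.exists_separating ⟨x, hxv⟩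
  have hmin : ∀ y ∈ P.body, inner ℝ (-ν) y ≤ inner ℝ (-ν) x := by
    intro y hy
    refine P.le_of_forall_vertices (fun p hp => ?_) hy
    by_cases h : p = x
    · rw [h]
    · have := h2 ⟨p, hp⟩ (fun h' => h (congrArg Subtype.val h'))
      simp only [inner_neg_left]
      simp only at this h1
      linarith
  obtain ⟨q, hq, hqx⟩ := P.exists_vertex_inner_ne (w := EuclideanSpace.single 0 1) (by simp)
    (inner ℝ (EuclideanSpace.single 0 1) x)
  have hqx' : q ≠ x := by
    rintro rfl
    exact hqx rfl
  have hν : 0 < inner ℝ ν (q - x) := by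
    have := h2 ⟨q, hq⟩ (fun h' => hqx' (congrArg Subtype.val h'))
    rw [inner_sub_right]
    simp only at this h1
    linarith
  have h2 : ∀ᶠ t in nhds (0 : ℝ), x - t • (q - x) ∈ P.body := by
    have hc : ContinuousAt (fun t : ℝ => x - t • (q - x)) 0 := by fun_prop
    apply hc.eventually_mem
    simpa only [zero_smul, add_zero, sub_zero] using mem_interior_iff_mem_nhds.1 hx
  have h3 : ∀ᶠ t in nhdsWithin (0 : ℝ) (Set.Ioi 0), x - t • (q - x) ∈ P.body :=
    h2.filter_mono inf_le_left
  obtain ⟨t, ht, ht0⟩ := (h3.and self_mem_nhdsWithin).exists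
  have := hmin _ ht
  rw [inner_sub_right, inner_smul_right, inner_neg_left _ (q - x)] at this
  have := mul_pos (Set.mem_Ioi.1 ht0) hν
  linarith

theorem exists_faceNormal_of_mem_domain {x : E3} (hx : x ∈ P.domain) (hxi : x ∉ interior P.body) :
    ∃ u, P.IsFaceNormal u ∧ x ∈ P.face u :=
  P.exists_faceNormal_of_mem_frontier ⟨subset_closure hx.1, hxi⟩

end ConvexPolyhedron
end

/-! ### Mollification in `L²` -/

noncomputable section

section Mollification

open MeasureTheory

theorem sq_lintegral_le_lintegral_sq {α : Type*} [MeasurableSpace α] (ν : Measure α)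
    [IsProbabilityMeasure ν] {h : α → ENNReal} (hh : AEMeasurable h ν) :
    (∫⁻ a, h a ∂ν) ^ 2 ≤ ∫⁻ a, h a ^ 2 ∂ν := by
  have h1 := ENNReal.lintegral_mul_le_Lp_mul_Lq ν Real.HolderConjugate.two_two hh
    (aemeasurable_const (b := (1 : ENNReal)))
  simp only [Pi.mul_apply, mul_one, ENNReal.one_rpow, lintegral_const, measure_univ] at h1
  calc (∫⁻ a, h a ∂ν) ^ 2 ≤ ((∫⁻ a, h a ^ (2 : ℝ) ∂ν) ^ (1 / 2 : ℝ)) ^ 2 := by gcongr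
    _ = ∫⁻ a, h a ^ 2 ∂ν := by
      rw [← ENNReal.rpow_natCast, ← ENNReal.rpow_mul]
      simp

theorem eLpNorm_two_sq {α F : Type*} [MeasurableSpace α] [NormedAddCommGroup F] (μ : Measure α)
    (f : α → F) :
    eLpNorm f 2 μ ^ 2 = ∫⁻ x, ‖f x‖ₑ ^ 2 ∂μ := by
  rw [eLpNorm_eq_lintegral_rpow_enorm_toReal (by norm_num) (by norm_num)]
  rw [← ENNReal.rpow_natCast, ← ENNReal.rpow_mul]
  simp

variable {E F : Type*} [NormedAddCommGroup E] [InnerProductSpace ℝ E] [FiniteDimensional ℝ E]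
  [MeasurableSpace E] [BorelSpace E] [NormedAddCommGroup F] [NormedSpace ℝ F]

/-- Convolution with a probability density does not increase the `L²` norm. -/
theorem eLpNorm_convolution_normed_le (φ : ContDiffBump (0 : E)) {g : E → F}
    (hg : AEStronglyMeasurable g volume) :
    eLpNorm (convolution (φ.normed volume) g (ContinuousLinearMap.lsmul ℝ ℝ) volume) 2 volume
      ≤ eLpNorm g 2 volume := by
  set ρ : E → ENNReal := fun t => ENNReal.ofReal (φ.normed volume t) with hρ
  have hρm : Measurable ρ := (φ.continuous_normed.measurable).ennreal_ofReal
  -- The convolution is an average against this probability measure: Jensen's inequality bounds it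
  -- pointwise, and Tonelli with translation invariance integrates the bound.
  set ν := (volume : Measure E).withDensity ρ with hν
  have hprob : IsProbabilityMeasure ν := by
    constructor
    rw [hν, withDensity_apply _ MeasurableSet.univ, Measure.restrict_univ,
      ← ofReal_integral_eq_lintegral_ofReal φ.integrable_normed
        (Filter.Eventually.of_forall φ.nonneg_normed), φ.integral_normed, ENNReal.ofReal_one]
  have hνac : ν ≪ volume := withDensity_absolutelyContinuous _ _
  have hgx : ∀ x, AEMeasurable (fun t => ‖g (x - t)‖ₑ) volume := fun x =>
    (hg.comp_quasiMeasurePreserving (quasiMeasurePreserving_sub_left volume x)).enorm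
  have hpt : ∀ x, ‖convolution (φ.normed volume) g (ContinuousLinearMap.lsmul ℝ ℝ) volume x‖ₑ ^ 2
      ≤ ∫⁻ t, ρ t * ‖g (x - t)‖ₑ ^ 2 := by
    intro x
    have h1 : ‖convolution (φ.normed volume) g (ContinuousLinearMap.lsmul ℝ ℝ) volume x‖ₑ
        ≤ ∫⁻ t, ‖g (x - t)‖ₑ ∂ν := by
      rw [hν, lintegral_withDensity_eq_lintegral_mul₀ hρm.aemeasurable (hgx x)]
      refine (enorm_integral_le_lintegral_enorm _).trans (le_of_eq ?_)
      congr 1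
      ext t
      rw [ContinuousLinearMap.lsmul_apply, enorm_smul, Pi.mul_apply,
        Real.enorm_of_nonneg (φ.nonneg_normed t)]
    calc _ ≤ (∫⁻ t, ‖g (x - t)‖ₑ ∂ν) ^ 2 := by gcongr
      _ ≤ ∫⁻ t, ‖g (x - t)‖ₑ ^ 2 ∂ν := sq_lintegral_le_lintegral_sq ν ((hgx x).mono_ac hνac)
      _ = _ := by
        rw [hν, lintegral_withDensity_eq_lintegral_mul₀ hρm.aemeasurable ((hgx x).pow_const 2)]
        rfl
  rw [← ENNReal.pow_le_pow_left_iff two_ne_zero, eLpNorm_two_sq, eLpNorm_two_sq]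
  calc _ ≤ ∫⁻ x, ∫⁻ t, ρ t * ‖g (x - t)‖ₑ ^ 2 := lintegral_mono hpt
    _ = ∫⁻ t, ∫⁻ x, ρ t * ‖g (x - t)‖ₑ ^ 2 := by
      apply lintegral_lintegral_swap
      refine AEMeasurable.mul (hρm.comp measurable_snd).aemeasurable ?_
      exact ((hg.comp_quasiMeasurePreserving
        (quasiMeasurePreserving_sub_of_right_invariant volume volume)).enorm).pow_const 2
    _ = ∫⁻ t, ρ t * ∫⁻ x, ‖g x‖ₑ ^ 2 := by
      congr 1
      ext t
      have hm : AEMeasurable (fun x => ‖g (x - t)‖ₑ ^ 2) volume :=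
        ((hg.comp_quasiMeasurePreserving
          (measurePreserving_sub_right volume t).quasiMeasurePreserving).enorm).pow_const 2
      rw [lintegral_const_mul'' _ hm, lintegral_sub_right_eq_self (fun x => ‖g x‖ₑ ^ 2) t]
    _ = ∫⁻ x, ‖g x‖ₑ ^ 2 := by
      rw [lintegral_mul_const _ hρm]
      have : ∫⁻ t, ρ t = 1 := by
        have := hprob.measure_univ
        rwa [hν, withDensity_apply _ MeasurableSet.univ, Measure.restrict_univ] at this
      rw [this, one_mul]

/-- By the contraction property it suffices to treat a dense class. For continuous functions of
compact support the convergence is uniform, on a fixed compact set. -/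
theorem tendsto_eLpNorm_convolution_sub [CompleteSpace F] {φ : ℕ → ContDiffBump (0 : E)}
    (hφ : Filter.Tendsto (fun j => (φ j).rOut) Filter.atTop (nhds 0)) {g : E → F}
    (hg : MemLp g 2 volume) :
    Filter.Tendsto (fun j => eLpNorm (convolution ((φ j).normed volume) g
      (ContinuousLinearMap.lsmul ℝ ℝ) volume - g) 2 volume) Filter.atTop (nhds 0) := by
  rw [ENNReal.tendsto_nhds_zero]
  intro ε hε
  obtain ⟨δ, hδ, hδε⟩ : ∃ δ : ENNReal, δ ≠ 0 ∧ δ + δ + δ ≤ ε := by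
    refine ⟨ε / 3, ENNReal.div_ne_zero.2 ⟨hε.ne', by norm_num⟩, ?_⟩
    rw [← two_mul, ← add_one_mul]
    norm_num
    exact ENNReal.mul_div_le
  obtain ⟨g', hc, hgg', hcont, hg'⟩ := hg.exists_hasCompactSupport_eLpNorm_sub_le (by norm_num) hδ
  -- Once the kernels have radius below `1`, all the mollifications of `g'` are supported in this
  -- set.
  set K := Metric.cthickening 1 (tsupport g') with hK
  have hKc : IsCompact K := hc.isCompact.cthickening
  obtain ⟨η, hη, hηδ⟩ : ∃ η : ℝ, 0 < η ∧
      volume K ^ (2 : ENNReal).toReal⁻¹ * ENNReal.ofReal η ≤ δ := by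
    have h1 : volume K ^ (2 : ENNReal).toReal⁻¹ ≠ ⊤ :=
      ENNReal.rpow_ne_top_of_nonneg (by norm_num) hKc.measure_lt_top.ne
    have h2 : Filter.Tendsto (fun η : ℝ => volume K ^ (2 : ENNReal).toReal⁻¹ * ENNReal.ofReal η)
        (nhdsWithin 0 (Set.Ioi 0)) (nhds 0) := by
      have : Filter.Tendsto (fun η : ℝ => volume K ^ (2 : ENNReal).toReal⁻¹ * ENNReal.ofReal η)
        (nhds 0) (nhds (volume K ^ (2 : ENNReal).toReal⁻¹ * ENNReal.ofReal 0)) :=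
        ENNReal.Tendsto.const_mul (ENNReal.continuous_ofReal.tendsto 0) (Or.inr h1)
      rw [ENNReal.ofReal_zero, mul_zero] at this
      exact this.mono_left inf_le_left
    obtain ⟨η, h3, h4⟩ := ((h2.eventually_le_const (pos_iff_ne_zero.2 hδ)).and
      self_mem_nhdsWithin).exists
    exact ⟨η, h4, h3⟩
  have huc := hc.uniformContinuous_of_continuous hcont
  rw [Metric.uniformContinuous_iff] at huc
  obtain ⟨r, hr, hr'⟩ := huc η hη
  have hsmall := hφ.eventually_lt_const (lt_min hr one_pos)
  filter_upwards [hsmall] with j hj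
  set A : (E → F) → E → F := fun f => convolution ((φ j).normed volume) f
    (ContinuousLinearMap.lsmul ℝ ℝ) volume with hA
  have hli : ∀ f : E → F, MemLp f 2 volume → LocallyIntegrable f volume := fun f hf =>
    hf.locallyIntegrable (by norm_num)
  have hex : ∀ f : E → F, MemLp f 2 volume → ConvolutionExists ((φ j).normed volume) f
      (ContinuousLinearMap.lsmul ℝ ℝ) volume := fun f hf =>
    (φ j).hasCompactSupport_normed.convolutionExists_left _ (φ j).continuous_normed (hli f hf)
  have hAm : ∀ f : E → F, MemLp f 2 volume → AEStronglyMeasurable (A f) volume := fun f hf =>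
    ((φ j).hasCompactSupport_normed.continuous_convolution_left _ (φ j).continuous_normed
      (hli f hf)).aestronglyMeasurable
  have hsplit : A g - g = (A (g - g') + (A g' - g')) + (g' - g) := by
    have : A g = A (g - g') + A g' := by
      conv_lhs => rw [← sub_add_cancel g g']
      exact (hex _ (hg.sub hg')).distrib_add (hex _ hg')
    rw [this]
    abel
  have hmid : eLpNorm (A g' - g') 2 volume ≤ δ := by
    have hsupp : Function.support (A g' - g') ⊆ K := by
      intro x hx
      by_contra hxK
      apply hx
      have h1 : ∀ y ∈ Metric.ball x (φ j).rOut, g' y = 0 := by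
        intro y hy
        by_contra hy0
        apply hxK
        refine Metric.mem_cthickening_of_dist_le x y 1 _ (subset_tsupport g' hy0) ?_
        rw [dist_comm]
        exact ((Metric.mem_ball.1 hy).trans (hj.trans_le (min_le_right _ _))).le
      have h2 : g' x = 0 := h1 x (Metric.mem_ball_self (φ j).rOut_pos)
      have h3 := ContDiffBump.dist_normed_convolution_le (φ := φ j) (μ := volume) (x₀ := x) (ε := 0)
        hcont.aestronglyMeasurable (fun y hy => by rw [h1 y hy, h2, dist_self])
      have h4 := dist_le_zero.1 h3
      simp only [Pi.sub_apply, hA, h4, sub_self]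
    rw [← eLpNorm_restrict_eq_of_support_subset hsupp]
    refine (eLpNorm_le_of_ae_bound (C := η) (Filter.Eventually.of_forall fun x => ?_)).trans ?_
    · rw [Pi.sub_apply, ← dist_eq_norm]
      refine ContDiffBump.dist_normed_convolution_le hcont.aestronglyMeasurable fun y hy => ?_
      exact (hr' ((Metric.mem_ball.1 hy).trans (hj.trans_le (min_le_left _ _)))).le
    · rwa [Measure.restrict_apply_univ]
  calc eLpNorm (A g - g) 2 volume
      ≤ eLpNorm (A (g - g')) 2 volume + eLpNorm (A g' - g') 2 volume
        + eLpNorm (g' - g) 2 volume := by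
        rw [hsplit]
        refine (eLpNorm_add_le ?_ ?_ (by norm_num)).trans ?_
        · exact (hAm _ (hg.sub hg')).add ((hAm _ hg').sub hg'.1)
        · exact hg'.1.sub hg.1
        gcongr
        exact eLpNorm_add_le (hAm _ (hg.sub hg')) ((hAm _ hg').sub hg'.1) (by norm_num)
    _ ≤ δ + δ + δ := by
        gcongr
        · exact (eLpNorm_convolution_normed_le (φ j) (hg.sub hg').1).trans hgg'
        · rwa [eLpNorm_sub_comm]
    _ ≤ ε := hδε

end Mollification

end

/-! ### Algebra and estimates for the flux density -/

noncomputable section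

section FluxDensity

theorem tripleProduct_eq (a b c : E3) : tripleProduct a b c =
    a 0 * (b 1 * c 2 - b 2 * c 1) - a 1 * (b 0 * c 2 - b 2 * c 0)
      + a 2 * (b 0 * c 1 - b 1 * c 0) := by
  rw [tripleProduct, Matrix.det_fin_three]
  simp only [Matrix.of_apply, Matrix.cons_val]
  ring

/-- The standard basis vectors of `ℝ³`. -/
abbrev stdVec (i : Fin 3) : E3 := EuclideanSpace.single i (1 : ℝ)

theorem norm_stdVec (i : Fin 3) : ‖stdVec i‖ = 1 := by simp [stdVec]

theorem eq_sum_stdVec (q : E3) : q = q 0 • stdVec 0 + q 1 • stdVec 1 + q 2 • stdVec 2 := by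
  ext i
  fin_cases i <;> simp [stdVec]

theorem ContinuousLinearMap.apply_eq_sum_stdVec {F : Type*} [NormedAddCommGroup F]
    [NormedSpace ℝ F] (L : E3 →L[ℝ] F) (q : E3) :
    L q = q 0 • L (stdVec 0) + q 1 • L (stdVec 1) + q 2 • L (stdVec 2) := by
  conv_lhs => rw [eq_sum_stdVec q]
  simp only [map_add, map_smul]

/-- `b · (∂ᵢ u × ∂ⱼ u) ∂ₖ φ`, summed over the cyclic permutations `(i, j, k)`, for a field with
gradient `G` and a function with differential `p`. -/
def fluxDensity (b : E3) (G : E3 →L[ℝ] E3) (p : E3 →L[ℝ] ℝ) : ℝ :=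
  tripleProduct b (G (stdVec 0)) (G (stdVec 1)) * p (stdVec 2)
    + tripleProduct b (G (stdVec 1)) (G (stdVec 2)) * p (stdVec 0)
    + tripleProduct b (G (stdVec 2)) (G (stdVec 0)) * p (stdVec 1)

theorem abs_apply_le_norm (a : E3) (i : Fin 3) : |a i| ≤ ‖a‖ := PiLp.norm_apply_le a i

theorem abs_tripleProduct_le (a b c : E3) : |tripleProduct a b c| ≤ 6 * (‖a‖ * ‖b‖ * ‖c‖) := by
  have h : ∀ i j k : Fin 3, |a i * (b j * c k)| ≤ ‖a‖ * ‖b‖ * ‖c‖ := by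
    intro i j k
    rw [abs_mul, abs_mul, mul_assoc]
    gcongr <;> exact abs_apply_le_norm _ _
  have h0 := abs_le.1 (h 0 1 2)
  have h1 := abs_le.1 (h 0 2 1)
  have h2 := abs_le.1 (h 1 0 2)
  have h3 := abs_le.1 (h 1 2 0)
  have h4 := abs_le.1 (h 2 0 1)
  have h5 := abs_le.1 (h 2 1 0)
  rw [tripleProduct_eq, abs_le]
  constructor <;> linarith [h0.1, h0.2, h1.1, h1.2, h2.1, h2.2, h3.1, h3.2, h4.1, h4.2, h5.1, h5.2]

theorem tripleProduct_sub (a b c a' b' c' : E3) :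
    tripleProduct a' b' c' - tripleProduct a b c = tripleProduct (a' - a) b' c'
      + tripleProduct a (b' - b) c' + tripleProduct a b (c' - c) := by
  simp only [tripleProduct_eq, PiLp.sub_apply]
  ring

theorem tripleProduct_sub_le (a a' : E3) (G G' : E3 →L[ℝ] E3) (i j : Fin 3) :
    |tripleProduct a' (G' (stdVec i)) (G' (stdVec j)) - tripleProduct a (G (stdVec i)) (G (stdVec j))|
      ≤ 6 * (‖a' - a‖ * ‖G'‖ ^ 2 + ‖a‖ * ‖G' - G‖ * (‖G'‖ + ‖G‖)) := by
  have hG : ∀ (L : E3 →L[ℝ] E3) i, ‖L (stdVec i)‖ ≤ ‖L‖ := fun L i => by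
    simpa [norm_stdVec] using L.le_opNorm (stdVec i)
  rw [tripleProduct_sub, ← sub_apply, ← sub_apply]
  refine (abs_add_three _ _ _).trans ?_
  have h1 : |tripleProduct (a' - a) (G' (stdVec i)) (G' (stdVec j))|
      ≤ 6 * (‖a' - a‖ * ‖G'‖ * ‖G'‖) := (abs_tripleProduct_le _ _ _).trans (by gcongr <;> apply hG)
  have h2 : |tripleProduct a ((G' - G) (stdVec i)) (G' (stdVec j))|
      ≤ 6 * (‖a‖ * ‖G' - G‖ * ‖G'‖) := (abs_tripleProduct_le _ _ _).trans (by gcongr <;> apply hG)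
  have h3 : |tripleProduct a (G (stdVec i)) ((G' - G) (stdVec j))|
      ≤ 6 * (‖a‖ * ‖G‖ * ‖G' - G‖) := (abs_tripleProduct_le _ _ _).trans (by gcongr <;> apply hG)
  linarith

theorem abs_apply_stdVec_le (p : E3 →L[ℝ] ℝ) (i : Fin 3) : |p (stdVec i)| ≤ ‖p‖ := by
  simpa [norm_stdVec] using p.le_opNorm (stdVec i)

/-- Telescoping in the trilinear triple product. The form of the right side is what passing to the
limit requires: `b' - b` small uniformly, `G' - G` small only in `L²`. The constant counts three
terms of six monomials. -/
theorem abs_fluxDensity_sub_le (b b' : E3) (G G' : E3 →L[ℝ] E3) (p : E3 →L[ℝ] ℝ) :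
    |fluxDensity b' G' p - fluxDensity b G p|
      ≤ 18 * (‖b' - b‖ * ‖G'‖ ^ 2 + ‖b‖ * ‖G' - G‖ * (‖G'‖ + ‖G‖)) * ‖p‖ := by
  have h : ∀ i j k : Fin 3, |(tripleProduct b' (G' (stdVec i)) (G' (stdVec j))
      - tripleProduct b (G (stdVec i)) (G (stdVec j))) * p (stdVec k)|
      ≤ 6 * (‖b' - b‖ * ‖G'‖ ^ 2 + ‖b‖ * ‖G' - G‖ * (‖G'‖ + ‖G‖)) * ‖p‖ := by
    intro i j k
    rw [abs_mul]
    gcongr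
    · exact tripleProduct_sub_le _ _ _ _ _ _
    · exact abs_apply_stdVec_le _ _
  have e : fluxDensity b' G' p - fluxDensity b G p =
      (tripleProduct b' (G' (stdVec 0)) (G' (stdVec 1))
        - tripleProduct b (G (stdVec 0)) (G (stdVec 1))) * p (stdVec 2)
      + (tripleProduct b' (G' (stdVec 1)) (G' (stdVec 2))
        - tripleProduct b (G (stdVec 1)) (G (stdVec 2))) * p (stdVec 0)
      + (tripleProduct b' (G' (stdVec 2)) (G' (stdVec 0))
        - tripleProduct b (G (stdVec 2)) (G (stdVec 0))) * p (stdVec 1) := by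
    simp only [fluxDensity]; ring
  rw [e]
  refine (abs_add_three _ _ _).trans ?_
  linarith [h 0 1 2, h 1 2 0, h 2 0 1]

theorem fluxDensity_zero_left (G : E3 →L[ℝ] E3) (p : E3 →L[ℝ] ℝ) : fluxDensity 0 G p = 0 := by
  simp [fluxDensity, tripleProduct_eq]

theorem fluxDensity_zero_right (b : E3) (G : E3 →L[ℝ] E3) : fluxDensity b G 0 = 0 := by
  simp [fluxDensity]

theorem abs_fluxDensity_le (b : E3) (G : E3 →L[ℝ] E3) (p : E3 →L[ℝ] ℝ) :
    |fluxDensity b G p| ≤ 18 * (‖b‖ * ‖G‖ ^ 2) * ‖p‖ := by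
  have := abs_fluxDensity_sub_le 0 b G G p
  simpa [fluxDensity_zero_left] using this

theorem continuous_tripleProduct :
    Continuous fun x : E3 × E3 × E3 => tripleProduct x.1 x.2.1 x.2.2 := by
  simp only [tripleProduct_eq]
  fun_prop

theorem continuous_fluxDensity :
    Continuous fun x : E3 × (E3 →L[ℝ] E3) × (E3 →L[ℝ] ℝ) => fluxDensity x.1 x.2.1 x.2.2 := by
  have h : ∀ i j k : Fin 3, Continuous fun x : E3 × (E3 →L[ℝ] E3) × (E3 →L[ℝ] ℝ) =>
      tripleProduct x.1 (x.2.1 (stdVec i)) (x.2.1 (stdVec j)) * x.2.2 (stdVec k) := fun i j k =>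
    (continuous_tripleProduct.comp (f := fun x : E3 × (E3 →L[ℝ] E3) × (E3 →L[ℝ] ℝ) =>
      (x.1, x.2.1 (stdVec i), x.2.1 (stdVec j))) (by fun_prop)).mul (by fun_prop)
  exact ((h 0 1 2).add (h 1 2 0)).add (h 2 0 1)

theorem continuousOn_tripleProduct {X : Type*} [TopologicalSpace X] {s : Set X} {a b c : X → E3}
    (ha : ContinuousOn a s) (hb : ContinuousOn b s) (hc : ContinuousOn c s) :
    ContinuousOn (fun x => _root_.tripleProduct (a x) (b x) (c x)) s := by
  have h : ContinuousOn (fun x => (a x, b x, c x)) s := ha.prodMk (hb.prodMk hc)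
  have := Continuous.comp_continuousOn
    (g := fun x : E3 × E3 × E3 => tripleProduct x.1 x.2.1 x.2.2) continuous_tripleProduct h
  exact this

theorem HasLineDerivAt.tripleProduct {a b c : E3 → E3} {a' b' c' : E3} {x w : E3}
    (ha : HasLineDerivAt ℝ a a' x w) (hb : HasLineDerivAt ℝ b b' x w)
    (hc : HasLineDerivAt ℝ c c' x w) :
    HasLineDerivAt ℝ (fun y => _root_.tripleProduct (a y) (b y) (c y))
      (_root_.tripleProduct a' (b x) (c x) + _root_.tripleProduct (a x) b' (c x)
        + _root_.tripleProduct (a x) (b x) c') x w := by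
  unfold HasLineDerivAt at *
  have hap : ∀ {f : ℝ → E3} {f' : E3}, HasDerivAt f f' 0 → ∀ i : Fin 3,
      HasDerivAt (fun t => f t i) (f' i) 0 := fun {f f'} hf i => by
    have := (EuclideanSpace.proj (𝕜 := ℝ) i).hasFDerivAt.comp_hasDerivAt (0 : ℝ) hf
    exact this
  have A := hap ha
  have B := hap hb
  have C := hap hc
  simp only [tripleProduct_eq]
  refine ((((A 0).fun_mul (((B 1).fun_mul (C 2)).fun_sub ((B 2).fun_mul (C 1)))).fun_sub
    ((A 1).fun_mul (((B 0).fun_mul (C 2)).fun_sub ((B 2).fun_mul (C 0))))).fun_add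
    ((A 2).fun_mul (((B 0).fun_mul (C 1)).fun_sub ((B 1).fun_mul (C 0))))).congr_deriv ?_
  simp only [zero_smul, add_zero]
  ring

/-- Cofactor expansion: the trace of `M` times a determinant. -/
theorem tripleProduct_trace (M : E3 →L[ℝ] E3) (p q r : E3) :
    tripleProduct (M p) q r + tripleProduct (M q) r p + tripleProduct (M r) p q
      = (∑ i, M (stdVec i) i) * tripleProduct p q r := by
  rw [M.apply_eq_sum_stdVec p, M.apply_eq_sum_stdVec q, M.apply_eq_sum_stdVec r]
  simp only [tripleProduct_eq, PiLp.add_apply, PiLp.smul_apply, smul_eq_mul, Fin.sum_univ_three]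
  ring

theorem tripleProduct_swap (a b c : E3) : tripleProduct a b c = - tripleProduct a c b := by
  simp only [tripleProduct_eq]; ring

end FluxDensity

/-! ### The Piola identity for smooth maps -/

section Piola

open MeasureTheory

theorem integrable_mul_of_continuousOn_tsupport {f ψ : E3 → ℝ} (hψ : Continuous ψ)
    (hc : HasCompactSupport ψ) (hf : ContinuousOn f (tsupport ψ)) :
    Integrable (fun x => f x * ψ x) volume := by
  rw [← integrableOn_iff_integrable_of_support_subset (s := tsupport ψ)]
  · exact (hf.mul hψ.continuousOn).integrableOn_compact hc
  · intro x hx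
    exact subset_tsupport _ (right_ne_zero_of_mul hx)

/-- The pull-back of a divergence-free vector field (as a closed `2`-form) under a smooth map
is weakly divergence free. -/
theorem integral_fluxDensity_of_smooth {v B : E3 → E3} {ψ : E3 → ℝ}
    (hv : ContDiff ℝ ((⊤ : ℕ∞) : WithTop ℕ∞) v) (hψ : ContDiff ℝ ((⊤ : ℕ∞) : WithTop ℕ∞) ψ)
    (hc : HasCompactSupport ψ) (hv0 : ∀ x ∈ tsupport ψ, v x ≠ 0) (hB : ContDiffOn ℝ 1 B {0}ᶜ)
    (hdiv : ∀ y ≠ 0, ∑ i, fderiv ℝ B y (stdVec i) i = 0) :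
    ∫ x, fluxDensity (B (v x)) (fderiv ℝ v x) (fderiv ℝ ψ x) = 0 := by
  have hv' : ContDiff ℝ ((⊤ : ℕ∞) : WithTop ℕ∞) (fderiv ℝ v) :=
    hv.fderiv_right (m := ((⊤ : ℕ∞) : WithTop ℕ∞)) (by norm_num)
  have hcv' : Continuous (fderiv ℝ v) := hv'.continuous
  have hcv'' : Continuous (fderiv ℝ (fderiv ℝ v)) := hv'.continuous_fderiv (by simp)
  have hmaps : Set.MapsTo v (tsupport ψ) ({0}ᶜ : Set E3) := hv0
  have hBc : ContinuousOn (fun x => B (v x)) (tsupport ψ) :=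
    hB.continuousOn.comp hv.continuous.continuousOn hmaps
  have hB'c : ContinuousOn (fun x => fderiv ℝ B (v x)) (tsupport ψ) :=
    (hB.continuousOn_fderiv_of_isOpen isOpen_compl_singleton le_rfl).comp
      hv.continuous.continuousOn hmaps
  let f : Fin 3 → Fin 3 → E3 → ℝ := fun i j x =>
    tripleProduct (B (v x)) (fderiv ℝ v x (stdVec i)) (fderiv ℝ v x (stdVec j))
  let f' : Fin 3 → Fin 3 → Fin 3 → E3 → ℝ := fun i j k x =>
    tripleProduct (fderiv ℝ B (v x) (fderiv ℝ v x (stdVec k)))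
        (fderiv ℝ v x (stdVec i)) (fderiv ℝ v x (stdVec j))
      + tripleProduct (B (v x)) (fderiv ℝ (fderiv ℝ v) x (stdVec k) (stdVec i))
          (fderiv ℝ v x (stdVec j))
      + tripleProduct (B (v x)) (fderiv ℝ v x (stdVec i))
          (fderiv ℝ (fderiv ℝ v) x (stdVec k) (stdVec j))
  have hfc : ∀ i j, ContinuousOn (f i j) (tsupport ψ) := fun i j =>
    continuousOn_tripleProduct hBc (hcv'.clm_apply continuous_const).continuousOn
      (hcv'.clm_apply continuous_const).continuousOn
  have hf'c : ∀ i j k, ContinuousOn (f' i j k) (tsupport ψ) := by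
    intro i j k
    have h1 : ∀ l, ContinuousOn (fun x => fderiv ℝ v x (stdVec l)) (tsupport ψ) := fun l =>
      (hcv'.clm_apply continuous_const).continuousOn
    have h2 : ∀ l, ContinuousOn (fun x => fderiv ℝ (fderiv ℝ v) x (stdVec k) (stdVec l))
        (tsupport ψ) := fun l =>
      ((hcv''.clm_apply continuous_const).clm_apply continuous_const).continuousOn
    exact ((continuousOn_tripleProduct (hB'c.clm_apply (h1 k)) (h1 i) (h1 j)).add
      (continuousOn_tripleProduct hBc (h2 i) (h1 j))).add (continuousOn_tripleProduct hBc (h1 i) (h2 j))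
  have hder : ∀ i j k, ∀ x ∈ tsupport ψ, HasLineDerivAt ℝ (f i j) (f' i j k x) x (stdVec k) := by
    intro i j k x hx
    have h1 : HasLineDerivAt ℝ (fun x => B (v x)) (fderiv ℝ B (v x) (fderiv ℝ v x (stdVec k))) x
        (stdVec k) := by
      have hd : HasFDerivAt B (fderiv ℝ B (v x)) (v x) :=
        ((hB.contDiffAt (isOpen_compl_singleton.mem_nhds (hv0 x hx))).differentiableAt
          one_ne_zero).hasFDerivAt
      exact (hd.comp x (hv.differentiable (by simp) x).hasFDerivAt).hasLineDerivAt (stdVec k)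
    have h2 : ∀ l, HasLineDerivAt ℝ (fun x => fderiv ℝ v x (stdVec l))
        (fderiv ℝ (fderiv ℝ v) x (stdVec k) (stdVec l)) x (stdVec k) := by
      intro l
      have hd := (hv'.differentiable (by simp) x).hasFDerivAt
      have := (hd.clm_apply (hasFDerivAt_const (stdVec l) x)).hasLineDerivAt (stdVec k)
      simpa using this
    exact h1.tripleProduct (h2 i) (h2 j)
  have hψc := hψ.continuous
  have hψ'c : ∀ k, Continuous (fun x => fderiv ℝ ψ x (stdVec k)) := fun k =>
    (hψ.continuous_fderiv (by simp)).clm_apply continuous_const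
  have hts : ∀ k, tsupport (fun x => fderiv ℝ ψ x (stdVec k)) ⊆ tsupport ψ := fun k =>
    closure_minimal (fun x hx => support_fderiv_subset ℝ fun h => hx (by simp [h]))
      (isClosed_tsupport _)
  have hcs : ∀ k, HasCompactSupport (fun x => fderiv ℝ ψ x (stdVec k)) := fun k =>
    hc.fderiv_apply ℝ _
  have hint : ∀ i j k, Integrable (fun x => f i j x * fderiv ℝ ψ x (stdVec k)) volume :=
    fun i j k => integrable_mul_of_continuousOn_tsupport (hψ'c k) (hcs k) ((hfc i j).mono (hts k))
  have hint' : ∀ i j k, Integrable (fun x => f' i j k x * ψ x) volume :=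
    fun i j k => integrable_mul_of_continuousOn_tsupport hψc hc (hf'c i j k)
  have hparts : ∀ i j k, ∫ x, f i j x * fderiv ℝ ψ x (stdVec k) = - ∫ x, f' i j k x * ψ x := by
    intro i j k
    exact integral_bilinear_hasLineDerivAt_right_eq_neg_left_of_integrable
      (B := ContinuousLinearMap.mul ℝ ℝ) (hint' i j k) (hint i j k)
      (integrable_mul_of_continuousOn_tsupport hψc hc (hfc i j)) (hder i j k)
      (fun x _ => ((hψ.differentiable (by simp) x).hasFDerivAt).hasLineDerivAt _)
  -- The terms with second derivatives of `v` cancel in pairs by symmetry and antisymmetry. The rest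
  -- is the divergence of `B` times the Jacobian determinant of `v`, by `tripleProduct_trace`.
  have hzero : ∀ x, f' 0 1 2 x * ψ x + f' 1 2 0 x * ψ x + f' 2 0 1 x * ψ x = 0 := by
    intro x
    by_cases hx : x ∈ tsupport ψ
    · have hsymm : ∀ a b, fderiv ℝ (fderiv ℝ v) x a b = fderiv ℝ (fderiv ℝ v) x b a := fun a b =>
        (hv.contDiffAt.isSymmSndFDerivAt
          (by simpa using WithTop.coe_le_coe.2 (le_top (a := (2 : ℕ∞))))) a b
      have htr := tripleProduct_trace (fderiv ℝ B (v x)) (fderiv ℝ v x (stdVec 0))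
        (fderiv ℝ v x (stdVec 1)) (fderiv ℝ v x (stdVec 2))
      rw [hdiv _ (hv0 x hx), zero_mul] at htr
      simp only [f']
      rw [hsymm (stdVec 2) (stdVec 0), hsymm (stdVec 2) (stdVec 1), hsymm (stdVec 1) (stdVec 0),
        tripleProduct_swap _ (fderiv ℝ (fderiv ℝ v) x (stdVec 0) (stdVec 2)),
        tripleProduct_swap _ (fderiv ℝ (fderiv ℝ v) x (stdVec 0) (stdVec 1)),
        tripleProduct_swap _ _ (fderiv ℝ (fderiv ℝ v) x (stdVec 1) (stdVec 2))]
      linear_combination ψ x * htr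
    · simp [image_eq_zero_of_notMem_tsupport hx]
  have e : ∀ x, fluxDensity (B (v x)) (fderiv ℝ v x) (fderiv ℝ ψ x) =
      f 0 1 x * fderiv ℝ ψ x (stdVec 2) + f 1 2 x * fderiv ℝ ψ x (stdVec 0)
        + f 2 0 x * fderiv ℝ ψ x (stdVec 1) := fun x => rfl
  simp only [e]
  have h1 := integral_add ((hint 0 1 2).add (hint 1 2 0)) (hint 2 0 1)
  have h2 := integral_add ((hint' 0 1 2).add (hint' 1 2 0)) (hint' 2 0 1)
  simp only [Pi.add_apply] at h1 h2
  rw [h1, integral_add (hint _ _ _) (hint _ _ _), hparts, hparts, hparts]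
  simp only [hzero, integral_zero] at h2
  rw [integral_add (hint' _ _ _) (hint' _ _ _)] at h2
  linarith

end Piola

end

/-! ### The pull-back identity for continuous `W^{1,2}` fields -/

noncomputable section

section InteriorIdentity

open MeasureTheory

theorem memLp_indicator_of_restrict {α F : Type*} [MeasurableSpace α] {μ : Measure α}
    [NormedAddCommGroup F] {p : ENNReal} {s : Set α} (hs : MeasurableSet s) {g : α → F}
    (hg : MemLp g p (μ.restrict s)) : MemLp (s.indicator g) p μ :=
  (memLp_indicator_iff_restrict hs).2 hg

/-- Local approximation of a continuous `W^{1,2}_{loc}` field by smooth fields, uniformly and in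
`W^{1,2}` on a compact set. -/
theorem ConvexPolyhedron.IsWeakGradient.exists_smooth_approx {U K : Set E3} (hU : IsOpen U)
    (hK : IsCompact K) (hKU : K ⊆ U) {u : E3 → E3} {G : E3 → E3 →L[ℝ] E3} (hu : ContinuousOn u U)
    (hG : ConvexPolyhedron.IsWeakGradient U u G)
    (hL : ∀ C ⊆ U, IsCompact C → MemLp G 2 (volume.restrict C)) :
    ∃ v : ℕ → E3 → E3, (∀ j, ContDiff ℝ ((⊤ : ℕ∞) : WithTop ℕ∞) (v j)) ∧
      TendstoUniformlyOn v u Filter.atTop K ∧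
      Filter.Tendsto (fun j => eLpNorm (fun x => fderiv ℝ (v j) x - G x) 2 (volume.restrict K))
        Filter.atTop (nhds 0) := by
  classical
  obtain ⟨δ, hδ, hδU⟩ := hK.exists_cthickening_subset_open hU hKU
  set K₁ := Metric.cthickening δ K with hK₁
  have hK₁c : IsCompact K₁ := hK.cthickening
  have hK₁m : MeasurableSet K₁ := hK₁c.isClosed.measurableSet
  have hball : ∀ x ∈ K, ∀ y, dist x y ≤ δ → y ∈ K₁ := fun x hx y hy =>
    Metric.mem_cthickening_of_dist_le y x δ K hx (by rwa [dist_comm])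
  set u' := K₁.indicator u with hu'
  set G' := K₁.indicator G with hG'
  have hu'i : Integrable u' volume :=
    ((hu.mono hδU).integrableOn_compact hK₁c).integrable_indicator hK₁m
  have hG'2 : MemLp G' 2 volume := memLp_indicator_of_restrict hK₁m (hL K₁ hδU hK₁c)
  -- The radii stay below `δ`, so at points of `K` the convolutions see only `K₁`, where the
  -- truncated `u'` and `G'` agree with `u` and `G`.
  let φ : ℕ → ContDiffBump (0 : E3) := fun j =>
    ⟨δ / 2 * (1 / ((j : ℝ) + 1)) / 2, δ / 2 * (1 / ((j : ℝ) + 1)), by positivity,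
      half_lt_self (by positivity)⟩
  have hφ : Filter.Tendsto (fun j => (φ j).rOut) Filter.atTop (nhds 0) := by
    have := (tendsto_one_div_add_atTop_nhds_zero_nat (𝕜 := ℝ)).const_mul (δ / 2)
    rw [mul_zero] at this
    exact this
  have hφδ : ∀ j, (φ j).rOut < δ := fun j => by
    have h1 : 1 / ((j : ℝ) + 1) ≤ 1 := by
      rw [div_le_one (by positivity)]
      linarith [(Nat.cast_nonneg j : (0 : ℝ) ≤ j)]
    have : δ / 2 * (1 / ((j : ℝ) + 1)) ≤ δ / 2 * 1 := by gcongr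
    change δ / 2 * (1 / ((j : ℝ) + 1)) < δ
    linarith
  let v : ℕ → E3 → E3 := fun j =>
    convolution ((φ j).normed volume) u' (ContinuousLinearMap.lsmul ℝ ℝ) volume
  have hcd : ∀ j, ContDiff ℝ ((⊤ : ℕ∞) : WithTop ℕ∞) ((φ j).normed (volume : Measure E3)) :=
    fun j => (φ j).contDiff_normed
  have hcd1 : ∀ j, ContDiff ℝ 1 ((φ j).normed (volume : Measure E3)) :=
    fun j => (φ j).contDiff_normed (n := 1)
  have hcs : ∀ j, HasCompactSupport ((φ j).normed (volume : Measure E3)) :=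
    fun j => (φ j).hasCompactSupport_normed
  have hvsm : ∀ j, ContDiff ℝ ((⊤ : ℕ∞) : WithTop ℕ∞) (v j) := fun j =>
    (hcs j).contDiff_convolution_left _ (hcd j) hu'i.locallyIntegrable
  have hder : ∀ j, ∀ x ∈ K, fderiv ℝ (v j) x =
      convolution ((φ j).normed volume) G' (ContinuousLinearMap.lsmul ℝ ℝ) volume x := by
    intro j x hx
    have h1 := (hcs j).hasFDerivAt_convolution_left (ContinuousLinearMap.lsmul ℝ ℝ) (hcd1 j)
      hu'i.locallyIntegrable x
    have hsubK : ∀ t, (φ j).normed volume (x - t) ≠ 0 → dist x t < (φ j).rOut := by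
      intro t ht
      have : x - t ∈ Function.support ((φ j).normed volume) := ht
      rwa [(φ j).support_normed_eq, mem_ball_zero_iff, ← dist_eq_norm] at this
    -- The reflected kernel centred at `x` is an admissible test function for the weak gradient, and
    -- testing with it moves the derivative of the convolution from the kernel to `u`.
    let η : E3 → ℝ := fun t => (φ j).normed volume (x - t)
    have hηs : ContDiff ℝ ((⊤ : ℕ∞) : WithTop ℕ∞) η := (hcd j).comp (contDiff_const.sub contDiff_id)
    have hηsupp : tsupport η ⊆ Metric.closedBall x (φ j).rOut := by
      refine closure_minimal (fun t ht => ?_) Metric.isClosed_closedBall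
      rw [Metric.mem_closedBall, dist_comm]
      exact (hsubK t ht).le
    have hηK₁ : tsupport η ⊆ K₁ := fun t ht => hball x hx t (by
      have := hηsupp ht
      rw [Metric.mem_closedBall, dist_comm] at this
      exact this.trans (hφδ j).le)
    have hηc : HasCompactSupport η := hK₁c.of_isClosed_subset (isClosed_tsupport _) hηK₁
    have hηd : ∀ t w, fderiv ℝ η t w = - fderiv ℝ ((φ j).normed volume) (x - t) w := by
      intro t w
      have hd := (((hcd1 j).differentiable one_ne_zero (x - t)).hasFDerivAt).comp t
        ((hasFDerivAt_const x t).sub (hasFDerivAt_id t))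
      have : fderiv ℝ η t = _ := hd.fderiv
      rw [this]
      simp
    rw [h1.fderiv, convolution_eq_swap, convolution_eq_swap]
    have hηsz : ∀ t, t ∉ K₁ → η t = 0 := fun t ht =>
      image_eq_zero_of_notMem_tsupport fun h => ht (hηK₁ h)
    have hηdz : ∀ t, t ∉ K₁ → fderiv ℝ η t = 0 := fun t ht => by
      by_contra h
      exact ht (hηK₁ (support_fderiv_subset ℝ h))
    have hint1 : Integrable (fun t => (ContinuousLinearMap.precompL E3
        (ContinuousLinearMap.lsmul ℝ ℝ)) (fderiv ℝ ((φ j).normed volume) (x - t)) (u' t)) volume := by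
      have h2 := ((hcs j).fderiv ℝ).convolutionExists_left
        (ContinuousLinearMap.precompL E3 (ContinuousLinearMap.lsmul ℝ ℝ : ℝ →L[ℝ] E3 →L[ℝ] E3))
        ((hcd j).continuous_fderiv (by simp)) hu'i.locallyIntegrable x
      exact (convolutionExistsAt_iff_integrable_swap).1 h2
    have hint2 : Integrable (fun t => (ContinuousLinearMap.lsmul ℝ ℝ)
        ((φ j).normed volume (x - t)) (G' t)) volume := by
      have h2 := (hcs j).convolutionExists_left
        (ContinuousLinearMap.lsmul ℝ ℝ : ℝ →L[ℝ] (E3 →L[ℝ] E3) →L[ℝ] (E3 →L[ℝ] E3))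
        ((φ j).continuous_normed) (hG'2.locallyIntegrable (by norm_num)) x
      exact (convolutionExistsAt_iff_integrable_swap).1 h2
    ext1 w
    have e1 := ContinuousLinearMap.integral_apply hint1 w
    have e2 := ContinuousLinearMap.integral_apply hint2 w
    have e3 := hG.2 η hηs hηc (hηK₁.trans hδU) w
    have hUm := hU.measurableSet
    have e4 : ∫ t in U, fderiv ℝ η t w • u t
        = ∫ t, -(fderiv ℝ ((φ j).normed volume) (x - t) w • u' t) := by
      rw [← integral_indicator hUm]
      congr 1
      ext1 t
      by_cases ht : t ∈ K₁
      · rw [Set.indicator_of_mem (hδU ht), hu', Set.indicator_of_mem ht, hηd, neg_smul]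
      · rw [hu', Set.indicator_of_notMem ht, smul_zero, neg_zero, Set.indicator_apply, hηdz t ht]
        simp
    have e5 : ∫ t in U, η t • G t w = ∫ t, η t • G' t w := by
      rw [← integral_indicator hUm]
      congr 1
      ext1 t
      by_cases ht : t ∈ K₁
      · rw [Set.indicator_of_mem (hδU ht), hG', Set.indicator_of_mem ht]
      · rw [Set.indicator_apply, hηsz t ht]
        simp
    rw [e4, e5, integral_neg, neg_inj] at e3
    exact e1.trans (e3.trans e2.symm)
  refine ⟨v, hvsm, ?_, ?_⟩
  · have huc : UniformContinuousOn u K₁ := hK₁c.uniformContinuousOn_of_continuous (hu.mono hδU)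
    rw [Metric.uniformContinuousOn_iff] at huc
    rw [Metric.tendstoUniformlyOn_iff]
    intro ε hε
    obtain ⟨r, hr, hr'⟩ := huc (ε / 2) (half_pos hε)
    filter_upwards [hφ.eventually_lt_const hr] with j hj x hx
    have hxK₁ : x ∈ K₁ := hball x hx x (by rw [dist_self]; exact hδ.le)
    have hux : u' x = u x := Set.indicator_of_mem hxK₁ u
    rw [← hux, dist_comm]
    refine lt_of_le_of_lt (ContDiffBump.dist_normed_convolution_le (ε := ε / 2) hu'i.1
      fun y hy => ?_) (half_lt_self hε)
    have hy' := Metric.mem_ball.1 hy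
    have hyK₁ : y ∈ K₁ := hball x hx y (by rw [dist_comm]; exact (hy'.trans (hφδ j)).le)
    rw [hux, hu', Set.indicator_of_mem hyK₁]
    exact (hr' y hyK₁ x hxK₁ (hy'.trans hj)).le
  · have h1 := tendsto_eLpNorm_convolution_sub hφ hG'2
    refine tendsto_of_tendsto_of_tendsto_of_le_of_le tendsto_const_nhds h1 (fun _ => bot_le)
      fun j => ?_
    refine le_trans (le_of_eq ?_) (eLpNorm_restrict_le _ _ _ K)
    refine eLpNorm_congr_ae ?_
    filter_upwards [ae_restrict_mem hK.isClosed.measurableSet] with x hx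
    have hxK₁ : x ∈ K₁ := hball x hx x (by rw [dist_self]; exact hδ.le)
    rw [Pi.sub_apply, hder j x hx, hG', Set.indicator_of_mem hxK₁]

theorem aestronglyMeasurable_fluxDensity {α : Type*} [MeasurableSpace α]
    {μ : Measure α} {b : α → E3} {G : α → E3 →L[ℝ] E3} {p : α → E3 →L[ℝ] ℝ}
    (hb : AEStronglyMeasurable b μ) (hG : AEStronglyMeasurable G μ)
    (hp : AEStronglyMeasurable p μ) :
    AEStronglyMeasurable (fun x => fluxDensity (b x) (G x) (p x)) μ := by
  have h : AEStronglyMeasurable (fun x => (b x, G x, p x)) μ := hb.prodMk (hG.prodMk hp)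
  have := Continuous.comp_aestronglyMeasurable
    (g := fun x : E3 × (E3 →L[ℝ] E3) × (E3 →L[ℝ] ℝ) => fluxDensity x.1 x.2.1 x.2.2)
    continuous_fluxDensity h
  exact this

/-- The density is quadratic in `G`, so square integrability is exactly enough. -/
theorem integrable_fluxDensity {α : Type*} [MeasurableSpace α]
    {μ : Measure α} {b : α → E3} {G : α → E3 →L[ℝ] E3} {p : α → E3 →L[ℝ] ℝ} {C₁ C₂ : ℝ}
    (hb : AEStronglyMeasurable b μ) (hG : MemLp G 2 μ) (hp : AEStronglyMeasurable p μ)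
    (hbC : ∀ᵐ x ∂μ, ‖b x‖ ≤ C₁) (hpC : ∀ᵐ x ∂μ, ‖p x‖ ≤ C₂) :
    Integrable (fun x => fluxDensity (b x) (G x) (p x)) μ := by
  have hi : Integrable (fun x => 18 * (C₁ * ‖G x‖ ^ 2) * C₂) μ :=
    ((((memLp_two_iff_integrable_sq_norm hG.1).1 hG).const_mul C₁).const_mul 18).mul_const C₂
  refine hi.mono' (aestronglyMeasurable_fluxDensity hb hG.1 hp) ?_
  filter_upwards [hbC, hpC] with x h1 h2
  refine (abs_fluxDensity_le _ _ _).trans ?_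
  have := (norm_nonneg _).trans h1
  gcongr

/-- The pull-back of a divergence-free vector field (as a closed `2`-form) under a continuous map
in `W^{1,2}_{loc}` is weakly divergence free. -/
theorem integral_fluxDensity_eq_zero {U : Set E3} (hU : IsOpen U) {u : E3 → E3}
    {G : E3 → E3 →L[ℝ] E3} (hu : ContinuousOn u U) (hu0 : ∀ x ∈ U, u x ≠ 0)
    (hG : ConvexPolyhedron.IsWeakGradient U u G)
    (hL : ∀ C ⊆ U, IsCompact C → MemLp G 2 (volume.restrict C)) {B : E3 → E3}
    (hB : ContDiffOn ℝ 1 B {0}ᶜ) (hdiv : ∀ y ≠ 0, ∑ i, fderiv ℝ B y (stdVec i) i = 0)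
    {ψ : E3 → ℝ} (hψ : ContDiff ℝ ((⊤ : ℕ∞) : WithTop ℕ∞) ψ) (hc : HasCompactSupport ψ)
    (hψU : tsupport ψ ⊆ U) :
    ∫ x in U, fluxDensity (B (u x)) (G x) (fderiv ℝ ψ x) = 0 := by
  set K := tsupport ψ with hKdef
  have hK : IsCompact K := hc
  have hKm : MeasurableSet K := hK.isClosed.measurableSet
  obtain ⟨v, hvs, hvu, hvL⟩ := hG.exists_smooth_approx hU hK hψU hu hL
  have hψ'0 : ∀ x ∉ K, fderiv ℝ ψ x = 0 := fun x hx => by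
    by_contra h
    exact hx (support_fderiv_subset ℝ h)
  have hψ'c : Continuous (fderiv ℝ ψ) := hψ.continuous_fderiv (by simp)
  obtain ⟨C₁, hC₁⟩ := (hc.fderiv ℝ).exists_bound_of_continuous hψ'c
  have hC₁0 : 0 ≤ C₁ := (norm_nonneg _).trans (hC₁ 0)
  have huK : ContinuousOn u K := hu.mono hψU
  have hBu : ContinuousOn (fun x => B (u x)) K :=
    hB.continuousOn.comp huK fun x hx => hu0 x (hψU hx)
  obtain ⟨C₂', hC₂'⟩ := hK.exists_bound_of_continuousOn hBu
  obtain ⟨C₂, hC₂0, hC₂⟩ : ∃ C₂, 0 ≤ C₂ ∧ ∀ x ∈ K, ‖B (u x)‖ ≤ C₂ :=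
    ⟨max C₂' 0, le_max_right _ _, fun x hx => (hC₂' x hx).trans (le_max_left _ _)⟩
  have hGK : MemLp G 2 (volume.restrict K) := hL K hψU hK
  have hIK : ∫ x in U, fluxDensity (B (u x)) (G x) (fderiv ℝ ψ x)
      = ∫ x in K, fluxDensity (B (u x)) (G x) (fderiv ℝ ψ x) :=
    setIntegral_eq_of_subset_of_forall_sdiff_eq_zero hU.measurableSet hψU fun x hx => by
      rw [hψ'0 x hx.2, fluxDensity_zero_right]
  rw [hIK]
  set I := ∫ x in K, fluxDensity (B (u x)) (G x) (fderiv ℝ ψ x) with hI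
  have hψm : AEStronglyMeasurable (fderiv ℝ ψ) (volume.restrict K) := hψ'c.aestronglyMeasurable
  have hIi : Integrable (fun x => fluxDensity (B (u x)) (G x) (fderiv ℝ ψ x)) (volume.restrict K) :=
    integrable_fluxDensity (hBu.aestronglyMeasurable hKm) hGK hψm
      ((ae_restrict_iff' hKm).2 (Filter.Eventually.of_forall hC₂)) (Filter.Eventually.of_forall hC₁)
  -- uniform convergence of the composition with `B`
  have hunif : ∀ η > 0, ∀ᶠ j in Filter.atTop, ∀ x ∈ K, v j x ≠ 0 ∧ ‖B (v j x) - B (u x)‖ ≤ η := by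
    intro η hη
    have hcK : IsCompact (u '' K) := hK.image_of_continuousOn huK
    have hsub : u '' K ⊆ ({0}ᶜ : Set E3) := by
      rintro _ ⟨x, hx, rfl⟩
      exact hu0 x (hψU hx)
    -- The mollified fields are not unit, but eventually they take values in a compact neighbourhood
    -- of `u '' K` that avoids the singularity of `B`.
    obtain ⟨r, hr, hrsub⟩ := hcK.exists_cthickening_subset_open isOpen_compl_singleton hsub
    have huc := (hcK.cthickening (r := r)).uniformContinuousOn_of_continuous
      (hB.continuousOn.mono hrsub)
    rw [Metric.uniformContinuousOn_iff] at huc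
    obtain ⟨r', hr', hr''⟩ := huc η hη
    rw [Metric.tendstoUniformlyOn_iff] at hvu
    filter_upwards [hvu (min r r') (lt_min hr hr')] with j hj x hx
    have h1 := hj x hx
    have hux : u x ∈ Metric.cthickening r (u '' K) :=
      Metric.self_subset_cthickening _ ⟨x, hx, rfl⟩
    have hvx : v j x ∈ Metric.cthickening r (u '' K) := by
      refine Metric.mem_cthickening_of_dist_le _ (u x) r _ ⟨x, hx, rfl⟩ ?_
      rw [dist_comm]
      exact (h1.trans_le (min_le_left _ _)).le
    refine ⟨hrsub hvx, ?_⟩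
    rw [← dist_eq_norm]
    refine (hr'' _ hvx _ hux ?_).le
    rw [dist_comm]
    exact h1.trans_le (min_le_right _ _)
  set A := ∫ x in K, ‖G x‖ ^ 2 with hA
  let S : ℕ → ℝ := fun j => ∫ x in K, ‖fderiv ℝ (v j) x - G x‖ ^ 2
  have hv'c : ∀ j, Continuous (fderiv ℝ (v j)) := fun j => (hvs j).continuous_fderiv (by simp)
  have hv'L : ∀ j, MemLp (fderiv ℝ (v j)) 2 (volume.restrict K) := by
    intro j
    obtain ⟨C, hC⟩ := hK.exists_bound_of_continuousOn (hv'c j).continuousOn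
    have : IsFiniteMeasure (volume.restrict K) := ⟨by
      rw [Measure.restrict_apply_univ]; exact hK.measure_lt_top⟩
    exact MemLp.of_bound (hv'c j).aestronglyMeasurable C
      ((ae_restrict_iff' hKm).2 (Filter.Eventually.of_forall hC))
  have hDL : ∀ j, MemLp (fun x => fderiv ℝ (v j) x - G x) 2 (volume.restrict K) := fun j =>
    (hv'L j).sub hGK
  have hS : Filter.Tendsto S Filter.atTop (nhds 0) := by
    have h1 : ∀ j, S j
        = (eLpNorm (fun x => fderiv ℝ (v j) x - G x) 2 (volume.restrict K) ^ 2).toReal := by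
      intro j
      rw [eLpNorm_two_sq]
      change ∫ x in K, ‖fderiv ℝ (v j) x - G x‖ ^ 2 = _
      have hm : AEStronglyMeasurable (fun x => ‖fderiv ℝ (v j) x - G x‖ ^ 2) (volume.restrict K) :=
        (hDL j).1.norm.pow 2
      rw [integral_eq_lintegral_of_nonneg_ae (Filter.Eventually.of_forall fun x => sq_nonneg _) hm]
      congr 2
      ext x
      rw [ENNReal.ofReal_pow (norm_nonneg _), ofReal_norm]
    have h2 : Filter.Tendsto (fun j => (eLpNorm (fun x => fderiv ℝ (v j) x - G x) 2
        (volume.restrict K) ^ 2).toReal) Filter.atTop (nhds ((0 : ENNReal) ^ 2).toReal) := by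
      refine (ENNReal.tendsto_toReal (by simp)).comp ?_
      exact (ENNReal.continuous_pow 2).tendsto 0 |>.comp hvL
    have h3 : S = _ := funext h1
    rw [h3]
    simpa using h2
  -- Two limits in order: for fixed `η` the mollification index goes to infinity, which removes the
  -- `L²` error `S j` despite its factor `1 / η`; only then does `η` go to zero.
  have hbound : ∀ η : ℝ, 0 < η → |I| ≤ 18 * C₁ * ((2 + C₂) * A) * η := by
    intro η hη
    have hev : ∀ᶠ j in Filter.atTop, |I| ≤ 18 * C₁ * ((2 + C₂) * A) * η
        + 18 * C₁ * (2 * η + C₂ * (1 + 1 / η)) * S j := by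
      filter_upwards [hunif η hη] with j hj
      have hBv : ContinuousOn (fun x => B (v j x)) K :=
        hB.continuousOn.comp (hvs j).continuous.continuousOn fun x hx => (hj x hx).1
      obtain ⟨C₃, hC₃⟩ := hK.exists_bound_of_continuousOn hBv
      have hJi : Integrable (fun x => fluxDensity (B (v j x)) (fderiv ℝ (v j) x) (fderiv ℝ ψ x))
          (volume.restrict K) :=
        integrable_fluxDensity (hBv.aestronglyMeasurable hKm) (hv'L j) hψm
          ((ae_restrict_iff' hKm).2 (Filter.Eventually.of_forall hC₃))
          (Filter.Eventually.of_forall hC₁)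
      have hJ : ∫ x in K, fluxDensity (B (v j x)) (fderiv ℝ (v j) x) (fderiv ℝ ψ x) = 0 := by
        rw [setIntegral_eq_integral_of_forall_compl_eq_zero]
        · exact integral_fluxDensity_of_smooth (hvs j) hψ hc (fun x hx => (hj x hx).1) hB hdiv
        · intro x hx
          rw [hψ'0 x hx, fluxDensity_zero_right]
      have hIJ : -I = ∫ x in K, (fluxDensity (B (v j x)) (fderiv ℝ (v j) x) (fderiv ℝ ψ x)
          - fluxDensity (B (u x)) (G x) (fderiv ℝ ψ x)) := by
        rw [integral_sub hJi hIi, hJ, zero_sub]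
      have hG2i : Integrable (fun x => ‖G x‖ ^ 2) (volume.restrict K) :=
        (memLp_two_iff_integrable_sq_norm hGK.1).1 hGK
      have hD2i : Integrable (fun x => ‖fderiv ℝ (v j) x - G x‖ ^ 2) (volume.restrict K) :=
        (memLp_two_iff_integrable_sq_norm (hDL j).1).1 (hDL j)
      have hb1 : |I| ≤ ∫ x in K, (18 * C₁ * ((2 + C₂) * η) * ‖G x‖ ^ 2
          + 18 * C₁ * (2 * η + C₂ * (1 + 1 / η)) * ‖fderiv ℝ (v j) x - G x‖ ^ 2) := by
        rw [← abs_neg, hIJ]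
        rw [← Real.norm_eq_abs]
        refine norm_integral_le_of_norm_le
          (g := fun x => 18 * C₁ * ((2 + C₂) * η) * ‖G x‖ ^ 2
            + 18 * C₁ * (2 * η + C₂ * (1 + 1 / η)) * ‖fderiv ℝ (v j) x - G x‖ ^ 2)
          ((hG2i.const_mul _).add (hD2i.const_mul _)) ?_
        refine (ae_restrict_iff' hKm).2 (Filter.Eventually.of_forall fun x hx => ?_)
        refine (abs_fluxDensity_sub_le _ _ _ _ _).trans ?_
        set g := ‖G x‖
        set d := ‖fderiv ℝ (v j) x - G x‖
        set g' := ‖fderiv ℝ (v j) x‖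
        have hg0 : 0 ≤ g := norm_nonneg _
        have hd0 : 0 ≤ d := norm_nonneg _
        have hg'0 : 0 ≤ g' := norm_nonneg _
        have hg' : g' ≤ g + d := by
          have := norm_add_le (G x) (fderiv ℝ (v j) x - G x)
          rwa [add_sub_cancel] at this
        have k1 : g' ^ 2 ≤ 2 * g ^ 2 + 2 * d ^ 2 := by nlinarith [sq_nonneg (g - d)]
        -- Young's inequality with weight `η` puts the large constant on the term that tends to
        -- zero.
        have k2 : d * (g' + g) ≤ η * g ^ 2 + (1 + 1 / η) * d ^ 2 := by
          have : 2 * d * g ≤ η * g ^ 2 + 1 / η * d ^ 2 := by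
            have h3 : 0 ≤ (η * g - d) ^ 2 / η := by positivity
            have h4 : (η * g - d) ^ 2 / η = η * g ^ 2 + 1 / η * d ^ 2 - 2 * d * g := by
              field_simp
              ring
            linarith
          nlinarith [mul_le_mul_of_nonneg_left hg' hd0]
        have k3 : ‖B (v j x) - B (u x)‖ * g' ^ 2 + ‖B (u x)‖ * d * (g' + g)
            ≤ η * (2 * g ^ 2 + 2 * d ^ 2) + C₂ * (η * g ^ 2 + (1 + 1 / η) * d ^ 2) := by
          have := (hj x hx).2
          have := hC₂ x hx
          rw [mul_assoc ‖B (u x)‖]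
          gcongr
        calc _ ≤ 18 * (η * (2 * g ^ 2 + 2 * d ^ 2) + C₂ * (η * g ^ 2 + (1 + 1 / η) * d ^ 2)) * C₁ := by
              have := hC₁ x
              have k4 : 0 ≤ η * (2 * g ^ 2 + 2 * d ^ 2)
                + C₂ * (η * g ^ 2 + (1 + 1 / η) * d ^ 2) := by positivity
              gcongr
          _ = _ := by ring
      rw [integral_add (hG2i.const_mul _) (hD2i.const_mul _), integral_const_mul,
        integral_const_mul] at hb1
      calc _ ≤ _ := hb1
        _ = _ := by simp only [S, hA]; ring
    have hlim := (hS.const_mul (18 * C₁ * (2 * η + C₂ * (1 + 1 / η)))).const_add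
      (18 * C₁ * ((2 + C₂) * A) * η)
    rw [mul_zero, add_zero] at hlim
    exact ge_of_tendsto hlim hev
  have hlim : Filter.Tendsto (fun η : ℝ => 18 * C₁ * ((2 + C₂) * A) * η)
      (nhdsWithin 0 (Set.Ioi 0)) (nhds 0) := by
    have : Filter.Tendsto (fun η : ℝ => 18 * C₁ * ((2 + C₂) * A) * η) (nhds 0) 
        (nhds (18 * C₁ * ((2 + C₂) * A) * 0)) := (continuous_const.mul continuous_id).tendsto 0
    rw [mul_zero] at this
    exact this.mono_left inf_le_left
  have := ge_of_tendsto hlim (Filter.eventually_of_mem self_mem_nhdsWithin fun η hη => hbound η hη)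
  exact abs_nonpos_iff.1 this

end InteriorIdentity

end

/-! ### The cut-off area form and the flux of a tangent field -/

noncomputable section

section Divergence

/-- The divergence is `y · ∇θ + 3 θ`, and Euler's relation for degree `-3` gives `y · ∇θ = -3 θ`. -/
theorem divergence_smul_id_of_homogeneous {θ : E3 → ℝ} {y : E3}
    (hθ : DifferentiableAt ℝ θ y) (hhom : ∀ t : ℝ, 0 < t → θ (t • y) = (t ^ 3)⁻¹ * θ y) :
    ∑ i, fderiv ℝ (fun z => θ z • z) y (stdVec i) i = 0 := by
  have h1 : HasFDerivAt (fun z : E3 => θ z • z)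
      (θ y • ContinuousLinearMap.id ℝ E3 + (fderiv ℝ θ y).smulRight y) y :=
    hθ.hasFDerivAt.smul (hasFDerivAt_id y)
  have h2 : HasDerivAt (fun t : ℝ => θ (t • y)) (fderiv ℝ θ y y) 1 := by
    have ht : HasDerivAt (fun t : ℝ => t • y) y 1 := by
      simpa using (hasDerivAt_id (1 : ℝ)).smul_const y
    have hθ' : HasFDerivAt θ (fderiv ℝ θ y) ((fun t : ℝ => t • y) 1) := by
      simpa using hθ.hasFDerivAt
    exact hθ'.comp_hasDerivAt (1 : ℝ) ht
  have h3 : HasDerivAt (fun t : ℝ => (t ^ 3)⁻¹ * θ y) (-3 * θ y) 1 := by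
    have := (((hasDerivAt_id (1 : ℝ)).pow 3).inv (by norm_num)).mul_const (θ y)
    simpa using this
  have h4 : fderiv ℝ θ y y = -3 * θ y := by
    refine (h2.congr_of_eventuallyEq ?_).unique h3 |>.symm ▸ rfl
    filter_upwards [lt_mem_nhds (zero_lt_one (α := ℝ))] with t ht
    exact (hhom t ht).symm
  have h5 := (fderiv ℝ θ y).apply_eq_sum_stdVec y
  rw [h4] at h5
  rw [h1.fderiv, Fin.sum_univ_three]
  simp only [stdVec, smul_eq_mul] at h5
  simp [stdVec]
  linarith

end Divergence

namespace ConvexPolyhedron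

variable (P : ConvexPolyhedron)

/-- The finite set of unit normals of the faces. -/
def normals : Finset E3 := P.finite_faceNormals.toFinset

theorem mem_normals {ν : E3} : ν ∈ P.normals ↔ P.IsFaceNormal ν := by
  simp [normals]

/-- A function on the space of directions which vanishes near the great circles of directions
tangent to some face, and tends to `1` away from these circles as `k → ∞`. -/
def cutoff (k : ℕ) (y : E3) : ℝ :=
  ∏ ν ∈ P.normals, Real.smoothTransition ((((k : ℝ) + 1) * (inner ℝ ν y / ‖y‖)) ^ 2 - 1)

/-- The radial divergence-free field `y / |y|³`, cut off near the planes parallel to the faces. -/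
def cutoffField (k : ℕ) (y : E3) : E3 := (P.cutoff k y / ‖y‖ ^ 3) • y

theorem cutoff_nonneg (k : ℕ) (y : E3) : 0 ≤ P.cutoff k y :=
  Finset.prod_nonneg fun _ _ => Real.smoothTransition.nonneg _

theorem cutoff_le_one (k : ℕ) (y : E3) : P.cutoff k y ≤ 1 :=
  Finset.prod_le_one (fun _ _ => Real.smoothTransition.nonneg _)
    fun _ _ => Real.smoothTransition.le_one _

theorem cutoffField_of_norm_eq_one {k : ℕ} {y : E3} (hy : ‖y‖ = 1) :
    P.cutoffField k y = P.cutoff k y • y := by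
  rw [cutoffField, hy]
  simp

theorem norm_cutoffField_le {k : ℕ} {y : E3} (hy : ‖y‖ = 1) : ‖P.cutoffField k y‖ ≤ 1 := by
  rw [P.cutoffField_of_norm_eq_one hy, norm_smul, hy, mul_one, Real.norm_eq_abs,
    abs_of_nonneg (P.cutoff_nonneg k y)]
  exact P.cutoff_le_one k y

theorem contDiffAt_cutoff (k : ℕ) {y : E3} (hy : y ≠ 0) : ContDiffAt ℝ 1 (P.cutoff k) y := by
  unfold cutoff
  refine contDiffAt_prod fun ν _ => ?_
  refine (Real.smoothTransition.contDiff (n := 1)).contDiffAt.comp y ?_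
  have h1 : ContDiffAt ℝ 1 (fun y : E3 => ‖y‖) y := contDiffAt_norm ℝ hy
  have h2 : ContDiffAt ℝ 1 (fun y : E3 => inner ℝ ν y) y :=
    contDiffAt_const.inner ℝ contDiffAt_id
  exact ((contDiffAt_const.mul (h2.div h1 (norm_ne_zero_iff.2 hy))).pow 2).sub contDiffAt_const

theorem contDiffAt_cutoff_div (k : ℕ) {y : E3} (hy : y ≠ 0) :
    ContDiffAt ℝ 1 (fun y => P.cutoff k y / ‖y‖ ^ 3) y :=
  (P.contDiffAt_cutoff k hy).div ((contDiffAt_norm ℝ hy).pow 3)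
    (pow_ne_zero _ (norm_ne_zero_iff.2 hy))

theorem contDiffOn_cutoffField (k : ℕ) : ContDiffOn ℝ 1 (P.cutoffField k) {0}ᶜ := fun _ hy =>
  ((P.contDiffAt_cutoff_div k hy).smul contDiffAt_id).contDiffWithinAt

theorem divergence_cutoffField (k : ℕ) (y : E3) (hy : y ≠ 0) :
    ∑ i, fderiv ℝ (P.cutoffField k) y (stdVec i) i = 0 := by
  refine divergence_smul_id_of_homogeneous
    ((P.contDiffAt_cutoff_div k hy).differentiableAt one_ne_zero) fun t ht => ?_
  have h1 : P.cutoff k (t • y) = P.cutoff k y := by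
    unfold cutoff
    refine Finset.prod_congr rfl fun ν _ => ?_
    rw [inner_smul_right, norm_smul, Real.norm_of_nonneg ht.le, mul_div_mul_left _ _ ht.ne']
  rw [h1, norm_smul, Real.norm_of_nonneg ht.le, mul_pow]
  field_simp

/-- The factor of `ν` is zero on a whole open cone around the plane orthogonal to `ν`, not just on
that plane. -/
theorem eventually_cutoffField_eq_zero (k : ℕ) {ν y : E3} (hν : P.IsFaceNormal ν) (hy : y ≠ 0)
    (hνy : inner ℝ ν y = 0) : ∀ᶠ z in nhds y, P.cutoffField k z = 0 := by
  have hc : ContinuousAt (fun z : E3 => (((k : ℝ) + 1) * (inner ℝ ν z / ‖z‖)) ^ 2) y := by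
    have : ContinuousAt (fun z : E3 => inner ℝ ν z / ‖z‖) y :=
      ContinuousAt.div (by fun_prop) (by fun_prop) (norm_ne_zero_iff.2 hy)
    exact (continuousAt_const.mul this).pow 2
  have h0 : (((k : ℝ) + 1) * (inner ℝ ν y / ‖y‖)) ^ 2 < 1 := by simp [hνy]
  filter_upwards [hc.eventually_lt_const h0] with z hz
  have : P.cutoff k z = 0 := by
    refine Finset.prod_eq_zero (P.mem_normals.2 hν) ?_
    exact Real.smoothTransition.zero_of_nonpos (by linarith)
  rw [cutoffField, this, zero_div, zero_smul]

theorem tendsto_cutoff {y : E3} (hy : y ≠ 0) (h : ∀ ν ∈ P.normals, inner ℝ ν y ≠ 0) :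
    Filter.Tendsto (fun k => P.cutoff k y) Filter.atTop (nhds 1) := by
  have h1 : ∀ ν ∈ P.normals, ∀ᶠ k : ℕ in Filter.atTop,
      Real.smoothTransition ((((k : ℝ) + 1) * (inner ℝ ν y / ‖y‖)) ^ 2 - 1) = 1 := by
    intro ν hν
    set a := inner ℝ ν y / ‖y‖ with ha
    have ha0 : 0 < |a| := abs_pos.2 (div_ne_zero (h ν hν) (norm_ne_zero_iff.2 hy))
    obtain ⟨K, hK⟩ := exists_nat_gt (2 / |a|)
    filter_upwards [Filter.eventually_ge_atTop K] with k hk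
    apply Real.smoothTransition.one_of_one_le
    have hk' : (K : ℝ) ≤ k := Nat.cast_le.2 hk
    rw [div_lt_iff₀ ha0] at hK
    have h2 : 2 ≤ ((k : ℝ) + 1) * |a| := by nlinarith
    have h3 : (((k : ℝ) + 1) * a) ^ 2 = (((k : ℝ) + 1) * |a|) ^ 2 := by
      rw [mul_pow, mul_pow, sq_abs]
    rw [h3]
    nlinarith
  have h2 : ∀ᶠ k : ℕ in Filter.atTop, P.cutoff k y = 1 := by
    filter_upwards [(Finset.eventually_all P.normals).2 h1] with k hk
    exact Finset.prod_eq_one hk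
  exact tendsto_const_nhds.congr' (h2.mono fun k hk => hk.symm)

/-- A continuous nowhere vanishing tangent field, with a given weak gradient which is locally
square integrable in the interior. -/
structure IsAdmissible (u : E3 → E3) (G : E3 → E3 →L[ℝ] E3) : Prop where
  continuousOn : ContinuousOn u P.domain
  ne_zero : ∀ x ∈ P.domain, u x ≠ 0
  tangent : ∀ ν, P.IsFaceNormal ν → ∀ x ∈ P.domain, x ∈ P.face ν → inner ℝ ν (u x) = 0
  isWeakGradient : IsWeakGradient (interior P.body) u G
  memLp : ∀ C ⊆ interior P.body, IsCompact C →
    MeasureTheory.MemLp G 2 (MeasureTheory.volume.restrict C)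

/-- The flux of the pulled-back cut-off area form through the level sets of `φ`. -/
def flux (k : ℕ) (u : E3 → E3) (G : E3 → E3 →L[ℝ] E3) (φ : E3 → ℝ) : ℝ :=
  ∫ x in interior P.body, fluxDensity (P.cutoffField k (u x)) (G x) (fderiv ℝ φ x)

variable {P}

theorem exists_smooth_cutoff {K U : Set E3} (hK : IsCompact K) (hU : IsOpen U) (hKU : K ⊆ U) :
    ∃ η : E3 → ℝ, ContDiff ℝ ((⊤ : ℕ∞) : WithTop ℕ∞) η ∧ HasCompactSupport η ∧ tsupport η ⊆ U ∧
      ∀ x ∈ K, ∀ᶠ y in nhds x, η y = 1 := by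
  obtain ⟨δ, hδ, hδU⟩ := hK.exists_cthickening_subset_open hU hKU
  obtain ⟨f, hf1, hf0, -⟩ := exists_contMDiffMap_one_nhds_of_subset_interior
    (n := (⊤ : ℕ∞)) (modelWithCornersSelf ℝ E3) (s := K)
    (t := Metric.cthickening δ K) hK.isClosed
    ((Metric.self_subset_thickening hδ K).trans (Metric.thickening_subset_interior_cthickening δ K))
  have hsupp : tsupport f ⊆ Metric.cthickening δ K := by
    refine closure_minimal (fun x hx => ?_) Metric.isClosed_cthickening
    by_contra h
    exact hx (hf0 x h)
  refine ⟨f, f.contMDiff.contDiff, hK.cthickening.of_isClosed_subset (isClosed_tsupport _) hsupp,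
    hsupp.trans hδU, fun x hx => ?_⟩
  exact Filter.eventually_iff.2 ((mem_nhdsSet_iff_forall.1 hf1) x hx)

/-- This replaces boundary terms. A boundary point of `T` is not a vertex, so it lies on a face and
`u` is parallel to that face there; by continuity `u` stays, nearby, in the directions where the
form was cut off. Hence the support of the pulled-back form, within `T`, is a compact subset of the
interior. -/
theorem IsAdmissible.exists_compact {u : E3 → E3} {G : E3 → E3 →L[ℝ] E3}
    (h : P.IsAdmissible u G) (k : ℕ) {T : Set E3} (hT : IsClosed T)
    (hv : ∀ v ∈ P.vertices, v ∉ T) :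
    ∃ K ⊆ interior P.body, IsCompact K ∧
      ∀ x ∈ interior P.body, x ∈ T → x ∉ K → P.cutoffField k (u x) = 0 := by
  set N : Set E3 := {x | x ∈ P.domain ∧ P.cutoffField k (u x) ≠ 0} with hN
  have hNb : closure N ⊆ P.body :=
    closure_minimal (fun x hx => hx.1.1) P.isClosed_body
  refine ⟨closure N ∩ T, ?_, P.isCompact_body.of_isClosed_subset
    (isClosed_closure.inter hT) fun x hx => hNb hx.1, fun x hx hxT hxK => ?_⟩
  · rintro x ⟨hx, hxT⟩
    by_contra hxi
    have hxd : x ∈ P.domain := ⟨hNb hx, fun hxv => hv x hxv hxT⟩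
    obtain ⟨ν, hν, hxν⟩ := P.exists_faceNormal_of_mem_domain hxd hxi
    have h1 := P.eventually_cutoffField_eq_zero k hν (h.ne_zero x hxd) (h.tangent ν hν x hxd hxν)
    have h2 := (h.continuousOn x hxd).eventually h1
    rw [eventually_nhdsWithin_iff] at h2
    obtain ⟨z, hz, hzN⟩ := (mem_closure_iff_frequently.1 hx).and_eventually h2 |>.exists
    exact hz.2 (hzN hz.1)
  · by_contra hne
    exact hxK ⟨subset_closure ⟨P.interior_subset_domain hx, hne⟩, hxT⟩

/-- Multiplying `ψ` by a function which is `1` near that compact set does not change the integrand,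
and makes `ψ` an admissible test function for the interior identity. -/
theorem IsAdmissible.flux_eq_zero {u : E3 → E3} {G : E3 → E3 →L[ℝ] E3} (h : P.IsAdmissible u G)
    (k : ℕ) {ψ : E3 → ℝ} (hψ : ContDiff ℝ ((⊤ : ℕ∞) : WithTop ℕ∞) ψ)
    (hv : ∀ v ∈ P.vertices, v ∉ tsupport ψ) : P.flux k u G ψ = 0 := by
  obtain ⟨K, hKU, hK, hKz⟩ := h.exists_compact k (isClosed_tsupport ψ) hv
  obtain ⟨η, hη, hηc, hηU, hη1⟩ := exists_smooth_cutoff hK isOpen_interior hKU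
  have hcU : ContinuousOn u (interior P.body) := h.continuousOn.mono P.interior_subset_domain
  have key := integral_fluxDensity_eq_zero isOpen_interior hcU
    (fun x hx => h.ne_zero x (P.interior_subset_domain hx)) h.isWeakGradient h.memLp
    (P.contDiffOn_cutoffField k) (P.divergence_cutoffField k) (hη.mul hψ)
    (hηc.mul_right) ((tsupport_mul_subset_left).trans hηU)
  rw [flux, ← key]
  refine MeasureTheory.setIntegral_congr_fun isOpen_interior.measurableSet fun x hx => ?_
  by_cases hxψ : x ∈ tsupport ψ
  · by_cases hxK : x ∈ K
    · have : (fun y => η y * ψ y) =ᶠ[nhds x] ψ := by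
        filter_upwards [hη1 x hxK] with y hy
        rw [hy, one_mul]
      rw [this.fderiv_eq]
    · rw [hKz x hx hxψ hxK, fluxDensity_zero_left, fluxDensity_zero_left]
  · have h1 : fderiv ℝ ψ x = 0 := by
      by_contra hne
      exact hxψ (support_fderiv_subset ℝ hne)
    have h2 : fderiv ℝ (fun y => η y * ψ y) x = 0 := by
      by_contra hne
      exact hxψ (tsupport_mul_subset_right (support_fderiv_subset ℝ hne))
    rw [h1, h2]

end ConvexPolyhedron
end

/-! ### Calculus of weak gradients -/

noncomputable section

namespace ConvexPolyhedron

section WeakGradient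

open MeasureTheory

theorem integrable_smul_of_locallyIntegrableOn {F : Type*} [NormedAddCommGroup F]
    [NormedSpace ℝ F] {U : Set E3} {f : E3 → ℝ} {g : E3 → F}
    (hf : Continuous f) (hc : HasCompactSupport f) (hfU : tsupport f ⊆ U)
    (hg : LocallyIntegrableOn g U volume) :
    Integrable (fun x => f x • g x) volume := by
  rw [← integrableOn_iff_integrable_of_support_subset (s := tsupport f)]
  · exact (hg.integrableOn_compact_subset hfU hc).continuousOn_smul hf.continuousOn hc
  · intro x hx
    refine subset_tsupport f fun h => hx ?_
    change f x • g x = 0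
    rw [h, zero_smul]

theorem locallyIntegrableOn_fun_add {F : Type*} [NormedAddCommGroup F] {U : Set E3}
    {f g : E3 → F} (hf : LocallyIntegrableOn f U volume) (hg : LocallyIntegrableOn g U volume) :
    LocallyIntegrableOn (fun x => f x + g x) U volume := by
  have : LocallyIntegrableOn (f + g) U volume := hf.add hg
  exact this

theorem memLp_fun_add {α F : Type*} [MeasurableSpace α] [NormedAddCommGroup F] {μ : Measure α}
    {f g : α → F} {p : ENNReal} (hf : MemLp f p μ) (hg : MemLp g p μ) :
    MemLp (fun x => f x + g x) p μ :=
  hf.add hg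

/-- Continuous fields with a given locally square-integrable weak gradient. -/
structure HasW12Loc (U : Set E3) (u : E3 → E3) (G : E3 → E3 →L[ℝ] E3) : Prop where
  continuousOn : ContinuousOn u U
  isWeakGradient : IsWeakGradient U u G
  memLp : ∀ C ⊆ U, IsCompact C → MemLp G 2 (volume.restrict C)

variable {U : Set E3} {u u' : E3 → E3} {G G' : E3 → E3 →L[ℝ] E3}

theorem setIntegral_smul_of_tsupport_subset {F : Type*} [NormedAddCommGroup F]
    [NormedSpace ℝ F] {f : E3 → ℝ} {g : E3 → F} (hfU : tsupport f ⊆ U) :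
    ∫ x in U, f x • g x = ∫ x, f x • g x :=
  setIntegral_eq_integral_of_forall_compl_eq_zero fun x hx => by
    rw [image_eq_zero_of_notMem_tsupport fun h => hx (hfU h), zero_smul]

theorem tsupport_fderiv_apply_subset (φ : E3 → ℝ) (w : E3) :
    tsupport (fun x => fderiv ℝ φ x w) ⊆ tsupport φ :=
  closure_minimal (fun x hx => support_fderiv_subset ℝ fun h => hx (by simp [h]))
    (isClosed_tsupport _)

theorem integrable_smul_apply {φ : E3 → ℝ} (hφ : Continuous φ) (hc : HasCompactSupport φ)
    (hφU : tsupport φ ⊆ U) {F₁ F₂ : Type*} [NormedAddCommGroup F₁] [NormedSpace ℝ F₁]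
    [NormedAddCommGroup F₂] [NormedSpace ℝ F₂] {G : E3 → F₁ →L[ℝ] F₂}
    (hG : LocallyIntegrableOn G U volume) (w : F₁) :
    Integrable (fun x => φ x • G x w) volume := by
  have h : Integrable (fun x => φ x • G x) volume :=
    integrable_smul_of_locallyIntegrableOn hφ hc hφU hG
  exact h.apply_continuousLinearMap w

theorem HasW12Loc.add (hU : IsOpen U) (h : HasW12Loc U u G) (h' : HasW12Loc U u' G') :
    HasW12Loc U (fun x => u x + u' x) (fun x => G x + G' x) := by
  have hli : LocallyIntegrableOn (fun x => G x + G' x) U volume :=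
    locallyIntegrableOn_fun_add h.isWeakGradient.1 h'.isWeakGradient.1
  refine ⟨h.continuousOn.add h'.continuousOn, ⟨hli, ?_⟩,
    fun C hC hCc => memLp_fun_add (h.memLp C hC hCc) (h'.memLp C hC hCc)⟩
  intro φ hφ hc hφU w
  have hd : Continuous fun x => fderiv ℝ φ x w :=
    (hφ.continuous_fderiv (by simp)).clm_apply continuous_const
  have hdc : HasCompactSupport fun x => fderiv ℝ φ x w := hc.fderiv_apply ℝ _
  have hds := (tsupport_fderiv_apply_subset φ w).trans hφU
  have hum := hU.measurableSet
  have i1 := (integrable_smul_of_locallyIntegrableOn hd hdc hds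
    (h.continuousOn.locallyIntegrableOn hum)).restrict (s := U)
  have i2 := (integrable_smul_of_locallyIntegrableOn hd hdc hds
    (h'.continuousOn.locallyIntegrableOn hum)).restrict (s := U)
  have i3 := (integrable_smul_apply hφ.continuous hc hφU h.isWeakGradient.1 w).restrict (s := U)
  have i4 := (integrable_smul_apply hφ.continuous hc hφU h'.isWeakGradient.1 w).restrict (s := U)
  simp only [smul_add, add_apply]
  rw [integral_add i1 i2, integral_add i3 i4, h.isWeakGradient.2 φ hφ hc hφU w,
    h'.isWeakGradient.2 φ hφ hc hφU w, neg_add]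

theorem memLp_restrict_of_continuousOn {F : Type*} [NormedAddCommGroup F] {C : Set E3}
    (hC : IsCompact C) {f : E3 → F} [SecondCountableTopologyEither E3 F]
    (hf : ContinuousOn f C) : MemLp f 2 (volume.restrict C) := by
  obtain ⟨K, hK⟩ := hC.exists_bound_of_continuousOn hf
  have : IsFiniteMeasure (volume.restrict C) := ⟨by
    rw [Measure.restrict_apply_univ]; exact hC.measure_lt_top⟩
  have hm := hC.isClosed.measurableSet
  exact MemLp.of_bound (hf.aestronglyMeasurable hm) K
    ((ae_restrict_iff' hm).2 (Filter.Eventually.of_forall hK))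

theorem memLp_smul_restrict {F : Type*} [NormedAddCommGroup F] [NormedSpace ℝ F] {C : Set E3}
    (hC : IsCompact C) {f : E3 → F} {χ : E3 → ℝ} (hχ : Continuous χ)
    (hf : MemLp f 2 (volume.restrict C)) : MemLp (fun x => χ x • f x) 2 (volume.restrict C) := by
  obtain ⟨K, hK⟩ := hC.exists_bound_of_continuousOn hχ.continuousOn
  refine hf.of_le_mul (c := K) (hχ.aestronglyMeasurable.smul hf.1) ?_
  refine (ae_restrict_iff' hC.isClosed.measurableSet).2 (Filter.Eventually.of_forall fun x hx => ?_)
  rw [norm_smul]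
  exact mul_le_mul_of_nonneg_right (hK x hx) (norm_nonneg _)

/-- The weak gradient of `u` is tested with `φ * χ`, whose differential obeys the Leibniz rule.
Together with `HasW12Loc.add` this allows fields to be glued by cut-off functions. -/
theorem HasW12Loc.smul (hU : IsOpen U) (h : HasW12Loc U u G) {χ : E3 → ℝ}
    (hχ : ContDiff ℝ ((⊤ : ℕ∞) : WithTop ℕ∞) χ) :
    HasW12Loc U (fun x => χ x • u x) (fun x => χ x • G x + (fderiv ℝ χ x).smulRight (u x)) := by
  have hum := hU.measurableSet
  have hχ' : Continuous (fderiv ℝ χ) := hχ.continuous_fderiv (by simp)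
  have hc2 : ContinuousOn (fun x => (fderiv ℝ χ x).smulRight (u x)) U := by
    have h1 : Continuous fun p : (E3 →L[ℝ] ℝ) × E3 => p.1.smulRight p.2 :=
      (ContinuousLinearMap.smulRightL ℝ E3 E3).continuous₂
    have := Continuous.comp_continuousOn (g := fun p : (E3 →L[ℝ] ℝ) × E3 => p.1.smulRight p.2)
      h1 (hχ'.continuousOn.prodMk h.continuousOn)
    exact this
  have hli1 : LocallyIntegrableOn (fun x => χ x • G x) U volume :=
    h.isWeakGradient.1.continuousOn_smul hU.isLocallyClosed hχ.continuous.continuousOn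
  have hli2 : LocallyIntegrableOn (fun x => (fderiv ℝ χ x).smulRight (u x)) U volume :=
    hc2.locallyIntegrableOn hum
  have hli : LocallyIntegrableOn (fun x => χ x • G x + (fderiv ℝ χ x).smulRight (u x)) U volume :=
    locallyIntegrableOn_fun_add hli1 hli2
  refine ⟨hχ.continuous.continuousOn.smul h.continuousOn, ⟨hli, ?_⟩, fun C hC hCc => ?_⟩
  · intro φ hφ hc hφU w
    have hφd : ∀ x, HasFDerivAt φ (fderiv ℝ φ x) x := fun x =>
      (hφ.differentiable (by simp) x).hasFDerivAt
    have hχd : ∀ x, HasFDerivAt χ (fderiv ℝ χ x) x := fun x =>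
      (hχ.differentiable (by simp) x).hasFDerivAt
    have hd : ∀ x, fderiv ℝ (fun y => φ y * χ y) x w
        = fderiv ℝ φ x w * χ x + φ x * fderiv ℝ χ x w := by
      intro x
      have := ((hφd x).mul (hχd x)).fderiv
      rw [show fderiv ℝ (fun y => φ y * χ y) x = _ from this]
      simp
      ring
    have hcm : HasCompactSupport (fun y => φ y * χ y) := hc.mul_right
    have hsm : tsupport (fun y => φ y * χ y) ⊆ U := (tsupport_mul_subset_left).trans hφU
    have key := h.isWeakGradient.2 (fun y => φ y * χ y) (hφ.mul hχ) hcm hsm w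
    have huli : LocallyIntegrableOn u U volume := h.continuousOn.locallyIntegrableOn hum
    have hd' : Continuous fun x => fderiv ℝ (fun y => φ y * χ y) x w :=
      ((hφ.mul hχ).continuous_fderiv (by simp)).clm_apply continuous_const
    have i1 := (integrable_smul_of_locallyIntegrableOn hd' (hcm.fderiv_apply ℝ _)
      ((tsupport_fderiv_apply_subset _ w).trans hsm) huli).restrict (s := U)
    have i2 : Integrable (fun x => (φ x * fderiv ℝ χ x w) • u x) (volume.restrict U) :=
      (integrable_smul_of_locallyIntegrableOn
        (hφ.continuous.mul (hχ'.clm_apply continuous_const)) hc.mul_right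
        ((tsupport_mul_subset_left).trans hφU) huli).restrict
    have i3 : Integrable (fun x => (φ x * χ x) • G x w) (volume.restrict U) :=
      (integrable_smul_apply (hφ.mul hχ).continuous hcm hsm h.isWeakGradient.1 w).restrict
    have e1 : ∀ x, fderiv ℝ φ x w • χ x • u x = fderiv ℝ (fun y => φ y * χ y) x w • u x
        - (φ x * fderiv ℝ χ x w) • u x := by
      intro x
      rw [hd, smul_smul, ← sub_smul]
      congr 1
      ring
    have e2 : ∀ x, φ x • (χ x • G x + (fderiv ℝ χ x).smulRight (u x)) w
        = (φ x * χ x) • G x w + (φ x * fderiv ℝ χ x w) • u x := by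
      intro x
      simp [smul_add, smul_smul]
    simp only [e1, e2]
    rw [integral_sub i1 i2, integral_add i3 i2, key]
    abel
  · exact memLp_fun_add (memLp_smul_restrict hCc hχ.continuous (h.memLp C hC hCc))
      (memLp_restrict_of_continuousOn hCc (hc2.mono hC))

theorem HasW12Loc.of_contDiffOn (hU : IsOpen U) (hu : ContDiffOn ℝ 1 u U) :
    HasW12Loc U u (fderiv ℝ u) := by
  have hum := hU.measurableSet
  have hc : ContinuousOn (fderiv ℝ u) U := hu.continuousOn_fderiv_of_isOpen hU le_rfl
  refine ⟨hu.continuousOn, ⟨hc.locallyIntegrableOn hum, ?_⟩,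
    fun C hC hCc => memLp_restrict_of_continuousOn hCc (hc.mono hC)⟩
  intro φ hφ hφc hφU w
  have hd : Continuous fun x => fderiv ℝ φ x w :=
    (hφ.continuous_fderiv (by simp)).clm_apply continuous_const
  have hds := (tsupport_fderiv_apply_subset φ w).trans hφU
  have huli : LocallyIntegrableOn u U volume := hu.continuousOn.locallyIntegrableOn hum
  have i1 := integrable_smul_of_locallyIntegrableOn hd (hφc.fderiv_apply ℝ _) hds huli
  have i2 := integrable_smul_apply hφ.continuous hφc hφU (hc.locallyIntegrableOn hum) w
  have i3 := integrable_smul_of_locallyIntegrableOn hφ.continuous hφc hφU huli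
  rw [setIntegral_smul_of_tsupport_subset hds, setIntegral_smul_of_tsupport_subset hφU]
  have := integral_bilinear_hasLineDerivAt_right_eq_neg_left_of_integrable (μ := volume)
    (f := φ) (f' := fun x => fderiv ℝ φ x w) (g := u) (g' := fun x => fderiv ℝ u x w) (v := w)
    (B := ContinuousLinearMap.lsmul ℝ ℝ) i1 i2 i3
    (fun x _ => (hφ.differentiable (by simp) x).hasFDerivAt.hasLineDerivAt w)
    (fun x hx => ((hu.contDiffAt (hU.mem_nhds (hφU hx))).differentiableAt
      one_ne_zero).hasFDerivAt.hasLineDerivAt w)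
  simp only [ContinuousLinearMap.lsmul_apply] at this
  rw [this, neg_neg]

end WeakGradient

/-! ### Tangent fields and their smooth approximation -/

variable {P : ConvexPolyhedron}

theorem TangentField.toFun_of_mem (n : P.TangentField) {x : E3} (hx : x ∈ P.domain) :
    n.toFun x = n.1 ⟨x, hx⟩ := dif_pos hx

theorem TangentField.continuousOn_toFun (n : P.TangentField) : ContinuousOn n.toFun P.domain := by
  rw [continuousOn_iff_continuous_domRestrict]
  have : P.domain.domRestrict n.toFun = fun x => (n.1 x : E3) := by
    ext1 x
    exact n.toFun_of_mem x.2
  rw [this]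
  exact continuous_subtype_val.comp n.1.continuous

theorem TangentField.norm_toFun (n : P.TangentField) {x : E3} (hx : x ∈ P.domain) :
    ‖n.toFun x‖ = 1 := by
  rw [n.toFun_of_mem hx]
  exact mem_sphere_zero_iff_norm.1 (n.1 ⟨x, hx⟩).2

theorem TangentField.tangent (n : P.TangentField) {ν : E3} (hν : P.IsFaceNormal ν) {x : E3}
    (hx : x ∈ P.domain) (hxν : x ∈ P.face ν) : inner ℝ ν (n.toFun x) = 0 := by
  rw [n.toFun_of_mem hx]
  exact n.2 ν hν ⟨x, hx⟩ hxν

theorem TangentField.isAdmissible (n : P.TangentField) {G : E3 → E3 →L[ℝ] E3}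
    (hG : IsWeakGradient (interior P.body) n.toFun G)
    (hL : ∀ C ⊆ interior P.body, IsCompact C →
      MeasureTheory.MemLp G 2 (MeasureTheory.volume.restrict C)) :
    P.IsAdmissible n.toFun G where
  continuousOn := n.continuousOn_toFun
  ne_zero x hx h := by simpa [h] using n.norm_toFun hx
  tangent _ hν _ hx hxν := n.tangent hν hx hxν
  isWeakGradient := hG
  memLp := hL

theorem TangentField.IsSmooth.contDiffOn_interior {n : P.TangentField} (hn : n.IsSmooth) :
    ContDiffOn ℝ 1 n.toFun (interior P.body) :=
  (hn.mono P.interior_subset_domain).of_le (by exact_mod_cast le_top)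

theorem TangentField.IsSmooth.isAdmissible {n : P.TangentField} (hn : n.IsSmooth) :
    P.IsAdmissible n.toFun (fderiv ℝ n.toFun) :=
  have h := HasW12Loc.of_contDiffOn isOpen_interior hn.contDiffOn_interior
  n.isAdmissible h.isWeakGradient h.memLp

/-- At each point, closeness to `m` and tangency are convex conditions on the value, once unit
length is dropped. A partition of unity therefore reduces the claim to finding locally a constant
vector which satisfies them. -/
theorem exists_smooth_tangent_approx (m : P.TangentField) :
    ∃ g : E3 → E3, ContDiffOn ℝ ((⊤ : ℕ∞) : WithTop ℕ∞) g (P.vertices : Set E3)ᶜ ∧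
      (∀ x ∈ P.domain, ‖g x - m.toFun x‖ < 1 / 2) ∧
      ∀ ν, P.IsFaceNormal ν → ∀ x ∈ P.domain, x ∈ P.face ν → inner ℝ ν (g x) = 0 := by
  let V : TopologicalSpace.Opens E3 :=
    ⟨(P.vertices : Set E3)ᶜ, P.vertices.finite_toSet.isClosed.isOpen_compl⟩
  have : LocallyCompactSpace V := V.isOpen.locallyCompactSpace
  let t : V → Set E3 := fun x => {c | (x : E3) ∈ P.body → ‖c - m.toFun x‖ < 1 / 2 ∧
    ∀ ν, P.IsFaceNormal ν → (x : E3) ∈ P.face ν → inner ℝ ν c = 0}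
  have htconv : ∀ x, Convex ℝ (t x) := by
    intro x c hc d hd a b ha hb hab hx
    obtain ⟨hc1, hc2⟩ := hc hx
    obtain ⟨hd1, hd2⟩ := hd hx
    refine ⟨?_, fun ν hν hxν => ?_⟩
    · have := convex_ball (m.toFun x) (1 / 2) (x := c) (by rwa [mem_ball_iff_norm]) (y := d)
        (by rwa [mem_ball_iff_norm]) ha hb hab
      rwa [mem_ball_iff_norm] at this
    · rw [inner_add_right, inner_smul_right, inner_smul_right, hc2 ν hν hxν, hd2 ν hν hxν]
      simp
  have hloc : ∀ x : V, ∃ c : E3, ∀ᶠ y in nhds x, c ∈ t y := by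
    intro x
    have hcont : Filter.Tendsto (Subtype.val : V → E3) (nhds x) (nhds (x : E3)) :=
      continuous_subtype_val.tendsto x
    by_cases hx : (x : E3) ∈ P.body
    · have hxd : (x : E3) ∈ P.domain := ⟨hx, x.2⟩
      refine ⟨m.toFun x, ?_⟩
      have h1 : ∀ᶠ y in nhds (x : E3), y ∈ P.domain → ‖m.toFun x - m.toFun y‖ < 1 / 2 := by
        have := (m.continuousOn_toFun _ hxd).eventually
          (Metric.ball_mem_nhds (m.toFun x) (by norm_num : (0 : ℝ) < 1 / 2))
        rw [eventually_nhdsWithin_iff] at this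
        filter_upwards [this] with y hy hyd
        rw [norm_sub_rev]
        exact mem_ball_iff_norm.1 (hy hyd)
      -- The faces are closed and finite in number, so near `x` there are only faces through `x`,
      -- and the constant `m.toFun x` is tangent to all of these.
      have h2 : ∀ᶠ y in nhds (x : E3), ∀ ν ∈ P.normals, y ∈ P.face ν → (x : E3) ∈ P.face ν := by
        refine (Finset.eventually_all P.normals).2 fun ν _ => ?_
        by_cases hxν : (x : E3) ∈ P.face ν
        · exact Filter.Eventually.of_forall fun _ _ => hxν
        · filter_upwards [(P.isClosed_face ν).isOpen_compl.mem_nhds hxν] with y hy hyν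
          exact absurd hyν hy
      filter_upwards [hcont.eventually (h1.and h2)] with y hy hyb
      exact ⟨hy.1 ⟨hyb, y.2⟩, fun ν hν hyν =>
        m.tangent hν hxd (hy.2 ν (P.mem_normals.2 hν) hyν)⟩
    · refine ⟨0, ?_⟩
      filter_upwards [hcont.eventually (P.isClosed_body.isOpen_compl.mem_nhds hx)] with y hy hyb
      exact absurd hyb hy
  obtain ⟨g₀, hg₀⟩ := exists_contMDiffMap_forall_mem_convex_of_local_const
    (n := (⊤ : ℕ∞)) (modelWithCornersSelf ℝ E3) htconv hloc
  classical
  let g : E3 → E3 := fun x => if hx : x ∈ V then g₀ ⟨x, hx⟩ else 0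
  have hgV : ∀ x : V, g x = g₀ x := fun x => dif_pos x.2
  have hmem : ∀ x ∈ P.domain, x ∈ V := fun x hx => hx.2
  refine ⟨g, fun x hx => ?_, fun x hx => ?_, fun ν hν x hx hxν => ?_⟩
  · have h1 : ContMDiffAt (modelWithCornersSelf ℝ E3) (modelWithCornersSelf ℝ E3) (⊤ : ℕ∞)
        (fun y : V => g y) (⟨x, hx⟩ : V) := by
      have : (fun y : V => g y) = g₀ := funext hgV
      rw [this]
      exact g₀.contMDiff _
    exact (contMDiffAt_subtype_iff.1 h1).contDiffAt.contDiffWithinAt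
  · rw [hgV ⟨x, hmem x hx⟩]
    exact (hg₀ ⟨x, hmem x hx⟩ hx.1).1
  · rw [hgV ⟨x, hmem x hx⟩]
    exact (hg₀ ⟨x, hmem x hx⟩ hx.1).2 ν hν hxν

end ConvexPolyhedron
end

/-! ### Fluxes at the vertices and their homotopy invariance -/

noncomputable section

namespace ConvexPolyhedron

variable {P : ConvexPolyhedron}

open MeasureTheory

variable (P) in
/-- Smooth functions which are constant near each vertex. -/
structure IsVertexConst (φ : E3 → ℝ) : Prop where
  contDiff : ContDiff ℝ ((⊤ : ℕ∞) : WithTop ℕ∞) φ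
  eventually_eq : ∀ v ∈ P.vertices, ∀ᶠ x in nhds v, φ x = φ v

theorem notMem_tsupport_of_eventually {F : Type*} [Zero F] {f : E3 → F} {v : E3}
    (h : ∀ᶠ x in nhds v, f x = 0) : v ∉ tsupport f :=
  notMem_tsupport_iff_eventuallyEq.2 h

theorem IsVertexConst.notMem_tsupport_fderiv {φ : E3 → ℝ} (h : P.IsVertexConst φ) {v : E3}
    (hv : v ∈ P.vertices) : v ∉ tsupport (fderiv ℝ φ) := by
  refine notMem_tsupport_of_eventually ?_
  filter_upwards [(h.eventually_eq v hv).eventually_nhds] with x hx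
  have : φ =ᶠ[nhds x] fun _ => φ v := hx
  rw [this.fderiv_eq]
  simp

/-- `G` is only locally square integrable, but `fderiv ℝ φ` is zero near the vertices, so the
integrand vanishes off a compact subset of the interior. -/
theorem IsAdmissible.integrableOn {u : E3 → E3} {G : E3 → E3 →L[ℝ] E3}
    (h : P.IsAdmissible u G) (k : ℕ) {φ : E3 → ℝ} (hφ : P.IsVertexConst φ) :
    IntegrableOn (fun x => fluxDensity (P.cutoffField k (u x)) (G x) (fderiv ℝ φ x))
      (interior P.body) volume := by
  obtain ⟨K, hKU, hK, hKz⟩ := h.exists_compact k (isClosed_tsupport (fderiv ℝ φ))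
    fun v hv => hφ.notMem_tsupport_fderiv hv
  have hKm := hK.isClosed.measurableSet
  have huK : ContinuousOn u K := h.continuousOn.mono (hKU.trans P.interior_subset_domain)
  have hc1 : ContinuousOn (fun x => P.cutoffField k (u x)) K :=
    (P.contDiffOn_cutoffField k).continuousOn.comp huK fun x hx =>
      h.ne_zero x (P.interior_subset_domain (hKU hx))
  have hc2 : Continuous (fderiv ℝ φ) := hφ.contDiff.continuous_fderiv (by simp)
  obtain ⟨C₁, hC₁⟩ := hK.exists_bound_of_continuousOn hc1
  obtain ⟨C₂, hC₂⟩ := hK.exists_bound_of_continuousOn hc2.continuousOn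
  have hi : IntegrableOn (fun x => fluxDensity (P.cutoffField k (u x)) (G x) (fderiv ℝ φ x))
      K volume :=
    integrable_fluxDensity (hc1.aestronglyMeasurable hKm) (h.memLp K hKU hK)
      hc2.aestronglyMeasurable ((ae_restrict_iff' hKm).2 (Filter.Eventually.of_forall hC₁))
      ((ae_restrict_iff' hKm).2 (Filter.Eventually.of_forall hC₂))
  refine hi.of_forall_sdiff_eq_zero isOpen_interior.measurableSet fun x hx => ?_
  by_cases hxT : x ∈ tsupport (fderiv ℝ φ)
  · rw [hKz x hx.1 hxT hx.2, fluxDensity_zero_left]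
  · rw [image_eq_zero_of_notMem_tsupport hxT, fluxDensity_zero_right]

theorem IsVertexConst.differentiableAt {φ : E3 → ℝ} (h : P.IsVertexConst φ) (x : E3) :
    DifferentiableAt ℝ φ x := h.contDiff.differentiable (by simp) x

/-- The flux depends on `φ` only through its values at the vertices. -/
theorem IsAdmissible.flux_congr {u : E3 → E3} {G : E3 → E3 →L[ℝ] E3} (h : P.IsAdmissible u G)
    (k : ℕ) {φ φ' : E3 → ℝ} (hφ : P.IsVertexConst φ) (hφ' : P.IsVertexConst φ')
    (he : ∀ v ∈ P.vertices, φ v = φ' v) : P.flux k u G φ = P.flux k u G φ' := by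
  have hz : P.flux k u G (fun x => φ x - φ' x) = 0 := by
    refine h.flux_eq_zero k (hφ.contDiff.sub hφ'.contDiff) fun v hv => ?_
    refine notMem_tsupport_of_eventually ?_
    filter_upwards [hφ.eventually_eq v hv, hφ'.eventually_eq v hv] with x h1 h2
    rw [h1, h2, he v hv, sub_self]
  have e : ∀ x, fluxDensity (P.cutoffField k (u x)) (G x) (fderiv ℝ (fun x => φ x - φ' x) x)
      = fluxDensity (P.cutoffField k (u x)) (G x) (fderiv ℝ φ x)
        - fluxDensity (P.cutoffField k (u x)) (G x) (fderiv ℝ φ' x) := by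
    intro x
    rw [fderiv_fun_sub (hφ.differentiableAt x) (hφ'.differentiableAt x)]
    simp only [fluxDensity, sub_apply]
    ring
  simp only [flux, e] at hz
  rw [integral_sub (h.integrableOn k hφ) (h.integrableOn k hφ')] at hz
  exact sub_eq_zero.1 hz

theorem IsAdmissible.flux_sum {u : E3 → E3} {G : E3 → E3 →L[ℝ] E3} (h : P.IsAdmissible u G)
    (k : ℕ) {ι : Type*} (s : Finset ι) (c : ι → ℝ) {φ : ι → E3 → ℝ}
    (hφ : ∀ i, P.IsVertexConst (φ i)) :
    P.flux k u G (fun x => ∑ i ∈ s, c i * φ i x) = ∑ i ∈ s, c i * P.flux k u G (φ i) := by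
  have e : ∀ x, fluxDensity (P.cutoffField k (u x)) (G x)
      (fderiv ℝ (fun x => ∑ i ∈ s, c i * φ i x) x)
      = ∑ i ∈ s, c i * fluxDensity (P.cutoffField k (u x)) (G x) (fderiv ℝ (φ i) x) := by
    intro x
    rw [fderiv_fun_sum fun i _ => ((hφ i).differentiableAt x).const_mul (c i)]
    have e2 : ∀ i, fderiv ℝ (fun x => c i * φ i x) x = c i • fderiv ℝ (φ i) x := fun i =>
      fderiv_const_mul ((hφ i).differentiableAt x) (c i)
    simp only [e2]
    simp only [fluxDensity, sum_apply, smul_apply, smul_eq_mul, Finset.mul_sum,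
      ← Finset.sum_add_distrib]
    refine Finset.sum_congr rfl fun i _ => ?_
    ring
  simp only [flux, e]
  rw [integral_finsetSum _ fun i _ => (h.integrableOn k (hφ i)).const_mul (c i)]
  simp only [integral_const_mul]

-- The factor `10` leaves room for several nested bumps, of radius up to `8 * r`, around one vertex
-- and away from the others.
variable (P) in
theorem exists_vertexRadius : ∃ r : ℝ, 0 < r ∧ ∀ v ∈ P.vertices, ∀ w ∈ P.vertices, w ≠ v →
    10 * r < dist w v := by
  have h : ∀ᶠ r : ℝ in nhdsWithin 0 (Set.Ioi 0), ∀ v ∈ P.vertices, ∀ w ∈ P.vertices, w ≠ v →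
      10 * r < dist w v := by
    refine (Finset.eventually_all _).2 fun v _ => (Finset.eventually_all _).2 fun w _ => ?_
    by_cases hwv : w = v
    · exact Filter.Eventually.of_forall fun _ h => absurd hwv h
    · have hc : Filter.Tendsto (fun r : ℝ => 10 * r) (nhdsWithin 0 (Set.Ioi 0)) (nhds (10 * 0)) :=
        ((continuous_const.mul continuous_id).tendsto 0).mono_left inf_le_left
      rw [mul_zero] at hc
      filter_upwards [hc.eventually_lt_const (dist_pos.2 hwv)] with r hr _
      exact hr
  obtain ⟨r, hr, hr0⟩ := (h.and self_mem_nhdsWithin).exists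
  exact ⟨r, hr0, hr⟩

variable (P) in
/-- A radius such that the balls of ten times this radius around the vertices contain no other
vertices. -/
def vertexRadius : ℝ := P.exists_vertexRadius.choose

theorem vertexRadius_pos : 0 < P.vertexRadius := P.exists_vertexRadius.choose_spec.1

theorem lt_dist_vertices {v w : E3} (hv : v ∈ P.vertices) (hw : w ∈ P.vertices) (h : w ≠ v) :
    10 * P.vertexRadius < dist w v := P.exists_vertexRadius.choose_spec.2 v hv w hw h

variable (P) in
/-- A radial bump function around `v`, equal to `1` on the ball of radius `a r` and vanishing off
the ball of radius `b r`, where `r` is the vertex radius of `P`. -/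
def radialBump (v : E3) (a b : ℝ) (h : 0 < a ∧ a < b) : ContDiffBump v :=
  ⟨a * P.vertexRadius, b * P.vertexRadius, mul_pos h.1 vertexRadius_pos,
    mul_lt_mul_of_pos_right h.2 vertexRadius_pos⟩

theorem radialBump_contDiff (v : E3) (a b : ℝ) (h : 0 < a ∧ a < b) :
    ContDiff ℝ ((⊤ : ℕ∞) : WithTop ℕ∞) (P.radialBump v a b h) :=
  ContDiffBump.contDiff _

theorem radialBump_eq_one {v : E3} {a b : ℝ} {h : 0 < a ∧ a < b} {x : E3}
    (hx : dist x v ≤ a * P.vertexRadius) : P.radialBump v a b h x = 1 :=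
  (P.radialBump v a b h).one_of_mem_closedBall hx

theorem radialBump_eq_zero {v : E3} {a b : ℝ} {h : 0 < a ∧ a < b} {x : E3}
    (hx : b * P.vertexRadius ≤ dist x v) : P.radialBump v a b h x = 0 :=
  (P.radialBump v a b h).zero_of_le_dist hx

theorem eventually_radialBump_eq_one {v : E3} {a b : ℝ} {h : 0 < a ∧ a < b} {x : E3}
    (hx : dist x v < a * P.vertexRadius) : ∀ᶠ y in nhds x, P.radialBump v a b h y = 1 := by
  have hc : ContinuousAt (fun y => dist y v) x := by fun_prop
  filter_upwards [hc.eventually_lt_const hx] with y hy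
  exact radialBump_eq_one hy.le

theorem eventually_radialBump_eq_zero {v : E3} {a b : ℝ} {h : 0 < a ∧ a < b} {x : E3}
    (hx : b * P.vertexRadius < dist x v) : ∀ᶠ y in nhds x, P.radialBump v a b h y = 0 := by
  have hc : ContinuousAt (fun y => dist y v) x := by fun_prop
  filter_upwards [hc.eventually_const_lt hx] with y hy
  exact radialBump_eq_zero hy.le

theorem radialBump_self {v : E3} {a b : ℝ} {h : 0 < a ∧ a < b} : P.radialBump v a b h v = 1 :=
  radialBump_eq_one (by rw [dist_self]; exact (mul_pos h.1 vertexRadius_pos).le)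

theorem radialBump_of_ne {v w : E3} {a b : ℝ} {h : 0 < a ∧ a < b} (hb : b ≤ 8)
    (hv : v ∈ P.vertices) (hw : w ∈ P.vertices) (hwv : w ≠ v) : P.radialBump v a b h w = 0 := by
  have := lt_dist_vertices hv hw hwv
  have := P.vertexRadius_pos
  exact radialBump_eq_zero (by nlinarith)

theorem isVertexConst_radialBump {v : E3} {a b : ℝ} {h : 0 < a ∧ a < b} (hb : b ≤ 8)
    (hv : v ∈ P.vertices) : P.IsVertexConst (P.radialBump v a b h) := by
  refine ⟨radialBump_contDiff _ _ _ _, fun w hw => ?_⟩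
  by_cases hwv : w = v
  · subst hwv
    rw [radialBump_self]
    exact eventually_radialBump_eq_one
      (by rw [dist_self]; exact mul_pos h.1 vertexRadius_pos)
  · rw [radialBump_of_ne hb hv hw hwv]
    have := lt_dist_vertices hv hw hwv
    have := P.vertexRadius_pos
    exact eventually_radialBump_eq_zero (by nlinarith)

variable (P) in
/-- The standard bump function at a vertex. -/
def vertexBump (v : E3) : E3 → ℝ := P.radialBump v 1 2 (by norm_num)

theorem isVertexConst_vertexBump {v : E3} (hv : v ∈ P.vertices) :
    P.IsVertexConst (P.vertexBump v) := isVertexConst_radialBump (by norm_num) hv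

/-- The flux around a single vertex. -/
def vertexFlux (P : ConvexPolyhedron) (k : ℕ) (u : E3 → E3) (G : E3 → E3 →L[ℝ] E3) (v : E3) : ℝ :=
  P.flux k u G (P.vertexBump v)

/-- `φ` has the same vertex values as the combination of the vertex bumps with coefficients `φ v`.
-/
theorem IsAdmissible.flux_eq_sum {u : E3 → E3} {G : E3 → E3 →L[ℝ] E3} (h : P.IsAdmissible u G)
    (k : ℕ) {φ : E3 → ℝ} (hφ : P.IsVertexConst φ) :
    P.flux k u G φ = ∑ v : P.vertices, φ v * P.vertexFlux k u G v := by
  have hb : ∀ v : P.vertices, P.IsVertexConst (P.vertexBump v) := fun v =>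
    isVertexConst_vertexBump v.2
  rw [show (∑ v : P.vertices, φ v * P.vertexFlux k u G v)
    = P.flux k u G (fun x => ∑ v : P.vertices, φ v * P.vertexBump v x) from
    (h.flux_sum k Finset.univ (fun v : P.vertices => φ v) hb).symm]
  have hval : ∀ w ∈ P.vertices, ∑ v : P.vertices, φ v * P.vertexBump v w = φ w := by
    intro w hw
    rw [Finset.sum_eq_single (⟨w, hw⟩ : P.vertices)]
    · simp only [vertexBump, radialBump_self, mul_one]
    · intro v _ hv
      have hne : w ≠ (v : E3) := fun h => hv (Subtype.ext h.symm)
      rw [vertexBump, radialBump_of_ne (by norm_num) v.2 hw hne, mul_zero]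
    · simp
  refine h.flux_congr k hφ ⟨?_, fun w hw => ?_⟩ fun w hw => (hval w hw).symm
  · exact ContDiff.sum fun v _ => contDiff_const.mul (hb v).contDiff
  · filter_upwards [(Filter.eventually_all).2 fun v => (hb v).eventually_eq w hw] with x hx
    exact Finset.sum_congr rfl fun v _ => by rw [hx v]

theorem IsAdmissible.flux_eq_vertexFlux {u : E3 → E3} {G : E3 → E3 →L[ℝ] E3}
    (h : P.IsAdmissible u G) (k : ℕ) {φ : E3 → ℝ} (hφ : P.IsVertexConst φ) {v : E3}
    (hv : v ∈ P.vertices) (hφv : φ v = 1) (hφw : ∀ w ∈ P.vertices, w ≠ v → φ w = 0) :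
    P.flux k u G φ = P.vertexFlux k u G v := by
  refine h.flux_congr k hφ (isVertexConst_vertexBump hv) fun w hw => ?_
  by_cases hwv : w = v
  · rw [hwv, hφv, vertexBump, radialBump_self]
  · rw [hφw w hw hwv, vertexBump, radialBump_of_ne (by norm_num) hv hw hwv]

theorem flux_congr_of_eventually {k : ℕ} {u u' : E3 → E3} {G G' : E3 → E3 →L[ℝ] E3} {φ : E3 → ℝ}
    (h : ∀ x ∈ interior P.body, fderiv ℝ φ x ≠ 0 → u x = u' x ∧ G x = G' x) :
    P.flux k u G φ = P.flux k u' G' φ := by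
  refine setIntegral_congr_fun isOpen_interior.measurableSet fun x hx => ?_
  by_cases hd : fderiv ℝ φ x = 0
  · rw [hd, fluxDensity_zero_right, fluxDensity_zero_right]
  · obtain ⟨h1, h2⟩ := h x hx hd
    rw [h1, h2]

theorem fderiv_eq_zero_of_eventually_const {χ : E3 → ℝ} {c : ℝ} {x : E3}
    (h : ∀ᶠ y in nhds x, χ y = c) : fderiv ℝ χ x = 0 := by
  have : χ =ᶠ[nhds x] fun _ => c := h
  rw [this.fderiv_eq]
  simp

/-- The flux around a vertex is an invariant of homotopy through tangent fields. -/
theorem vertexFlux_eq_of_homotopic {n n' : P.TangentField}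
    (hnn' : ContinuousMap.HomotopicWith n.1 n'.1 P.IsTangent) {G G' : E3 → E3 →L[ℝ] E3}
    (h : P.IsAdmissible n.toFun G) (h' : P.IsAdmissible n'.toFun G') (k : ℕ) {v : E3}
    (hv : v ∈ P.vertices) :
    P.vertexFlux k n.toFun G v = P.vertexFlux k n'.toFun G' v := by
  obtain ⟨H⟩ := hnn'
  set r := P.vertexRadius with hr
  have hr0 : 0 < r := P.vertexRadius_pos
  -- The distance to `v` serves as the homotopy parameter: `m` below runs through the homotopy
  -- between the radii `4 * r` and `5 * r`, and is `n` inside and `n'` outside.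
  let τ : E3 → unitInterval := fun x =>
    Set.projIcc 0 1 zero_le_one ((dist x v - 4 * r) / r)
  have hτ : Continuous τ := continuous_projIcc.comp (by fun_prop)
  have hτ0 : ∀ x, dist x v ≤ 4 * r → τ x = 0 := fun x hx =>
    Set.projIcc_of_le_left _ (div_nonpos_of_nonpos_of_nonneg (by linarith) hr0.le)
  have hτ1 : ∀ x, 5 * r ≤ dist x v → τ x = 1 := fun x hx =>
    Set.projIcc_of_right_le _ (by rw [le_div_iff₀ hr0]; linarith)
  let m : P.TangentField := ⟨⟨fun x => H (τ x, x),
    H.continuous.comp ((hτ.comp continuous_subtype_val).prodMk continuous_id)⟩,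
    fun ν hν x hx => (H.prop' (τ x)) ν hν x hx⟩
  have hm0 : ∀ x ∈ P.domain, dist x v ≤ 4 * r → m.toFun x = n.toFun x := by
    intro x hx hd
    rw [m.toFun_of_mem hx, n.toFun_of_mem hx]
    change ((H (τ x, ⟨x, hx⟩) : Metric.sphere (0 : E3) 1) : E3) = _
    rw [hτ0 x hd]
    exact congrArg Subtype.val (H.apply_zero ⟨x, hx⟩)
  have hm1 : ∀ x ∈ P.domain, 5 * r ≤ dist x v → m.toFun x = n'.toFun x := by
    intro x hx hd
    rw [m.toFun_of_mem hx, n'.toFun_of_mem hx]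
    change ((H (τ x, ⟨x, hx⟩) : Metric.sphere (0 : E3) 1) : E3) = _
    rw [hτ1 x hd]
    exact congrArg Subtype.val (H.apply_one ⟨x, hx⟩)
  obtain ⟨g, hg, hgm, hgt⟩ := exists_smooth_tangent_approx m
  have hUv : interior P.body ⊆ (P.vertices : Set E3)ᶜ := fun x hx =>
    (P.interior_subset_domain hx).2
  have hgW := HasW12Loc.of_contDiffOn isOpen_interior
    ((hg.mono hUv).of_le (by exact_mod_cast le_top))
  -- Since `m` need not have a weak gradient, it is replaced by its smooth approximation `g` in the
  -- shell between `3 * r` and `6 * r`. The transitions of `χ₁` and `χ₂` take place where `m` is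
  -- still `n`, or already `n'`.
  set χ₁ : E3 → ℝ := fun x => P.radialBump v 3 4 (by norm_num) x with hχ₁
  set χ₂ : E3 → ℝ := fun x => 1 - P.radialBump v 5 6 (by norm_num) x with hχ₂
  set χ₃ : E3 → ℝ := fun x => 1 - χ₁ x - χ₂ x with hχ₃
  have hs₁ : ContDiff ℝ ((⊤ : ℕ∞) : WithTop ℕ∞) χ₁ := radialBump_contDiff _ _ _ _
  have hs₂ : ContDiff ℝ ((⊤ : ℕ∞) : WithTop ℕ∞) χ₂ :=
    contDiff_const.sub (radialBump_contDiff _ _ _ _)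
  have hs₃ : ContDiff ℝ ((⊤ : ℕ∞) : WithTop ℕ∞) χ₃ := (contDiff_const.sub hs₁).sub hs₂
  have hχ₁z : ∀ x, 4 * r ≤ dist x v → χ₁ x = 0 := fun x hx => radialBump_eq_zero hx
  have hχ₂z : ∀ x, dist x v ≤ 5 * r → χ₂ x = 0 := fun x hx => by
    simp only [hχ₂, radialBump_eq_one hx, sub_self]
  have hχ₃b : ∀ x, |χ₃ x| ≤ 1 := by
    intro x
    have h1 := (P.radialBump v 3 4 (by norm_num)).nonneg (x := x)
    have h2 := (P.radialBump v 3 4 (by norm_num)).le_one (x := x)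
    have h3 := (P.radialBump v 5 6 (by norm_num)).nonneg (x := x)
    have h4 := (P.radialBump v 5 6 (by norm_num)).le_one (x := x)
    rw [abs_le]
    constructor <;> simp only [hχ₃, hχ₂, hχ₁] <;> linarith
  let w : E3 → E3 := fun x => χ₁ x • n.toFun x + (χ₂ x • n'.toFun x + χ₃ x • g x)
  obtain ⟨Gw, hGw⟩ : ∃ Gw : E3 → E3 →L[ℝ] E3, Gw = fun x =>
      (χ₁ x • G x + (fderiv ℝ χ₁ x).smulRight (n.toFun x))
      + ((χ₂ x • G' x + (fderiv ℝ χ₂ x).smulRight (n'.toFun x))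
        + (χ₃ x • fderiv ℝ g x + (fderiv ℝ χ₃ x).smulRight (g x))) := ⟨_, rfl⟩
  have hsub := P.interior_subset_domain
  have hW : HasW12Loc (interior P.body) w Gw := by
    rw [hGw]
    have hn : HasW12Loc (interior P.body) n.toFun G :=
      ⟨h.continuousOn.mono hsub, h.isWeakGradient, h.memLp⟩
    have hn' : HasW12Loc (interior P.body) n'.toFun G' :=
      ⟨h'.continuousOn.mono hsub, h'.isWeakGradient, h'.memLp⟩
    exact (hn.smul isOpen_interior hs₁).add isOpen_interior
      ((hn'.smul isOpen_interior hs₂).add isOpen_interior (hgW.smul isOpen_interior hs₃))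
  have hgc : ContinuousOn g P.domain := hg.continuousOn.mono fun x hx => hx.2
  -- This keeps `w` from vanishing. It is not of unit length, but admissibility does not ask for
  -- that.
  have hwm : ∀ x ∈ P.domain, ‖w x - m.toFun x‖ < 1 := by
    intro x hx
    have e1 : χ₁ x • n.toFun x = χ₁ x • m.toFun x := by
      by_cases hd : dist x v ≤ 4 * r
      · rw [hm0 x hx hd]
      · rw [hχ₁z x (not_le.1 hd).le, zero_smul, zero_smul]
    have e2 : χ₂ x • n'.toFun x = χ₂ x • m.toFun x := by
      by_cases hd : 5 * r ≤ dist x v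
      · rw [hm1 x hx hd]
      · rw [hχ₂z x (not_le.1 hd).le, zero_smul, zero_smul]
    have e3 : w x - m.toFun x = χ₃ x • (g x - m.toFun x) := by
      have : χ₁ x + χ₂ x + χ₃ x = 1 := by simp only [hχ₃]; ring
      simp only [w]
      rw [e1, e2]
      conv_lhs => rw [← one_smul ℝ (m.toFun x), ← this]
      module
    rw [e3, norm_smul, Real.norm_eq_abs]
    have := hgm x hx
    nlinarith [hχ₃b x, norm_nonneg (g x - m.toFun x), abs_nonneg (χ₃ x)]
  have hwA : P.IsAdmissible w Gw := by
    refine ⟨?_, fun x hx h0 => ?_, fun ν hν x hx hxν => ?_, hW.isWeakGradient, hW.memLp⟩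
    · exact (hs₁.continuous.continuousOn.smul h.continuousOn).add
        ((hs₂.continuous.continuousOn.smul h'.continuousOn).add
          (hs₃.continuous.continuousOn.smul hgc))
    · have := hwm x hx
      rw [h0, zero_sub, norm_neg, m.norm_toFun hx] at this
      exact lt_irrefl _ this
    · simp only [w, inner_add_right, inner_smul_right, n.tangent hν hx hxν,
        n'.tangent hν hx hxν, hgt ν hν x hx hxν, mul_zero, add_zero]
  -- The differential of the standard bump lives where `w` is `n`, that of `φ` where `w` is `n'`.
  -- Both functions are `1` at `v` and `0` at the other vertices, so they give the same flux of `w`.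
  set φ : E3 → ℝ := fun x => P.radialBump v 7 8 (by norm_num) x with hφ
  have hφc : P.IsVertexConst φ := isVertexConst_radialBump (by norm_num) hv
  have hφv : φ v = 1 := radialBump_self
  have hφw : ∀ w ∈ P.vertices, w ≠ v → φ w = 0 := fun w hw hwv =>
    radialBump_of_ne (by norm_num) hv hw hwv
  have hin : P.vertexFlux k n.toFun G v = P.vertexFlux k w Gw v := by
    refine flux_congr_of_eventually fun x _ hd => ?_
    have hxd : dist x v ≤ 2 * r := by
      by_contra hlt
      exact hd (fderiv_eq_zero_of_eventually_const
        (eventually_radialBump_eq_zero (not_le.1 hlt)))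
    have a1 : ∀ᶠ y in nhds x, χ₁ y = 1 := eventually_radialBump_eq_one (by linarith)
    have a2 : ∀ᶠ y in nhds x, χ₂ y = 0 := by
      filter_upwards [eventually_radialBump_eq_one (P := P) (v := v) (a := 5) (b := 6)
        (h := by norm_num) (x := x) (by linarith)] with y hy
      simp only [hχ₂, hy, sub_self]
    have a3 : ∀ᶠ y in nhds x, χ₃ y = 0 := by
      filter_upwards [a1, a2] with y h1 h2
      simp only [hχ₃, h1, h2]; norm_num
    constructor
    · simp only [w, a1.self_of_nhds, a2.self_of_nhds, a3.self_of_nhds]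
      simp
    · simp only [hGw, a1.self_of_nhds, a2.self_of_nhds, a3.self_of_nhds,
        fderiv_eq_zero_of_eventually_const a1, fderiv_eq_zero_of_eventually_const a2,
        fderiv_eq_zero_of_eventually_const a3]
      ext1 y
      simp
  have hout : P.flux k n'.toFun G' φ = P.flux k w Gw φ := by
    refine flux_congr_of_eventually fun x _ hd => ?_
    have hxd : 7 * r ≤ dist x v := by
      by_contra hlt
      exact hd (fderiv_eq_zero_of_eventually_const
        (eventually_radialBump_eq_one (not_le.1 hlt)))
    have a1 : ∀ᶠ y in nhds x, χ₁ y = 0 := eventually_radialBump_eq_zero (by linarith)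
    have a2 : ∀ᶠ y in nhds x, χ₂ y = 1 := by
      filter_upwards [eventually_radialBump_eq_zero (P := P) (v := v) (a := 5) (b := 6)
        (h := by norm_num) (x := x) (by linarith)] with y hy
      simp only [hχ₂, hy, sub_zero]
    have a3 : ∀ᶠ y in nhds x, χ₃ y = 0 := by
      filter_upwards [a1, a2] with y h1 h2
      simp only [hχ₃, h1, h2]; norm_num
    constructor
    · simp only [w, a1.self_of_nhds, a2.self_of_nhds, a3.self_of_nhds]
      simp
    · simp only [hGw, a1.self_of_nhds, a2.self_of_nhds, a3.self_of_nhds,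
        fderiv_eq_zero_of_eventually_const a1, fderiv_eq_zero_of_eventually_const a2,
        fderiv_eq_zero_of_eventually_const a3]
      ext1 y
      simp
  rw [hin, ← hwA.flux_eq_vertexFlux k hφc hv hφv hφw, ← hout,
    h'.flux_eq_vertexFlux k hφc hv hφv hφw]

end ConvexPolyhedron
end

/-! ### Cross products and adapted coordinates -/

noncomputable section

section Frame

/-- The cross product in `ℝ³`. -/
def crossVec (a b : E3) : E3 :=
  !₂[a 1 * b 2 - a 2 * b 1, a 2 * b 0 - a 0 * b 2, a 0 * b 1 - a 1 * b 0]

theorem inner_eq_sum (a b : E3) : inner ℝ a b = a 0 * b 0 + a 1 * b 1 + a 2 * b 2 := by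
  rw [PiLp.inner_apply, Fin.sum_univ_three]
  simp only [RCLike.inner_apply, conj_trivial]
  ring

theorem inner_crossVec (a b c : E3) : inner ℝ (crossVec a b) c = tripleProduct a b c := by
  rw [inner_eq_sum, tripleProduct_eq]
  simp [crossVec]
  ring

theorem inner_crossVec_left (a b : E3) : inner ℝ (crossVec a b) a = 0 := by
  rw [inner_crossVec, tripleProduct_eq]; ring

theorem inner_crossVec_right (a b : E3) : inner ℝ (crossVec a b) b = 0 := by
  rw [inner_crossVec, tripleProduct_eq]; ring

theorem inner_crossVec_self (a b : E3) : inner ℝ (crossVec a b) (crossVec a b) =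
    inner ℝ a a * inner ℝ b b - inner ℝ a b ^ 2 := by
  simp only [inner_eq_sum]
  simp [crossVec]
  ring

theorem tripleProduct_crossVec (a b c : E3) : tripleProduct a (crossVec b a) c =
    inner ℝ a a * inner ℝ b c - inner ℝ a b * inner ℝ a c := by
  simp only [inner_eq_sum, tripleProduct_eq]
  simp [crossVec]
  ring

theorem tripleProduct_eq_zero_of_inner_eq_zero {ν a b c : E3} (hν : ν ≠ 0) (ha : inner ℝ ν a = 0)
    (hb : inner ℝ ν b = 0) (hc : inner ℝ ν c = 0) : tripleProduct a b c = 0 := by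
  rw [inner_eq_sum] at ha hb hc
  have h : ∀ i, ν i * tripleProduct a b c = 0 := by
    intro i
    rw [tripleProduct_eq]
    fin_cases i
    · simp only [Fin.zero_eta]
      linear_combination (b 1 * c 2 - b 2 * c 1) * ha + (c 1 * a 2 - c 2 * a 1) * hb
        + (a 1 * b 2 - a 2 * b 1) * hc
    · simp only [Fin.mk_one]
      linear_combination (b 2 * c 0 - b 0 * c 2) * ha + (c 2 * a 0 - c 0 * a 2) * hb
        + (a 2 * b 0 - a 0 * b 2) * hc
    · simp only [Fin.reduceFinMk]
      linear_combination (b 0 * c 1 - b 1 * c 0) * ha + (c 0 * a 1 - c 1 * a 0) * hb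
        + (a 0 * b 1 - a 1 * b 0) * hc
  by_contra hne
  apply hν
  ext i
  simpa [hne] using h i

/-- For a function of the height above a plane, the flux density becomes the area density on the
parallel planes. -/
theorem fluxDensity_crossVec (b : E3) (G : E3 →L[ℝ] E3) (c : ℝ) (a₁ a₂ : E3) :
    fluxDensity b G (c • innerSL ℝ (crossVec a₁ a₂)) = c * tripleProduct b (G a₁) (G a₂) := by
  rw [G.apply_eq_sum_stdVec a₁, G.apply_eq_sum_stdVec a₂]
  simp only [fluxDensity, smul_apply, innerSL_apply_apply, inner_crossVec, tripleProduct_eq,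
    PiLp.add_apply, PiLp.smul_apply, smul_eq_mul]
  simp [stdVec]
  ring

open MeasureTheory in
/-- Cartesian coordinates adapted to an oriented plane. -/
theorem exists_measurePreserving_frame {t₁ t₂ : E3} (h₁ : ‖t₁‖ = 1) (h₂ : ‖t₂‖ = 1)
    (h₁₂ : inner ℝ t₁ t₂ = 0) (base : E3) :
    ∃ e : ℝ × (ℝ × ℝ) ≃ᵐ E3, MeasurePreserving e volume volume ∧
      ∀ s p, e (s, p) = base + p.1 • t₁ + p.2 • t₂ + s • crossVec t₁ t₂ := by
  have i₁ : inner ℝ t₁ t₁ = (1 : ℝ) := by rw [real_inner_self_eq_norm_sq, h₁]; norm_num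
  have i₂ : inner ℝ t₂ t₂ = (1 : ℝ) := by rw [real_inner_self_eq_norm_sq, h₂]; norm_num
  have i₃ : inner ℝ (crossVec t₁ t₂) (crossVec t₁ t₂) = (1 : ℝ) := by
    rw [inner_crossVec_self, i₁, i₂, h₁₂]; norm_num
  have h₃ : ‖crossVec t₁ t₂‖ = 1 := by
    rw [real_inner_self_eq_norm_sq] at i₃
    exact (pow_eq_one_iff_of_nonneg (norm_nonneg _) two_ne_zero).1 i₃
  have hon : Orthonormal ℝ ![crossVec t₁ t₂, t₁, t₂] := by
    rw [orthonormal_iff_ite]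
    intro i j
    fin_cases i <;> fin_cases j <;>
      simp [h₁, h₂, h₃, h₁₂, inner_crossVec_left, inner_crossVec_right,
        real_inner_comm (crossVec t₁ t₂) t₁, real_inner_comm (crossVec t₁ t₂) t₂,
        real_inner_comm t₁ t₂]
  have hspan : ⊤ ≤ Submodule.span ℝ (Set.range ![crossVec t₁ t₂, t₁, t₂]) :=
    (hon.linearIndependent.span_eq_top_of_card_eq_finrank (by simp)).ge
  let b := OrthonormalBasis.mk hon hspan
  have hb : ∀ i, b i = ![crossVec t₁ t₂, t₁, t₂] i := fun i => by
    simp [b]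
  let e₁ : ℝ × (ℝ × ℝ) ≃ᵐ ℝ × (Fin 2 → ℝ) :=
    MeasurableEquiv.prodCongr (MeasurableEquiv.refl ℝ) MeasurableEquiv.finTwoArrow.symm
  have m₁ : MeasurePreserving e₁ volume volume :=
    (MeasurePreserving.id volume).prod (volume_preserving_finTwoArrow ℝ).symm
  let e₂ := (MeasurableEquiv.piFinSuccAbove (fun _ : Fin 3 => ℝ) 0).symm
  have m₂ : MeasurePreserving e₂ volume volume :=
    (volume_preserving_piFinSuccAbove (fun _ : Fin 3 => ℝ) 0).symm
  let e₃ := MeasurableEquiv.toLp 2 (Fin 3 → ℝ)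
  have m₃ : MeasurePreserving e₃ volume volume := PiLp.volume_preserving_toLp (Fin 3)
  let e₄ : EuclideanSpace ℝ (Fin 3) ≃ᵐ E3 := b.repr.symm.toHomeomorph.toMeasurableEquiv
  have m₄ : MeasurePreserving e₄ volume volume := b.measurePreserving_repr_symm
  let e₅ : E3 ≃ᵐ E3 := MeasurableEquiv.addLeft base
  have m₅ : MeasurePreserving e₅ volume volume := measurePreserving_add_left volume base
  refine ⟨(((e₁.trans e₂).trans e₃).trans e₄).trans e₅, ?_, fun s p => ?_⟩
  · exact m₅.comp (m₄.comp (m₃.comp (m₂.comp m₁)))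
  · have : e₄ (e₃ (e₂ (e₁ (s, p)))) = p.1 • t₁ + p.2 • t₂ + s • crossVec t₁ t₂ := by
      change b.repr.symm (e₃ (e₂ (e₁ (s, p)))) = _
      rw [← b.sum_repr_symm, Fin.sum_univ_three, hb, hb, hb]
      change s • crossVec t₁ t₂ + p.1 • t₁ + p.2 • t₂ = _
      abel
    change base + e₄ (e₃ (e₂ (e₁ (s, p)))) = _
    rw [this]
    abel

end Frame

/-! ### Existence of sections and of smooth representatives -/

namespace ConvexPolyhedron

variable {P : ConvexPolyhedron}

theorem nonempty_vertexSection (v : P.vertices) : Nonempty (VertexSection P v) := by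
  obtain ⟨ν, c, hv, hw⟩ := P.exists_separating v
  have hν : ν ≠ 0 := by
    rintro rfl
    obtain ⟨q, hq, hne⟩ := P.exists_vertex_inner_ne (w := EuclideanSpace.single 0 1) (by simp)
      (inner ℝ (EuclideanSpace.single 0 1) (v : E3))
    have hqv : (⟨q, hq⟩ : P.vertices) ≠ v := by
      rintro rfl
      exact hne rfl
    have := hw _ hqv
    rw [inner_zero_left] at hv this
    exact lt_asymm hv this
  set μ : E3 := ‖ν‖⁻¹ • ν with hμ
  have hμ1 : ‖μ‖ = 1 := norm_smul_inv_norm hν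
  have hν0 : 0 < ‖ν‖ := norm_pos_iff.2 hν
  obtain ⟨t, ht, ht0⟩ : ∃ t ∈ (Submodule.span ℝ {μ})ᗮ, t ≠ 0 := by
    apply Submodule.exists_mem_ne_zero_of_ne_bot
    intro h
    have h2 := Submodule.finrank_add_finrank_orthogonal (Submodule.span ℝ {μ})
    rw [h, finrank_bot, finrank_euclideanSpace_fin] at h2
    have := finrank_span_singleton (K := ℝ) (norm_ne_zero_iff.1 (hμ1.trans_ne one_ne_zero))
    omega
  rw [Submodule.mem_orthogonal_singleton_iff_inner_right] at ht
  set t₁ : E3 := ‖t‖⁻¹ • t with ht₁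
  have h₁ : ‖t₁‖ = 1 := norm_smul_inv_norm ht0
  have hμt : inner ℝ μ t₁ = 0 := by rw [ht₁, inner_smul_right, ht, mul_zero]
  have i₁ : inner ℝ t₁ t₁ = (1 : ℝ) := by rw [real_inner_self_eq_norm_sq, h₁]; norm_num
  have iμ : inner ℝ μ μ = (1 : ℝ) := by rw [real_inner_self_eq_norm_sq, hμ1]; norm_num
  -- With `μ` the unit normal from `exists_separating`, the frame `(t₁, μ × t₁)` has normal exactly
  -- `μ`, which fixes the orientation.
  have htp : ∀ x, tripleProduct t₁ (crossVec μ t₁) x = inner ℝ μ x := by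
    intro x
    rw [tripleProduct_crossVec, i₁, real_inner_comm μ t₁, hμt]
    ring
  have hval : ∀ x, inner ℝ μ (x - (‖ν‖⁻¹ * c) • μ) = ‖ν‖⁻¹ * (inner ℝ ν x - c) := by
    intro x
    rw [inner_sub_right, inner_smul_right, iμ, hμ, inner_smul_left]
    simp
    ring
  refine ⟨⟨(‖ν‖⁻¹ * c) • μ, t₁, crossVec μ t₁, h₁, ?_, ?_, ?_, fun w hwv => ?_⟩⟩
  · have : ‖crossVec μ t₁‖ ^ 2 = 1 := by
      rw [← real_inner_self_eq_norm_sq, inner_crossVec_self, iμ, i₁, hμt]; norm_num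
    nlinarith [norm_nonneg (crossVec μ t₁)]
  · rw [real_inner_comm, inner_crossVec_right]
  · rw [htp, hval]
    exact mul_neg_of_pos_of_neg (inv_pos.2 hν0) (by linarith)
  · rw [htp, hval]
    exact mul_pos (inv_pos.2 hν0) (by linarith [hw w hwv])

/-- Normalization of a nowhere vanishing field which is close to a tangent field. -/
theorem exists_smooth_representative (h : P.HomotopyClass) :
    ∃ n : P.TangentField, (⟦n⟧ : P.HomotopyClass) = h ∧ n.IsSmooth := by
  induction h using Quotient.inductionOn with
  | h m =>
    obtain ⟨g, hg, hgm, hgt⟩ := exists_smooth_tangent_approx m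
    have hgc : ContinuousOn g P.domain := hg.continuousOn.mono fun x hx => hx.2
    -- The segment from `m` to the smooth field `g` keeps within distance `1` of the unit vector
    -- `m`, hence avoids `0`, and tangency is linear. Normalizing it gives the homotopy.
    let z : unitInterval × P.domain → E3 := fun q =>
      m.toFun q.2 + (q.1 : ℝ) • (g q.2 - m.toFun q.2)
    have hzc : Continuous z := by
      have h1 : Continuous fun q : unitInterval × P.domain => m.toFun q.2 :=
        (continuousOn_iff_continuous_domRestrict.1 m.continuousOn_toFun).comp continuous_snd
      have h2 : Continuous fun q : unitInterval × P.domain => g q.2 :=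
        (continuousOn_iff_continuous_domRestrict.1 hgc).comp continuous_snd
      exact h1.add ((continuous_subtype_val.comp continuous_fst).smul (h2.sub h1))
    have hz0 : ∀ q, z q ≠ 0 := by
      intro q hq
      have h1 : ‖(q.1 : ℝ) • (g q.2 - m.toFun q.2)‖ < 1 := by
        rw [norm_smul, Real.norm_of_nonneg q.1.2.1]
        have h2 := hgm q.2 q.2.2
        have h3 := q.1.2.2
        have h4 := q.1.2.1
        nlinarith [norm_nonneg (g q.2 - m.toFun q.2)]
      have h2 : (q.1 : ℝ) • (g q.2 - m.toFun q.2) = - m.toFun q.2 :=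
        (neg_eq_of_add_eq_zero_right hq).symm
      rw [h2, norm_neg, m.norm_toFun q.2.2] at h1
      exact lt_irrefl _ h1
    have hzt : ∀ t : unitInterval, ∀ ν, P.IsFaceNormal ν → ∀ x : P.domain, (x : E3) ∈ P.face ν →
        inner ℝ ν (z (t, x)) = 0 := by
      intro t ν hν x hxν
      simp only [z, inner_add_right, inner_smul_right, inner_sub_right,
        m.tangent hν x.2 hxν, hgt ν hν x x.2 hxν]
      ring
    have hmem : ∀ q, ‖z q‖⁻¹ • z q ∈ Metric.sphere (0 : E3) 1 := fun q => by
      rw [mem_sphere_zero_iff_norm]; exact norm_smul_inv_norm (hz0 q)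
    have hnc : Continuous fun q => ‖z q‖⁻¹ • z q :=
      (hzc.norm.inv₀ fun q => norm_ne_zero_iff.2 (hz0 q)).smul hzc
    let H : C(unitInterval × P.domain, Metric.sphere (0 : E3) 1) :=
      ⟨fun q => ⟨‖z q‖⁻¹ • z q, hmem q⟩, hnc.subtype_mk hmem⟩
    have hHt : ∀ t : unitInterval, ∀ ν, P.IsFaceNormal ν → ∀ x : P.domain, (x : E3) ∈ P.face ν →
        inner ℝ ν ((H (t, x) : Metric.sphere (0 : E3) 1) : E3) = 0 := by
      intro t ν hν x hxν
      change inner ℝ ν (‖z (t, x)‖⁻¹ • z (t, x)) = 0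
      rw [inner_smul_right, hzt t ν hν x hxν, mul_zero]
    let n : P.TangentField := ⟨⟨fun x => H (1, x), H.continuous.comp (by fun_prop)⟩,
      fun ν hν x hxν => hHt 1 ν hν x hxν⟩
    have hz1 : ∀ x : P.domain, z (1, x) = g x := fun x => by simp [z]
    refine ⟨n, Quotient.sound (Setoid.symm ?_), ?_⟩
    · refine ⟨⟨⟨H, fun x => ?_, fun x => rfl⟩, fun t ν hν x hxν => hHt t ν hν x hxν⟩⟩
      apply Subtype.ext
      change ‖z (0, x)‖⁻¹ • z (0, x) = (m.1 x : E3)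
      have hz : z (0, x) = (m.1 x : E3) := by simp [z, m.toFun_of_mem x.2]
      rw [hz, mem_sphere_zero_iff_norm.1 (m.1 x).2]
      simp
    · have hg0 : ∀ x ∈ P.domain, g x ≠ 0 := fun x hx => by
        rw [← hz1 ⟨x, hx⟩]; exact hz0 _
      have hgd : ContDiffOn ℝ ((⊤ : ℕ∞) : WithTop ℕ∞) g P.domain := hg.mono fun x hx => hx.2
      have : ContDiffOn ℝ ((⊤ : ℕ∞) : WithTop ℕ∞) (fun x => ‖g x‖⁻¹ • g x) P.domain :=
        ((hgd.norm ℝ hg0).inv fun x hx => norm_ne_zero_iff.2 (hg0 x hx)).smul hgd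
      refine this.congr fun x hx => ?_
      rw [n.toFun_of_mem hx]
      change ‖z (1, ⟨x, hx⟩)‖⁻¹ • z (1, ⟨x, hx⟩) = _
      rw [hz1]

end ConvexPolyhedron
end

/-! ### Derivatives on zero sets, smooth steps, geometry of sections -/

noncomputable section

open MeasureTheory Filter Topology in
/-- The derivative of a function vanishes at almost every zero. -/
theorem ae_fderiv_eq_zero_of_eq_zero {O : Set (ℝ × ℝ)} (hO : IsOpen O) {f : ℝ × ℝ → ℝ}
    (hf : ∀ p ∈ O, DifferentiableAt ℝ f p) :
    ∀ᵐ p, p ∈ O → f p = 0 → fderiv ℝ f p = 0 := by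
  set s : Set (ℝ × ℝ) := {p | p ∈ O ∧ f p = 0} with hs
  have hfc : ContinuousOn f O := fun p hp => (hf p hp).continuousAt.continuousWithinAt
  have hsm : MeasurableSet s := by
    have h1 := hfc.isOpen_inter_preimage hO (isClosed_singleton (x := (0 : ℝ))).isOpen_compl
    have h2 : s = O \ (O ∩ f ⁻¹' {0}ᶜ) := by
      ext p
      simp only [hs, Set.mem_ofPred_eq, Set.mem_sdiff, Set.mem_inter_iff, Set.mem_preimage,
        Set.mem_compl_iff, Set.mem_singleton_iff]
      tauto
    rw [h2]
    exact MeasurableSet.diff hO.measurableSet h1.measurableSet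
  -- On its zero set `f` is approximated by the zero map with constant `0`, so at almost every point
  -- of the set the derivative is within `0` of the zero map. The second component `0` only makes
  -- this a self-map of the plane.
  have h0 : ApproximatesLinearOn (fun p : ℝ × ℝ => (f p, (0 : ℝ))) (0 : ℝ × ℝ →L[ℝ] ℝ × ℝ) s 0 := by
    intro p hp q hq
    simp [hp.2, hq.2]
  have h1 := h0.norm_fderiv_sub_le (μ := volume) hsm
    (fun p => (fderiv ℝ f p).prod (0 : ℝ × ℝ →L[ℝ] ℝ)) fun p hp =>
      ((hf p hp.1).hasFDerivAt.prodMk (hasFDerivAt_const (0 : ℝ) p)).hasFDerivWithinAt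
  rw [ae_restrict_iff' hsm] at h1
  filter_upwards [h1] with p hp hpO hpf
  have h2 := hp ⟨hpO, hpf⟩
  rw [sub_zero, nonpos_iff_eq_zero, nnnorm_eq_zero] at h2
  refine ContinuousLinearMap.ext fun y => ?_
  have := congrArg (fun A : ℝ × ℝ →L[ℝ] ℝ × ℝ => (A y).1) h2
  simpa using this

/-- A smooth decreasing step of width `ε`, from `1` on the left of `0` to `0`. -/
def stepDown (ε s : ℝ) : ℝ := 1 - Real.smoothTransition (s / ε)

section stepDown

open MeasureTheory Filter Topology

theorem contDiff_stepDown (ε : ℝ) : ContDiff ℝ ((⊤ : ℕ∞) : WithTop ℕ∞) (stepDown ε) :=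
  contDiff_const.sub (Real.smoothTransition.contDiff.comp (contDiff_id.div_const ε))

theorem stepDown_of_nonpos {ε : ℝ} (hε : 0 < ε) {s : ℝ} (hs : s ≤ 0) : stepDown ε s = 1 := by
  rw [stepDown, Real.smoothTransition.zero_of_nonpos (div_nonpos_of_nonpos_of_nonneg hs hε.le),
    sub_zero]

theorem stepDown_of_le {ε : ℝ} (hε : 0 < ε) {s : ℝ} (hs : ε ≤ s) : stepDown ε s = 0 := by
  rw [stepDown, Real.smoothTransition.one_of_one_le ((one_le_div hε).2 hs), sub_self]

theorem antitone_stepDown {ε : ℝ} (hε : 0 < ε) : Antitone (stepDown ε) := fun _ _ h =>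
  sub_le_sub_left (Real.smoothTransition.monotone (div_le_div_of_nonneg_right h hε.le)) _

theorem deriv_stepDown_of_notMem {ε : ℝ} (hε : 0 < ε) {s : ℝ} (hs : s ∉ Set.Icc 0 ε) :
    deriv (stepDown ε) s = 0 := by
  rw [Set.mem_Icc, not_and_or, not_le, not_le] at hs
  rcases hs with hs | hs
  · have : stepDown ε =ᶠ[𝓝 s] fun _ => 1 := by
      filter_upwards [Iio_mem_nhds hs] with t ht
      exact stepDown_of_nonpos hε (le_of_lt ht)
    rw [this.deriv_eq, deriv_const]
  · have : stepDown ε =ᶠ[𝓝 s] fun _ => 0 := by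
      filter_upwards [Ioi_mem_nhds hs] with t ht
      exact stepDown_of_le hε (le_of_lt ht)
    rw [this.deriv_eq, deriv_const]

theorem integrable_deriv_stepDown {ε : ℝ} (hε : 0 < ε) : Integrable (deriv (stepDown ε)) :=
  ((contDiff_stepDown ε).continuous_deriv (by simp)).integrable_of_hasCompactSupport
    (HasCompactSupport.intro isCompact_Icc fun _ hs => deriv_stepDown_of_notMem hε hs)

theorem integral_deriv_stepDown {ε : ℝ} (hε : 0 < ε) : ∫ s, deriv (stepDown ε) s = -1 := by
  have hb : Tendsto (stepDown ε) atBot (𝓝 1) := tendsto_const_nhds.congr' <| by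
    filter_upwards [eventually_le_atBot 0] with t ht
    exact (stepDown_of_nonpos hε ht).symm
  have ht : Tendsto (stepDown ε) atTop (𝓝 0) := tendsto_const_nhds.congr' <| by
    filter_upwards [eventually_ge_atTop ε] with t ht
    exact (stepDown_of_le hε ht).symm
  have := integral_of_hasDerivAt_of_tendsto
    (fun s => ((contDiff_stepDown ε).differentiable (by simp) s).hasDerivAt)
    (integrable_deriv_stepDown hε) hb ht
  rw [this]
  norm_num

/-- `-deriv (stepDown ε)` is non-negative, of integral `1` and supported in `[0, ε]`: an approximate
identity at `0`. -/
theorem eq_neg_of_integral_deriv_stepDown {A : ℝ → ℝ} {c : ℝ} (hA : ContinuousAt A 0)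
    (h : ∀ᶠ ε in 𝓝[>] 0, Integrable (fun s => deriv (stepDown ε) s * A s) ∧
      ∫ s, deriv (stepDown ε) s * A s = c) : c = - A 0 := by
  by_contra hne
  have hδ : 0 < |c + A 0| := abs_pos.2 fun h0 => hne (eq_neg_of_add_eq_zero_left h0)
  set δ := |c + A 0| with hδd
  obtain ⟨η, hη, hAη⟩ := Metric.continuousAt_iff.1 hA (δ / 2) (by linarith)
  have hη' : ∀ᶠ ε in 𝓝[>] (0 : ℝ), ε < η := mem_nhdsWithin_of_mem_nhds (Iio_mem_nhds hη)
  obtain ⟨ε, ⟨⟨hi, hc⟩, hεη⟩, hε⟩ := ((h.and hη').and self_mem_nhdsWithin).exists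
  have hε : 0 < ε := hε
  have hd := integrable_deriv_stepDown hε
  have e1 : c + A 0 = ∫ s, deriv (stepDown ε) s * (A s - A 0) := by
    simp only [mul_sub]
    rw [integral_sub hi (hd.mul_const _), integral_mul_const, integral_deriv_stepDown hε, hc]
    ring
  have e2 : |c + A 0| ≤ ∫ s, -deriv (stepDown ε) s * (δ / 2) := by
    rw [e1, ← Real.norm_eq_abs]
    refine norm_integral_le_of_norm_le (hd.neg.mul_const _) (Eventually.of_forall fun s => ?_)
    rw [norm_mul, Real.norm_of_nonpos (antitone_stepDown hε).deriv_nonpos]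
    by_cases hs : s ∈ Set.Icc 0 ε
    · refine mul_le_mul_of_nonneg_left ?_
        (neg_nonneg.2 (antitone_stepDown hε).deriv_nonpos)
      have := hAη (x := s) (by
        rw [Real.dist_eq, sub_zero, abs_of_nonneg hs.1]
        exact hs.2.trans_lt hεη)
      exact this.le
    · rw [deriv_stepDown_of_notMem hε hs]
      simp
  rw [integral_mul_const, integral_neg, integral_deriv_stepDown hε] at e2
  linarith

end stepDown

namespace ConvexPolyhedron

variable {P : ConvexPolyhedron}

open MeasureTheory Filter Topology

theorem uniqueDiffOn_domain : UniqueDiffOn ℝ P.domain :=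
  (uniqueDiffOn_convex P.convex_body P.solid).inter P.vertices.finite_toSet.isClosed.isOpen_compl

/-- Smoothness up to the faces is used here: the derivative within the domain is continuous up to
the boundary, so it is bounded on compact sets that miss the vertices. -/
theorem TangentField.IsSmooth.exists_bound_fderiv {n : P.TangentField} (hn : n.IsSmooth)
    {T : Set E3} (hT : IsClosed T) (hv : ∀ v ∈ P.vertices, v ∉ T) :
    ∃ C, ∀ x ∈ interior P.body, x ∈ T → ‖fderiv ℝ n.toFun x‖ ≤ C := by
  have hc : ContinuousOn (fderivWithin ℝ n.toFun P.domain) P.domain :=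
    ContDiffOn.continuousOn_fderivWithin hn uniqueDiffOn_domain (by simp)
  obtain ⟨C, hC⟩ := (P.isCompact_body.inter_right hT).exists_bound_of_continuousOn
    (hc.mono fun x hx => ⟨hx.1, fun hxv => hv x hxv hx.2⟩)
  refine ⟨C, fun x hx hxT => ?_⟩
  have hd : P.domain ∈ 𝓝 x := mem_of_superset (isOpen_interior.mem_nhds hx)
    P.interior_subset_domain
  rw [← fderivWithin_of_mem_nhds hd]
  exact hC x ⟨interior_subset hx, hxT⟩

/-- The signed distance to the plane of a section. -/
def VertexSection.height {v : P.vertices} (S : VertexSection P v) (x : E3) : ℝ :=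
  inner ℝ (crossVec S.t₁ S.t₂) (x - S.base)

section height

variable {v : P.vertices} (S : VertexSection P v)

theorem VertexSection.norm_crossVec : ‖crossVec S.t₁ S.t₂‖ = 1 := by
  have : ‖crossVec S.t₁ S.t₂‖ ^ 2 = 1 := by
    rw [← real_inner_self_eq_norm_sq, inner_crossVec_self, S.orthogonal,
      real_inner_self_eq_norm_sq, real_inner_self_eq_norm_sq, S.norm_t₁, S.norm_t₂]
    norm_num
  exact (pow_eq_one_iff_of_nonneg (norm_nonneg _) two_ne_zero).1 this

theorem VertexSection.height_add (s : ℝ) (p : ℝ × ℝ) :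
    S.height (S.point p + s • crossVec S.t₁ S.t₂) = s := by
  have : S.point p + s • crossVec S.t₁ S.t₂ - S.base
      = p.1 • S.t₁ + p.2 • S.t₂ + s • crossVec S.t₁ S.t₂ := by
    rw [VertexSection.point]; abel
  rw [height, this, inner_add_right, inner_add_right, inner_smul_right, inner_smul_right,
    inner_smul_right, inner_crossVec_left, inner_crossVec_right, real_inner_self_eq_norm_sq,
    S.norm_crossVec]
  ring

theorem VertexSection.hasFDerivAt_height (x : E3) :
    HasFDerivAt S.height (innerSL ℝ (crossVec S.t₁ S.t₂)) x := by
  have := (innerSL ℝ (crossVec S.t₁ S.t₂)).hasFDerivAt.comp x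
    ((hasFDerivAt_id x).sub_const S.base)
  exact this

theorem VertexSection.contDiff_height : ContDiff ℝ ((⊤ : ℕ∞) : WithTop ℕ∞) S.height :=
  contDiff_const.inner ℝ (contDiff_id.sub contDiff_const)

theorem VertexSection.continuous_height : Continuous S.height := S.contDiff_height.continuous

/-- Gives a slab around the section without vertices, in which the steps are placed. -/
theorem VertexSection.exists_height_gt : ∃ σ : ℝ, 0 < σ ∧ ∀ w ∈ P.vertices, σ < |S.height w| := by
  have h : ∀ᶠ σ in 𝓝[>] (0 : ℝ), ∀ w ∈ P.vertices, σ < |S.height w| := by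
    refine (Finset.eventually_all _).2 fun w hw => mem_nhdsWithin_of_mem_nhds (Iio_mem_nhds ?_)
    rw [abs_pos, height, inner_crossVec]
    by_cases hwv : (⟨w, hw⟩ : P.vertices) = v
    · subst hwv
      exact S.below.ne
    · exact (S.above _ hwv).ne'
  obtain ⟨σ, h1, h2⟩ := (h.and self_mem_nhdsWithin).exists
  exact ⟨σ, h2, h1⟩

theorem VertexSection.isVertexConst_stepDown {σ ε : ℝ} (hε : 0 < ε) (hεσ : ε ≤ σ)
    (hσ : ∀ w ∈ P.vertices, σ < |S.height w|) :
    P.IsVertexConst (fun x => stepDown ε (S.height x)) ∧ stepDown ε (S.height v) = 1 ∧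
      ∀ w ∈ P.vertices, w ≠ v → stepDown ε (S.height w) = 0 := by
  have hv : S.height v < 0 := by rw [height, inner_crossVec]; exact S.below
  have hw : ∀ w ∈ P.vertices, w ≠ v → ε < S.height w := by
    intro w hw hwv
    have h1 : 0 < S.height w := by
      rw [height, inner_crossVec]
      exact S.above ⟨w, hw⟩ fun h => hwv (congrArg Subtype.val h)
    have := hσ w hw
    rw [abs_of_pos h1] at this
    linarith
  refine ⟨⟨(contDiff_stepDown ε).comp S.contDiff_height, fun w hwP => ?_⟩,
    stepDown_of_nonpos hε hv.le, fun w hwP hwv => stepDown_of_le hε (hw w hwP hwv).le⟩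
  by_cases hwv : w = v
  · rw [hwv, stepDown_of_nonpos hε hv.le]
    filter_upwards [S.continuous_height.continuousAt.eventually_lt_const hv] with x hx
    exact stepDown_of_nonpos hε hx.le
  · rw [stepDown_of_le hε (hw w hwP hwv).le]
    filter_upwards [S.continuous_height.continuousAt.eventually_const_lt (hw w hwP hwv)] with x hx
    exact stepDown_of_le hε hx.le

theorem VertexSection.exists_bound_point :
    ∃ R : ℝ, ∀ (s : ℝ) (p : ℝ × ℝ), S.point p + s • crossVec S.t₁ S.t₂ ∈ P.body →
      p ∈ Metric.closedBall (0 : ℝ × ℝ) R := by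
  obtain ⟨R, hR⟩ := P.isCompact_body.isBounded.exists_norm_le
  refine ⟨R + ‖S.base‖, fun s p hp => ?_⟩
  set x := S.point p + s • crossVec S.t₁ S.t₂ with hx
  have hxe : x - S.base = p.1 • S.t₁ + p.2 • S.t₂ + s • crossVec S.t₁ S.t₂ := by
    rw [hx, VertexSection.point]; abel
  have hb : ‖x - S.base‖ ≤ R + ‖S.base‖ :=
    (norm_sub_le _ _).trans (add_le_add_left (hR x hp) _)
  have h1 : inner ℝ S.t₁ (x - S.base) = p.1 := by
    rw [hxe, inner_add_right, inner_add_right, inner_smul_right, inner_smul_right,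
      inner_smul_right, real_inner_comm, real_inner_comm (crossVec S.t₁ S.t₂) S.t₁,
      inner_crossVec_left, S.orthogonal, real_inner_self_eq_norm_sq, S.norm_t₁]
    ring
  have h2 : inner ℝ S.t₂ (x - S.base) = p.2 := by
    rw [hxe, inner_add_right, inner_add_right, inner_smul_right, inner_smul_right,
      inner_smul_right, real_inner_comm S.t₁ S.t₂, real_inner_comm (crossVec S.t₁ S.t₂) S.t₂,
      inner_crossVec_right, S.orthogonal, real_inner_self_eq_norm_sq, S.norm_t₂]
    ring
  have h3 := abs_real_inner_le_norm S.t₁ (x - S.base)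
  have h4 := abs_real_inner_le_norm S.t₂ (x - S.base)
  rw [h1, S.norm_t₁, one_mul] at h3
  rw [h2, S.norm_t₂, one_mul] at h4
  rw [mem_closedBall_zero_iff, Prod.norm_def, Real.norm_eq_abs, Real.norm_eq_abs]
  exact max_le (h3.trans hb) (h4.trans hb)

end height

end ConvexPolyhedron
end

/-! ### The vertex flux as an integral over a section -/

noncomputable section

namespace ConvexPolyhedron

variable {P : ConvexPolyhedron}

open MeasureTheory Filter Topology

/-- The cut-off area density of a field on the planes parallel to a section, extended by zero
outside the polyhedron. -/
def sectionDensity (n : P.TangentField) {v : P.vertices} (S : VertexSection P v) (k : ℕ) :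
    E3 → ℝ :=
  (interior P.body).indicator fun x => tripleProduct (P.cutoffField k (n.toFun x))
    (fderiv ℝ n.toFun x S.t₁) (fderiv ℝ n.toFun x S.t₂)

variable {n : P.TangentField} {v : P.vertices} (S : VertexSection P v)

theorem continuousOn_areaDensity (hn : n.IsSmooth) (a b : E3) (k : ℕ) :
    ContinuousOn (fun x => tripleProduct (P.cutoffField k (n.toFun x))
      (fderiv ℝ n.toFun x a) (fderiv ℝ n.toFun x b)) (interior P.body) := by
  have hd : ContinuousOn (fderiv ℝ n.toFun) (interior P.body) :=
    hn.contDiffOn_interior.continuousOn_fderiv_of_isOpen isOpen_interior le_rfl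
  refine continuousOn_tripleProduct ?_ (hd.clm_apply continuousOn_const)
    (hd.clm_apply continuousOn_const)
  exact (P.contDiffOn_cutoffField k).continuousOn.comp
    (n.continuousOn_toFun.mono P.interior_subset_domain) fun x hx =>
      hn.isAdmissible.ne_zero x (P.interior_subset_domain hx)

/-- Within the slab the cut-off field vanishes off a compact subset of the interior, so the
extension by zero creates no jump at the faces. -/
theorem continuousAt_sectionDensity (hn : n.IsSmooth) {σ : ℝ}
    (hσ : ∀ w ∈ P.vertices, σ < |S.height w|) (k : ℕ) {x : E3} (hx : |S.height x| < σ) :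
    ContinuousAt (sectionDensity n S k) x := by
  have hcl : IsClosed {x | |S.height x| ≤ σ} :=
    isClosed_le S.continuous_height.abs continuous_const
  obtain ⟨K, hKU, hK, hKz⟩ := hn.isAdmissible.exists_compact k hcl
    fun w hw => not_le.2 (hσ w hw)
  by_cases hxU : x ∈ interior P.body
  · refine ((continuousOn_areaDensity hn S.t₁ S.t₂ k).continuousAt
      (isOpen_interior.mem_nhds hxU)).congr ?_
    filter_upwards [isOpen_interior.mem_nhds hxU] with y hy
    rw [sectionDensity, Set.indicator_of_mem hy]
  · have h0 : ∀ᶠ y in 𝓝 x, sectionDensity n S k y = 0 := by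
      have h1 : ∀ᶠ y in 𝓝 x, y ∉ K := hK.isClosed.isOpen_compl.mem_nhds fun h => hxU (hKU h)
      filter_upwards [h1, S.continuous_height.abs.continuousAt.eventually_lt_const hx] with y hy hyσ
      by_cases hyU : y ∈ interior P.body
      · rw [sectionDensity, Set.indicator_of_mem hyU, hKz y hyU hyσ.le hy, tripleProduct_eq]
        simp
      · rw [sectionDensity, Set.indicator_of_notMem hyU]
    exact continuousAt_const.congr (h0.mono fun y hy => hy.symm)

/-- Uniform in both the height and `k`: it dominates the limit in which the planes approach the
section and the limit `k → ∞`. -/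
theorem exists_bound_sectionDensity (hn : n.IsSmooth) {σ : ℝ}
    (hσ : ∀ w ∈ P.vertices, σ < |S.height w|) :
    ∃ C R : ℝ, ∀ (k : ℕ) (s : ℝ) (p : ℝ × ℝ), |s| ≤ σ →
      ‖sectionDensity n S k (S.point p + s • crossVec S.t₁ S.t₂)‖ ≤
        (Metric.closedBall (0 : ℝ × ℝ) R).indicator (fun _ => C) p := by
  have hcl : IsClosed {x | |S.height x| ≤ σ} :=
    isClosed_le S.continuous_height.abs continuous_const
  obtain ⟨C, hC⟩ := hn.exists_bound_fderiv hcl fun w hw => not_le.2 (hσ w hw)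
  obtain ⟨R, hR⟩ := S.exists_bound_point
  refine ⟨6 * (1 * |C| * |C|), R, fun k s p hs => ?_⟩
  set x := S.point p + s • crossVec S.t₁ S.t₂ with hx
  by_cases hxU : x ∈ interior P.body
  · rw [sectionDensity, Set.indicator_of_mem hxU,
      Set.indicator_of_mem (hR s p (interior_subset hxU)), Real.norm_eq_abs]
    refine (abs_tripleProduct_le _ _ _).trans ?_
    have hCx := (hC x hxU (by
      change |S.height x| ≤ σ
      rw [hx, S.height_add]; exact hs)).trans (le_abs_self C)
    have h1 : ∀ t : E3, ‖t‖ = 1 → ‖fderiv ℝ n.toFun x t‖ ≤ |C| := fun t ht => by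
      have := (fderiv ℝ n.toFun x).le_opNorm t
      rw [ht, mul_one] at this
      exact this.trans hCx
    have h2 := P.norm_cutoffField_le (k := k) (n.norm_toFun (P.interior_subset_domain hxU))
    have h3 := h1 _ S.norm_t₁
    have h4 := h1 _ S.norm_t₂
    gcongr
  · rw [sectionDensity, Set.indicator_of_notMem hxU, norm_zero]
    exact Set.indicator_nonneg (fun _ _ => by positivity) _

theorem continuousAt_integral_sectionDensity (hn : n.IsSmooth) (k : ℕ) :
    ContinuousAt (fun s : ℝ => ∫ p, sectionDensity n S k
      (S.point p + s • crossVec S.t₁ S.t₂)) 0 := by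
  obtain ⟨σ, hσ0, hσ⟩ := S.exists_height_gt
  obtain ⟨C, R, hCR⟩ := exists_bound_sectionDensity S hn hσ
  have hs : ∀ᶠ s in 𝓝 (0 : ℝ), |s| < σ := by
    have : ContinuousAt (fun s : ℝ => |s|) 0 := by fun_prop
    exact this.eventually_lt_const (by simpa using hσ0)
  have hpc : ∀ s : ℝ, Continuous fun p : ℝ × ℝ => S.point p + s • crossVec S.t₁ S.t₂ := fun s => by
    unfold VertexSection.point
    fun_prop
  refine continuousAt_of_dominated
    (bound := (Metric.closedBall (0 : ℝ × ℝ) R).indicator fun _ => C) ?_ ?_ ?_ ?_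
  · filter_upwards [hs] with s hs
    refine Continuous.aestronglyMeasurable (continuous_iff_continuousAt.2 fun p => ?_)
    have := continuousAt_sectionDensity (n := n) S hn hσ k
      (x := S.point p + s • crossVec S.t₁ S.t₂) (by rw [S.height_add]; exact hs)
    exact this.comp (f := fun p => S.point p + s • crossVec S.t₁ S.t₂) (hpc s).continuousAt
  · filter_upwards [hs] with s hs
    exact Eventually.of_forall fun p => hCR k s p hs.le
  · exact (integrable_indicator_iff measurableSet_closedBall).2
      (integrableOn_const measure_closedBall_lt_top.ne)
  · refine Eventually.of_forall fun p => ?_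
    have := continuousAt_sectionDensity (n := n) S hn hσ k
      (x := S.point p + (0 : ℝ) • crossVec S.t₁ S.t₂) (by rw [S.height_add]; simpa using hσ0)
    exact ContinuousAt.comp (f := fun s : ℝ => S.point p + s • crossVec S.t₁ S.t₂) this
      (by fun_prop)

/-- The flux around a vertex is the flux through a section. -/
theorem vertexFlux_eq_integral_sectionDensity (hn : n.IsSmooth) (k : ℕ) :
    P.vertexFlux k n.toFun (fderiv ℝ n.toFun) v =
      - ∫ p, sectionDensity n S k (S.point p) := by
  obtain ⟨σ, hσ0, hσ⟩ := S.exists_height_gt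
  obtain ⟨e, he, hes⟩ := exists_measurePreserving_frame S.norm_t₁ S.norm_t₂ S.orthogonal S.base
  have hes' : ∀ s p, e (s, p) = S.point p + s • crossVec S.t₁ S.t₂ := hes
  have key := eq_neg_of_integral_deriv_stepDown
    (c := P.vertexFlux k n.toFun (fderiv ℝ n.toFun) v)
    (continuousAt_integral_sectionDensity (n := n) S hn k) ?_
  · simpa using key
  have hεσ : ∀ᶠ ε in 𝓝[>] (0 : ℝ), ε < σ := mem_nhdsWithin_of_mem_nhds (Iio_mem_nhds hσ0)
  filter_upwards [hεσ, self_mem_nhdsWithin] with ε hεσ hε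
  have hε : 0 < ε := hε
  obtain ⟨hφ, hφv, hφw⟩ := S.isVertexConst_stepDown hε hεσ.le hσ
  have hdens : ∀ x, (interior P.body).indicator (fun x => fluxDensity
      (P.cutoffField k (n.toFun x)) (fderiv ℝ n.toFun x)
      (fderiv ℝ (fun x => stepDown ε (S.height x)) x)) x =
      deriv (stepDown ε) (S.height x) * sectionDensity n S k x := by
    intro x
    have hd : HasFDerivAt (fun x => stepDown ε (S.height x))
        (deriv (stepDown ε) (S.height x) • innerSL ℝ (crossVec S.t₁ S.t₂)) x :=
      ((contDiff_stepDown ε).differentiable (by simp) _).hasDerivAt.comp_hasFDerivAt x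
        (S.hasFDerivAt_height x)
    by_cases hx : x ∈ interior P.body
    · rw [sectionDensity, Set.indicator_of_mem hx, Set.indicator_of_mem hx, hd.fderiv,
        fluxDensity_crossVec]
    · rw [sectionDensity, Set.indicator_of_notMem hx, Set.indicator_of_notMem hx, mul_zero]
  have hi1 := (integrable_indicator_iff isOpen_interior.measurableSet).2
    (hn.isAdmissible.integrableOn k hφ)
  rw [funext hdens] at hi1
  have hi2 : Integrable (fun q : ℝ × (ℝ × ℝ) => deriv (stepDown ε) q.1 *
      sectionDensity n S k (S.point q.2 + q.1 • crossVec S.t₁ S.t₂)) volume := by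
    have := (he.integrable_comp_emb e.measurableEmbedding).2 hi1
    refine this.congr (Eventually.of_forall fun q => ?_)
    change deriv (stepDown ε) (S.height (e (q.1, q.2))) * sectionDensity n S k (e (q.1, q.2)) = _
    rw [hes', S.height_add]
  have hflux : P.vertexFlux k n.toFun (fderiv ℝ n.toFun) v =
      ∫ q : ℝ × (ℝ × ℝ), deriv (stepDown ε) q.1 *
        sectionDensity n S k (S.point q.2 + q.1 • crossVec S.t₁ S.t₂) := by
    rw [← hn.isAdmissible.flux_eq_vertexFlux k hφ v.2 hφv hφw, flux,
      ← integral_indicator isOpen_interior.measurableSet, funext hdens, ← he.integral_comp']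
    refine integral_congr_ae (Eventually.of_forall fun q => ?_)
    change deriv (stepDown ε) (S.height (e (q.1, q.2))) * sectionDensity n S k (e (q.1, q.2)) = _
    rw [hes', S.height_add]
  have hi3 := hi2.integral_prod_left
  -- Fubini in the adapted frame: the flux is the integral over heights of the step's derivative
  -- times the plane integrals.
  have hI := integral_prod _ hi2
  simp only [integral_const_mul] at hi3 hI
  exact ⟨hi3, by rw [hflux]; exact hI.symm⟩

/-- Where `n` is orthogonal to `ν`, so are its derivatives along the section, almost everywhere;
there the area density is zero. -/
theorem ae_inner_eq_zero_imp (hn : n.IsSmooth) (ν : E3) :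
    ∀ᵐ p : ℝ × ℝ, S.point p ∈ interior P.body → inner ℝ ν (n.toFun (S.point p)) = 0 →
      inner ℝ ν (fderiv ℝ n.toFun (S.point p) S.t₁) = 0 ∧
      inner ℝ ν (fderiv ℝ n.toFun (S.point p) S.t₂) = 0 := by
  have hpc : Continuous S.point := by
    unfold VertexSection.point
    fun_prop
  set D : ℝ × ℝ →L[ℝ] E3 := (ContinuousLinearMap.fst ℝ ℝ ℝ).smulRight S.t₁ +
    (ContinuousLinearMap.snd ℝ ℝ ℝ).smulRight S.t₂ with hD
  have hpd : ∀ p, HasFDerivAt S.point D p := by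
    intro p
    have h : S.point = fun p => S.base + D p := by
      funext p
      simp [VertexSection.point, hD, add_assoc]
    rw [h]
    exact D.hasFDerivAt.const_add S.base
  have hd : ∀ p ∈ S.point ⁻¹' interior P.body,
      HasFDerivAt (fun p => inner ℝ ν (n.toFun (S.point p)))
        ((innerSL ℝ ν).comp ((fderiv ℝ n.toFun (S.point p)).comp D)) p := by
    intro p hp
    have h1 : HasFDerivAt n.toFun (fderiv ℝ n.toFun (S.point p)) (S.point p) :=
      ((hn.contDiffOn_interior.contDiffAt (isOpen_interior.mem_nhds hp)).differentiableAt
        (by simp)).hasFDerivAt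
    exact (innerSL ℝ ν).hasFDerivAt.comp p (h1.comp p (hpd p))
  have := ae_fderiv_eq_zero_of_eq_zero (isOpen_interior.preimage hpc)
    fun p hp => (hd p hp).differentiableAt
  filter_upwards [this] with p hp hpU hp0
  have h0 := hp hpU hp0
  rw [(hd p hpU).fderiv] at h0
  have h1 := congrArg (fun A : ℝ × ℝ →L[ℝ] ℝ => A (1, 0)) h0
  have h2 := congrArg (fun A : ℝ × ℝ →L[ℝ] ℝ => A (0, 1)) h0
  simp [hD] at h1 h2
  exact ⟨h1, h2⟩

/-- Dominated convergence on the section. The minus sign is that of the step, which decreases along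
the normal. -/
theorem tendsto_vertexFlux (hn : n.IsSmooth) :
    Tendsto (fun k => P.vertexFlux k n.toFun (fderiv ℝ n.toFun) v) atTop
      (𝓝 (-(4 * Real.pi * n.sectionArea S))) := by
  obtain ⟨σ, hσ0, hσ⟩ := S.exists_height_gt
  obtain ⟨C, R, hCR⟩ := exists_bound_sectionDensity S hn hσ
  have hpc : Continuous S.point := by
    unfold VertexSection.point
    fun_prop
  have hms : MeasurableSet {p : ℝ × ℝ | S.point p ∈ interior P.body} :=
    (isOpen_interior.preimage hpc).measurableSet
  have h4 : 4 * Real.pi * n.sectionArea S =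
      ∫ p, ({p : ℝ × ℝ | S.point p ∈ interior P.body}).indicator
      (fun s => tripleProduct (n.toFun (S.point s)) (fderiv ℝ n.toFun (S.point s) S.t₁)
        (fderiv ℝ n.toFun (S.point s) S.t₂)) p := by
    rw [TangentField.sectionArea, integral_indicator hms, ← mul_assoc, mul_one_div_cancel, one_mul]
    positivity
  rw [h4]
  simp only [vertexFlux_eq_integral_sectionDensity S hn]
  refine Tendsto.neg (tendsto_integral_of_dominated_convergence
    ((Metric.closedBall (0 : ℝ × ℝ) R).indicator fun _ => C) (fun k => ?_) ?_ (fun k => ?_) ?_)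
  · refine Continuous.aestronglyMeasurable (continuous_iff_continuousAt.2 fun p => ?_)
    have := continuousAt_sectionDensity (n := n) S hn hσ k (x := S.point p)
      (by have := S.height_add 0 p; rw [zero_smul, add_zero] at this; rw [this]; simpa using hσ0)
    exact this.comp hpc.continuousAt
  · exact (integrable_indicator_iff measurableSet_closedBall).2
      (integrableOn_const measure_closedBall_lt_top.ne)
  · refine Eventually.of_forall fun p => ?_
    have := hCR k 0 p (by simpa using hσ0.le)
    rwa [zero_smul, add_zero] at this
  · have hae := (ae_ball_iff P.normals.countable_toSet).2
      fun ν _ => ae_inner_eq_zero_imp (n := n) S hn ν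
    filter_upwards [hae] with p hp
    by_cases hpU : S.point p ∈ interior P.body
    · have hu1 := n.norm_toFun (P.interior_subset_domain hpU)
      have e1 : ∀ k, sectionDensity n S k (S.point p) = P.cutoff k (n.toFun (S.point p)) *
          tripleProduct (n.toFun (S.point p)) (fderiv ℝ n.toFun (S.point p) S.t₁)
            (fderiv ℝ n.toFun (S.point p) S.t₂) := by
        intro k
        rw [sectionDensity, Set.indicator_of_mem hpU, P.cutoffField_of_norm_eq_one hu1,
          tripleProduct_eq, tripleProduct_eq]
        simp only [PiLp.smul_apply, smul_eq_mul]
        ring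
      simp only [e1]
      rw [Set.indicator_of_mem (by exact hpU)]
      -- Either the cut-off tends to `1`, or `n` and both derivatives lie in the plane orthogonal to
      -- some `ν`, and then the uncut density is already zero.
      by_cases hne : ∀ ν ∈ P.normals, inner ℝ ν (n.toFun (S.point p)) ≠ 0
      · have := (P.tendsto_cutoff (norm_ne_zero_iff.1 (hu1.trans_ne one_ne_zero)) hne).mul_const
          (tripleProduct (n.toFun (S.point p)) (fderiv ℝ n.toFun (S.point p) S.t₁)
            (fderiv ℝ n.toFun (S.point p) S.t₂))
        rwa [one_mul] at this
      · push Not at hne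
        obtain ⟨ν, hν, hν0⟩ := hne
        obtain ⟨h1, h2⟩ := hp ν hν hpU hν0
        have hν1 : ν ≠ 0 := norm_ne_zero_iff.1 ((P.mem_normals.1 hν).1.trans_ne one_ne_zero)
        rw [tripleProduct_eq_zero_of_inner_eq_zero hν1 hν0 h1 h2]
        simp
    · have e1 : ∀ k, sectionDensity n S k (S.point p) = 0 := fun k => by
        rw [sectionDensity, Set.indicator_of_notMem hpU]
      simp only [e1]
      rw [Set.indicator_of_notMem (by exact hpU)]
      exact tendsto_const_nhds

end ConvexPolyhedron
end

/-! ### The energy inequality and the test functions -/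

noncomputable section

open MeasureTheory Filter Topology

/-- The area density is at most half of the energy density. -/
theorem abs_fluxDensity_le_half {b : E3} (hb : ‖b‖ ≤ 1) (G : E3 →L[ℝ] E3) {p : E3 →L[ℝ] ℝ}
    (hp : ‖p‖ ≤ 1) : |fluxDensity b G p| ≤ 1 / 2 * ∑ i, ‖G (stdVec i)‖ ^ 2 := by
  set w₀ := G (stdVec 0) with hw₀
  set w₁ := G (stdVec 1) with hw₁
  set w₂ := G (stdVec 2) with hw₂
  set p₀ := p (stdVec 0) with hp₀
  set p₁ := p (stdVec 1) with hp₁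
  set p₂ := p (stdVec 2) with hp₂
  have hp2 : p₀ ^ 2 + p₁ ^ 2 + p₂ ^ 2 ≤ 1 := by
    set q : E3 := p₀ • stdVec 0 + p₁ • stdVec 1 + p₂ • stdVec 2 with hq
    have h1 : p q = p₀ ^ 2 + p₁ ^ 2 + p₂ ^ 2 := by
      simp only [hq, map_add, map_smul, smul_eq_mul, ← hp₀, ← hp₁, ← hp₂]; ring
    have h2 : ‖q‖ ^ 2 = p₀ ^ 2 + p₁ ^ 2 + p₂ ^ 2 := by
      rw [← real_inner_self_eq_norm_sq, inner_eq_sum]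
      simp [hq, stdVec]
      ring
    have h3 := (le_abs_self _).trans (p.le_opNorm q)
    rw [h1, ← h2] at h3
    have h4 : ‖q‖ ^ 2 ≤ 1 * ‖q‖ := h3.trans (mul_le_mul_of_nonneg_right hp (norm_nonneg _))
    have h5 : ‖q‖ ≤ 1 := by nlinarith [norm_nonneg q]
    rw [← h2]
    exact pow_le_one₀ (norm_nonneg _) h5
  have hcr : ∀ w : E3, ‖crossVec b w‖ ^ 2 ≤ ‖w‖ ^ 2 := fun w => by
    rw [← real_inner_self_eq_norm_sq, inner_crossVec_self, real_inner_self_eq_norm_sq,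
      real_inner_self_eq_norm_sq]
    have : ‖b‖ ^ 2 ≤ 1 := pow_le_one₀ (norm_nonneg _) hb
    nlinarith [sq_nonneg ‖w‖, sq_nonneg (inner ℝ b w)]
  set z₀ := p₂ • w₁ - p₁ • w₂ with hz₀
  set z₁ := p₀ • w₂ - p₂ • w₀ with hz₁
  set z₂ := p₁ • w₀ - p₀ • w₁ with hz₂
  -- Lagrange's identity for the cross product of `p` with the columns of `G`.
  have hz : ‖z₀‖ ^ 2 + ‖z₁‖ ^ 2 + ‖z₂‖ ^ 2 ≤ ‖w₀‖ ^ 2 + ‖w₁‖ ^ 2 + ‖w₂‖ ^ 2 := by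
    have h1 : ‖z₀‖ ^ 2 + ‖z₁‖ ^ 2 + ‖z₂‖ ^ 2 + ‖p₀ • w₀ + p₁ • w₁ + p₂ • w₂‖ ^ 2 =
        (p₀ ^ 2 + p₁ ^ 2 + p₂ ^ 2) * (‖w₀‖ ^ 2 + ‖w₁‖ ^ 2 + ‖w₂‖ ^ 2) := by
      simp only [← real_inner_self_eq_norm_sq, inner_eq_sum, hz₀, hz₁, hz₂, PiLp.add_apply,
        PiLp.sub_apply, PiLp.smul_apply, smul_eq_mul]
      ring
    have h2 := sq_nonneg ‖p₀ • w₀ + p₁ • w₁ + p₂ • w₂‖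
    have h3 : 0 ≤ ‖w₀‖ ^ 2 + ‖w₁‖ ^ 2 + ‖w₂‖ ^ 2 := by positivity
    nlinarith
  -- Written symmetrically, each product occurs twice. This is what makes the sharp constant `1 / 2`
  -- come out of the arithmetic–geometric mean inequality below.
  have hQ : 2 * fluxDensity b G p = inner ℝ (crossVec b w₀) z₀ + inner ℝ (crossVec b w₁) z₁ +
      inner ℝ (crossVec b w₂) z₂ := by
    simp only [fluxDensity, ← hw₀, ← hw₁, ← hw₂, ← hp₀, ← hp₁, ← hp₂, inner_crossVec,
      tripleProduct_eq, hz₀, hz₁, hz₂, PiLp.sub_apply, PiLp.smul_apply, smul_eq_mul]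
    ring
  have hi : ∀ w z : E3, |inner ℝ (crossVec b w) z| ≤ (‖w‖ ^ 2 + ‖z‖ ^ 2) / 2 := fun w z => by
    have h1 := abs_real_inner_le_norm (crossVec b w) z
    have h2 := hcr w
    nlinarith [sq_nonneg (‖crossVec b w‖ - ‖z‖)]
  have h0 := abs_le.1 (hi w₀ z₀)
  have h1 := abs_le.1 (hi w₁ z₁)
  have h2 := abs_le.1 (hi w₂ z₂)
  rw [Fin.sum_univ_three, ← hw₀, ← hw₁, ← hw₂, abs_le]
  constructor <;> linarith [h0.1, h0.2, h1.1, h1.2, h2.1, h2.2]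

theorem ContinuousLinearMap.enorm_sq_le_sum_stdVec (G : E3 →L[ℝ] E3) :
    ‖G‖ₑ ^ 2 ≤ 3 * ∑ i, ‖G (stdVec i)‖ₑ ^ 2 := by
  have h1 : ‖G‖ ≤ ∑ i, ‖G (stdVec i)‖ := by
    refine G.opNorm_le_bound (by positivity) fun x => ?_
    rw [G.apply_eq_sum_stdVec x, Fin.sum_univ_three, add_mul, add_mul]
    refine (norm_add₃_le).trans ?_
    simp only [norm_smul, Real.norm_eq_abs]
    have h := fun i => mul_le_mul_of_nonneg_right (abs_apply_le_norm x i)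
      (norm_nonneg (G (stdVec i)))
    linarith [h 0, h 1, h 2]
  have h2 : ‖G‖ ^ 2 ≤ 3 * ∑ i, ‖G (stdVec i)‖ ^ 2 := by
    rw [Fin.sum_univ_three] at h1 ⊢
    set a := ‖G (stdVec 0)‖
    set b := ‖G (stdVec 1)‖
    set c := ‖G (stdVec 2)‖
    have h3 : ‖G‖ ^ 2 ≤ (a + b + c) ^ 2 := pow_le_pow_left₀ (norm_nonneg _) h1 2
    nlinarith [sq_nonneg (a - b), sq_nonneg (b - c), sq_nonneg (a - c)]
  have h3 := ENNReal.ofReal_le_ofReal h2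
  rw [ENNReal.ofReal_mul (by norm_num), ENNReal.ofReal_sum_of_nonneg fun _ _ => by positivity] at h3
  simpa only [ENNReal.ofReal_pow (norm_nonneg _), ofReal_norm, ENNReal.ofReal_ofNat] using h3

namespace ConvexPolyhedron

variable {P : ConvexPolyhedron}

theorem TangentField.isAdmissible_of_lintegral_ne_top {n : P.TangentField} {G : E3 → E3 →L[ℝ] E3}
    (hG : IsWeakGradient (interior P.body) n.toFun G)
    (hE : ∫⁻ x in interior P.body, ∑ i, ‖G x (stdVec i)‖ₑ ^ 2 ≠ ⊤) : P.IsAdmissible n.toFun G := by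
  refine n.isAdmissible hG fun C hCU hC => ⟨?_, ?_⟩
  · exact (hG.1.integrableOn_compact_subset hCU hC).aestronglyMeasurable
  · have h1 : eLpNorm G 2 (volume.restrict C) ^ 2 < ⊤ := by
      rw [eLpNorm_two_sq]
      calc ∫⁻ x in C, ‖G x‖ₑ ^ 2 ≤ ∫⁻ x in interior P.body, ‖G x‖ₑ ^ 2 :=
            lintegral_mono_set hCU
        _ ≤ ∫⁻ x in interior P.body, 3 * ∑ i, ‖G x (stdVec i)‖ₑ ^ 2 :=
            lintegral_mono fun x => (G x).enorm_sq_le_sum_stdVec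
        _ = 3 * ∫⁻ x in interior P.body, ∑ i, ‖G x (stdVec i)‖ₑ ^ 2 :=
            lintegral_const_mul' _ _ (by norm_num)
        _ < ⊤ := ENNReal.mul_lt_top (by norm_num) hE.lt_top
    by_contra h2
    rw [not_lt, top_le_iff] at h2
    rw [h2] at h1
    simp at h1

theorem two_mul_enorm_flux_le (n : P.TangentField) (G : E3 → E3 →L[ℝ] E3) (k : ℕ) {φ : E3 → ℝ}
    (hφ : ∀ x, ‖fderiv ℝ φ x‖ ≤ 1) :
    2 * ‖P.flux k n.toFun G φ‖ₑ ≤ ∫⁻ x in interior P.body, ∑ i, ‖G x (stdVec i)‖ₑ ^ 2 := by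
  rw [flux]
  refine (mul_le_mul_right (enorm_integral_le_lintegral_enorm _) 2).trans ?_
  rw [← lintegral_const_mul' _ _ (by norm_num)]
  refine setLIntegral_mono' isOpen_interior.measurableSet fun x hx => ?_
  have h1 := abs_fluxDensity_le_half
    (P.norm_cutoffField_le (k := k) (n.norm_toFun (P.interior_subset_domain hx))) (G x) (hφ x)
  have h2 : 2 * ‖fluxDensity (P.cutoffField k (n.toFun x)) (G x) (fderiv ℝ φ x)‖ ≤
      ∑ i, ‖G x (stdVec i)‖ ^ 2 := by
    rw [Real.norm_eq_abs]; linarith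
  have h3 := ENNReal.ofReal_le_ofReal h2
  rw [ENNReal.ofReal_mul (by norm_num), ENNReal.ofReal_sum_of_nonneg fun _ _ => by positivity] at h3
  simpa only [ENNReal.ofReal_pow (norm_nonneg _), ofReal_norm, ENNReal.ofReal_ofNat] using h3

theorem nonempty_vertices : Nonempty P.vertices := by
  obtain ⟨q, hq, -⟩ := P.exists_vertex_inner_ne (w := stdVec 0)
    (norm_ne_zero_iff.1 ((norm_stdVec 0).trans_ne one_ne_zero)) 0
  exact ⟨⟨q, hq⟩⟩

/-- Smooth functions of slope at most `1` with prescribed values at the vertices. -/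
theorem exists_isVertexConst {ξ : P.vertices → ℝ}
    (hξ : ∀ v w : P.vertices, |ξ v - ξ w| ≤ ‖(v : E3) - (w : E3)‖) {θ : ℝ} (hθ0 : 0 ≤ θ)
    (hθ1 : θ < 1) :
    ∃ φ : E3 → ℝ, P.IsVertexConst φ ∧ (∀ v : P.vertices, φ v = θ * ξ v) ∧
      ∀ x, ‖fderiv ℝ φ x‖ ≤ 1 := by
  have := P.nonempty_vertices
  -- Shrinking `ξ` by `θ` leaves a slack of `(1 - θ)` times the distance in each constraint, enough
  -- to flatten the tips of the cones `g v` on balls of radius `ρ`.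
  set ρ : ℝ := (1 - θ) * P.vertexRadius with hρ
  have hρ0 : 0 < ρ := mul_pos (by linarith) P.vertexRadius_pos
  let g : P.vertices → E3 → ℝ := fun v x => θ * ξ v + max 0 (dist x v - ρ)
  let f : E3 → ℝ := fun x => Finset.univ.inf' Finset.univ_nonempty fun v => g v x
  have hgl : ∀ v x y, g v x ≤ g v y + dist x y := by
    intro v x y
    have h1 := dist_triangle x y v
    have h2 : max 0 (dist x v - ρ) ≤ max 0 (dist y v - ρ) + dist x y :=
      max_le (by positivity) (by linarith [le_max_right 0 (dist y v - ρ)])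
    simp only [g]
    linarith
  have hfl : LipschitzWith 1 f := by
    refine LipschitzWith.of_le_add fun x y => ?_
    obtain ⟨v, -, hv⟩ := Finset.exists_mem_eq_inf' Finset.univ_nonempty fun v : P.vertices => g v y
    calc f x ≤ g v x := Finset.inf'_le _ (Finset.mem_univ v)
      _ ≤ g v y + dist x y := hgl v x y
      _ = f y + dist x y := by rw [← hv]
  have hfv : ∀ (v : P.vertices) (x : E3), dist x v ≤ ρ → f x = θ * ξ v := by
    intro v x hx
    apply le_antisymm
    · refine (Finset.inf'_le _ (Finset.mem_univ v)).trans ?_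
      simp only [g, max_eq_left (show dist x v - ρ ≤ 0 by linarith), add_zero, le_refl]
    · refine Finset.le_inf' _ _ fun w _ => ?_
      by_cases hwv : w = v
      · rw [hwv]
        simp only [g]
        linarith [le_max_left 0 (dist x v - ρ)]
      · have h1 := lt_dist_vertices v.2 w.2 fun h => hwv (Subtype.ext h)
        have h2 := (le_abs_self _).trans (hξ v w)
        rw [← dist_eq_norm] at h2
        rw [dist_comm] at h1
        have h3 := dist_triangle_left (v : E3) w x
        have h4 : 0 < 1 - θ := by linarith
        have h5 : (1 - θ) * (10 * P.vertexRadius) ≤ (1 - θ) * dist (v : E3) w :=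
          mul_le_mul_of_nonneg_left h1.le h4.le
        have h6 : θ * (ξ v - ξ w) ≤ θ * dist (v : E3) w := mul_le_mul_of_nonneg_left h2 hθ0
        simp only [g]
        nlinarith [le_max_right 0 (dist x w - ρ)]
  -- An average over radius `ρ / 2` does not increase the Lipschitz constant, and keeps `f` constant
  -- on balls of radius `ρ / 2` around the vertices.
  let ψ : ContDiffBump (0 : E3) := ⟨ρ / 4, ρ / 2, by linarith, by linarith⟩
  set φ : E3 → ℝ := convolution (ψ.normed volume) f (ContinuousLinearMap.lsmul ℝ ℝ) volume with hφ
  have hfc : Continuous f := hfl.continuous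
  have hval : ∀ (v : P.vertices) (x : E3), dist x v < ρ / 2 → φ x = θ * ξ v := by
    intro v x hx
    rw [hφ, ψ.normed_convolution_eq_right, hfv v x (by linarith)]
    intro y hy
    have hy' : dist y x < ρ / 2 := hy
    have := dist_triangle y x v
    rw [hfv v x (by linarith), hfv v y (by linarith)]
  refine ⟨φ, ⟨?_, fun w hw => ?_⟩, fun v => hval v v (by rw [dist_self]; linarith), fun x => ?_⟩
  · exact ψ.hasCompactSupport_normed.contDiff_convolution_left _ ψ.contDiff_normed
      hfc.locallyIntegrable
  · have hc : ContinuousAt (fun y => dist y w) w := by fun_prop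
    filter_upwards [hc.eventually_lt_const (show dist w w < ρ / 2 by rw [dist_self]; linarith)]
      with y hy
    rw [hval ⟨w, hw⟩ y hy, hval ⟨w, hw⟩ w (by rw [dist_self]; linarith)]
  · have hlip : LipschitzWith 1 φ := by
      refine LipschitzWith.of_le_add fun x y => ?_
      have hint : ∀ x, Integrable fun t => ψ.normed volume t * f (x - t) := fun x =>
        (ψ.continuous_normed.mul (hfc.comp (continuous_sub_left x))).integrable_of_hasCompactSupport
          ψ.hasCompactSupport_normed.mul_right
      have hψ : Integrable fun t => ψ.normed volume t * dist x y := ψ.integrable_normed.mul_const _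
      have h1 : φ y + dist x y = ∫ t, (ψ.normed volume t * f (y - t) +
          ψ.normed volume t * dist x y) := by
        rw [integral_add (hint y) hψ, integral_mul_const, ψ.integral_normed, one_mul]
        rfl
      rw [h1]
      change ∫ t, ψ.normed volume t * f (x - t) ≤ _
      refine integral_mono (hint x) ((hint y).add hψ) fun t => ?_
      have h2 : f (x - t) ≤ f (y - t) + dist x y := by
        have := hfl.dist_le_mul (x - t) (y - t)
        rw [dist_sub_right, NNReal.coe_one, one_mul, Real.dist_eq] at this
        linarith [le_abs_self (f (x - t) - f (y - t))]
      have := mul_le_mul_of_nonneg_left h2 (ψ.nonneg_normed (μ := volume) t)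
      change ψ.normed volume t * f (x - t) ≤ ψ.normed volume t * f (y - t) +
        ψ.normed volume t * dist x y
      linarith
    simpa using norm_fderiv_le_of_lipschitz ℝ hlip (x₀ := x)

end ConvexPolyhedron
end

/-! ### Trapped areas, the lower bound and its maximum -/

noncomputable section

namespace ConvexPolyhedron

variable {P : ConvexPolyhedron}

open MeasureTheory Filter Topology

/-- Both areas are determined by the limit of one sequence, as `vertexFlux` involves no section and
is homotopy invariant for each `k`. -/
theorem sectionArea_eq_of_homotopic {n n' : P.TangentField}
    (hnn' : ContinuousMap.HomotopicWith n.1 n'.1 P.IsTangent) (hn : n.IsSmooth) (hn' : n'.IsSmooth)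
    {v : P.vertices} (S S' : VertexSection P v) : n.sectionArea S = n'.sectionArea S' := by
  have h1 := tendsto_vertexFlux S hn
  have h2 := tendsto_vertexFlux S' hn'
  simp only [vertexFlux_eq_of_homotopic hnn' hn.isAdmissible hn'.isAdmissible _ v.2] at h1
  have h3 := neg_injective (tendsto_nhds_unique h1 h2)
  exact mul_left_cancel₀ (by positivity) h3

/-- The area of the image, under a field, of some section around a vertex. -/
def TangentField.vertexArea (n : P.TangentField) (v : P.vertices) : ℝ :=
  n.sectionArea (Classical.choice (nonempty_vertexSection v))

theorem TangentField.IsSmooth.isTrappedArea {n : P.TangentField} (hn : n.IsSmooth) :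
    IsTrappedArea (⟦n⟧ : P.HomotopyClass) n.vertexArea :=
  ⟨⟨n, rfl, hn⟩, fun _ hm hms _ S =>
    sectionArea_eq_of_homotopic (Quotient.exact hm) hms hn S _⟩

theorem tendsto_sum_vertexFlux {n : P.TangentField} (hn : n.IsSmooth) (ξ : P.vertices → ℝ) :
    Tendsto (fun k => ∑ v : P.vertices, ξ v * P.vertexFlux k n.toFun (fderiv ℝ n.toFun) v) atTop
      (𝓝 (-(4 * Real.pi * ∑ v : P.vertices, n.vertexArea v * ξ v))) := by
  have h := tendsto_finsetSum Finset.univ fun (v : P.vertices) _ => (tendsto_vertexFlux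
    (Classical.choice (nonempty_vertexSection v)) hn).const_mul (ξ v)
  convert h using 2
  rw [Finset.mul_sum, ← Finset.sum_neg_distrib]
  refine Finset.sum_congr rfl fun v _ => ?_
  rw [TangentField.vertexArea]
  ring

/-- The constant function `1` has zero flux, which by `IsAdmissible.flux_eq_sum` is the sum of the
vertex fluxes. -/
theorem sum_vertexArea {n : P.TangentField} (hn : n.IsSmooth) :
    ∑ v : P.vertices, n.vertexArea v = 0 := by
  have h0 : ∀ k, ∑ v : P.vertices, (1 : ℝ) * P.vertexFlux k n.toFun (fderiv ℝ n.toFun) v = 0 := by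
    intro k
    have hc : P.IsVertexConst fun _ => 1 := ⟨contDiff_const, fun _ _ => Eventually.of_forall
      fun _ => rfl⟩
    rw [← hn.isAdmissible.flux_eq_sum k hc, flux]
    simp [fluxDensity_zero_right]
  have h1 := tendsto_sum_vertexFlux hn fun _ => 1
  simp only [h0, mul_one] at h1
  have h2 := tendsto_nhds_unique h1 tendsto_const_nhds
  have h3 : 4 * Real.pi ≠ 0 := by positivity
  rw [neg_eq_zero, mul_eq_zero] at h2
  exact h2.resolve_left h3

/-- The lower bound for the energy of a field homotopic to a smooth one. -/
theorem ofReal_le_lintegral {n m : P.TangentField} (hn : n.IsSmooth)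
    (hmn : ContinuousMap.HomotopicWith m.1 n.1 P.IsTangent) {G : E3 → E3 →L[ℝ] E3}
    (hG : IsWeakGradient (interior P.body) m.toFun G) {ξ : P.vertices → ℝ}
    (hξ : ∀ v w : P.vertices, |ξ v - ξ w| ≤ ‖(v : E3) - (w : E3)‖) :
    ENNReal.ofReal (8 * Real.pi * ∑ v : P.vertices, n.vertexArea v * ξ v) ≤
      ∫⁻ x in interior P.body, ∑ i, ‖G x (stdVec i)‖ₑ ^ 2 := by
  by_cases hE : ∫⁻ x in interior P.body, ∑ i, ‖G x (stdVec i)‖ₑ ^ 2 = ⊤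
  · rw [hE]; exact le_top
  have hA := TangentField.isAdmissible_of_lintegral_ne_top hG hE
  set E := (∫⁻ x in interior P.body, ∑ i, ‖G x (stdVec i)‖ₑ ^ 2).toReal with hEd
  rw [← ENNReal.ofReal_toReal hE]
  refine ENNReal.ofReal_le_ofReal ?_
  set B := 8 * Real.pi * ∑ v : P.vertices, n.vertexArea v * ξ v with hB
  have hθ : ∀ θ ∈ Set.Ico (0 : ℝ) 1, θ * B ≤ E := by
    intro θ hθ
    obtain ⟨φ, hφ, hφv, hφ1⟩ := exists_isVertexConst hξ hθ.1 hθ.2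
    -- The flux of the competitor `m` obeys the energy bound, and its vertex fluxes equal those of
    -- the smooth field `n`, whose limits are known.
    have hk : ∀ k, -E / 2 ≤
        ∑ v : P.vertices, θ * ξ v * P.vertexFlux k n.toFun (fderiv ℝ n.toFun) v := by
      intro k
      have h1 := two_mul_enorm_flux_le m G k hφ1
      rw [hA.flux_eq_sum k hφ] at h1
      simp only [vertexFlux_eq_of_homotopic hmn hA hn.isAdmissible k (Subtype.mem _), hφv] at h1
      have h2 := ENNReal.toReal_mono hE h1
      rw [ENNReal.toReal_mul, toReal_enorm, Real.norm_eq_abs, ENNReal.toReal_ofNat] at h2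
      have h3 := neg_abs_le
        (∑ v : P.vertices, θ * ξ v * P.vertexFlux k n.toFun (fderiv ℝ n.toFun) v)
      linarith
    have h4 := ge_of_tendsto' (tendsto_sum_vertexFlux hn fun v => θ * ξ v) hk
    have h5 : ∑ v : P.vertices, n.vertexArea v * (θ * ξ v) =
        θ * ∑ v : P.vertices, n.vertexArea v * ξ v := by
      rw [Finset.mul_sum]
      exact Finset.sum_congr rfl fun v _ => by ring
    rw [h5] at h4
    rw [hB]
    linarith
  have ht : Tendsto (fun θ : ℝ => θ * B) (𝓝[<] 1) (𝓝 (1 * B)) :=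
    ((continuous_id.mul continuous_const).tendsto 1).mono_left inf_le_left
  rw [one_mul] at ht
  refine le_of_tendsto ht ?_
  filter_upwards [Ioo_mem_nhdsLT (show (0 : ℝ) < 1 by norm_num)] with θ hθ'
  exact hθ θ ⟨hθ'.1.le, hθ'.2⟩

/-- As `∑ Ω = 0`, adding a constant to `ξ` changes nothing. Normalized to vanish at `v₀`, the
admissible `ξ` form a compact set. -/
theorem exists_isGreatest_boundValues {Ω : P.vertices → ℝ} (hΩ : ∑ v, Ω v = 0) :
    ∃ B, IsGreatest (boundValues Ω) B := by
  obtain ⟨v₀⟩ := P.nonempty_vertices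
  set X : Set (P.vertices → ℝ) := {ξ | (∀ v w : P.vertices, |ξ v - ξ w| ≤ ‖(v : E3) - (w : E3)‖) ∧
    ξ v₀ = 0} with hX
  have hXc : IsClosed X := by
    have h1 : IsClosed {ξ : P.vertices → ℝ |
        ∀ v w : P.vertices, |ξ v - ξ w| ≤ ‖(v : E3) - (w : E3)‖} := by
      simp only [Set.ofPred_forall]
      exact isClosed_iInter fun v => isClosed_iInter fun w =>
        isClosed_le (by fun_prop) continuous_const
    exact h1.inter (isClosed_eq (continuous_apply v₀) continuous_const)
  have hXb : X ⊆ Set.univ.pi fun v : P.vertices =>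
      Set.Icc (-‖(v : E3) - (v₀ : E3)‖) ‖(v : E3) - (v₀ : E3)‖ := by
    intro ξ hξ v _
    have := hξ.1 v v₀
    rw [hξ.2, sub_zero] at this
    exact abs_le.1 this
  have hXk : IsCompact X :=
    (isCompact_univ_pi fun _ => isCompact_Icc).of_isClosed_subset hXc hXb
  have hX0 : X.Nonempty := ⟨0, fun v w => by simp, rfl⟩
  obtain ⟨ξ, hξ, hmax⟩ := hXk.exists_isMaxOn hX0
    (f := fun ξ : P.vertices → ℝ => 8 * Real.pi * ∑ v, Ω v * ξ v)
    (Continuous.continuousOn (by fun_prop))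
  refine ⟨_, ⟨ξ, hξ.1, rfl⟩, ?_⟩
  rintro _ ⟨η, hη, rfl⟩
  have h1 := hmax (show (fun v => η v - η v₀) ∈ X from ⟨fun v w => by simpa using hη v w, by simp⟩)
  have h2 : ∑ v, Ω v * (η v - η v₀) = ∑ v, Ω v * η v := by
    simp only [mul_sub]
    rw [Finset.sum_sub_distrib, ← Finset.sum_mul, hΩ, zero_mul, sub_zero]
  have h3 : 8 * Real.pi * ∑ v, Ω v * (η v - η v₀) ≤ 8 * Real.pi * ∑ v, Ω v * ξ v := h1
  rwa [h2] at h3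

theorem pos_iff_of_isGreatest_boundValues {Ω : P.vertices → ℝ} {B : ℝ}
    (hB : IsGreatest (boundValues Ω) B) : 0 < B ↔ ∃ v, Ω v ≠ 0 := by
  constructor
  · obtain ⟨ξ, -, rfl⟩ := hB.1
    intro h
    by_contra! h0
    simp [h0] at h
  · rintro ⟨v, hv⟩
    classical
    -- A competitor supported at the single vertex `v`, with the sign of `Ω v`, and admissible
    -- because its size is below the distance between any two vertices.
    set c := P.vertexRadius * (Ω v / |Ω v|) with hc
    have hr := P.vertexRadius_pos
    have hΩ : 0 < |Ω v| := abs_pos.2 hv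
    have hcr : |c| = P.vertexRadius := by
      rw [hc, abs_mul, abs_div, abs_abs, div_self hΩ.ne', mul_one, abs_of_pos hr]
    have hmem : 8 * Real.pi * ∑ w, Ω w * Pi.single (M := fun _ => ℝ) v c w ∈ boundValues Ω := by
      refine ⟨_, fun a b => ?_, rfl⟩
      by_cases hab : a = b
      · simp [hab]
      · have h1 := lt_dist_vertices b.2 a.2 fun h => hab (Subtype.ext h)
        rw [dist_eq_norm] at h1
        have h2 : |Pi.single (M := fun _ => ℝ) v c a - Pi.single (M := fun _ => ℝ) v c b| ≤ |c| := by
          by_cases ha : a = v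
          · subst ha
            rw [Pi.single_eq_same, Pi.single_eq_of_ne (Ne.symm hab), sub_zero]
          · rw [Pi.single_eq_of_ne ha]
            by_cases hb : b = v
            · subst hb
              rw [Pi.single_eq_same, zero_sub, abs_neg]
            · rw [Pi.single_eq_of_ne hb, sub_zero, abs_zero]
              exact abs_nonneg _
        linarith
    refine lt_of_lt_of_le ?_ (hB.2 hmem)
    have hsum : ∑ w, Ω w * Pi.single (M := fun _ => ℝ) v c w = Ω v * c := by
      rw [Finset.sum_eq_single v (fun w _ hw => by rw [Pi.single_eq_of_ne hw, mul_zero]) (by simp),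
        Pi.single_eq_same]
    have hpos : Ω v * c = P.vertexRadius * |Ω v| := by
      rw [hc, mul_left_comm, ← mul_div_assoc, ← abs_mul_abs_self, mul_div_assoc, div_self hΩ.ne',
        mul_one]
    rw [hsum, hpos]
    positivity

end ConvexPolyhedron

end

theorem theorem1 (P : ConvexPolyhedron) (h : P.HomotopyClass) :
    ∃ Ω : P.vertices → ℝ, ConvexPolyhedron.IsTrappedArea h Ω ∧
      ∃ B : ℝ, IsGreatest (ConvexPolyhedron.boundValues Ω) B ∧
        ENNReal.ofReal B ≤ ConvexPolyhedron.minEnergy h ∧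
        (0 < B ↔ ∃ v : P.vertices, Ω v ≠ 0) := by
  obtain ⟨n, rfl, hn⟩ := ConvexPolyhedron.exists_smooth_representative h
  obtain ⟨B, hB⟩ :=
    ConvexPolyhedron.exists_isGreatest_boundValues (ConvexPolyhedron.sum_vertexArea hn)
  refine ⟨n.vertexArea, hn.isTrappedArea, B, hB, ?_,
    ConvexPolyhedron.pos_iff_of_isGreatest_boundValues hB⟩
  obtain ⟨ξ, hξ, rfl⟩ := hB.1
  exact le_iInf fun m => le_iInf fun hm => le_iInf fun _ => le_iInf fun G => le_iInf fun hG =>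
    ConvexPolyhedron.ofReal_le_lintegral hn (Quotient.exact hm) hG hξ
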